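/- **Setting.** A (connected) 1-linkoid universe $U$ is a connected graph embedded in $S^2$ with $n$ four-valent vertices (crossings) and two univalent vertices, the tail and the head. The region containing the tail is starred. A clock state $s$ places one marker at each crossing, in one of its four corners, so that every unstarred region contains exactly one marker and the starred region none. A clock move turns markers by $90^\circ$, clockwise or counterclockwise, and yields another state: either the markers at two crossings turn in the same sense and exchange their regions, or one marker turns inside its region (across a half-edge leading to the head, possibly through a knotted portion). Smoothing every crossing so that the marked corner is joined with the opposite one gives a trail, i.e. a path from the tail to the head that passes each edge exactly once and does not cross itself. A trail $T_2$ is obtained from a trail $T_1$ by an exchange if $T_2$ results from $T_1$ by changing the smoothing at one site (single) or at two sites (double), the exchange sites. For trails coming from states $s_1,s_2$, the exchange is clockwise (counterclockwise) if the markers at its sites in $s_2$ are those of $s_1$ turned by $90^\circ$ clockwise (counterclockwise). An exchange is indivisible if it is not a double exchange each of whose two sites could be changed on its own so that the result is a trail. Let an exchange on $T_1$ be given and cut $T_1$ at the passages through the exchange sites. The mid-line is the piece that begins at the first exchange site met from the tail, with the half-edge opposite to the one along which $T_1$ first arrives there. Let $v$ be a crossing other than an exchange site. It is off the mid-line if neither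 of the two passages of $T_1$ through $v$ lies on the mid-line (this includes self-interactions of the top and bottom parts, in particular those on their riders), a cusp if exactly one does (this includes the sites between the mid-line and the top or bottom part), and a self-interaction site of the mid-line if both do. A (trail-)rider is an arc of the mid-line that contains passages through self-interaction sites, such that every self-interaction site of the mid-line with one passage on the arc has both on it; cusps may lie on it. Two self-interaction sites belong to the same atom if no rider contains exactly one of them. An atom is involved if a cusp lies on the arc of $T_1$ from the first to the last passage through the sites of the atom. An atom $A$ rides on an atom $B\neq A$ if all passages through $A$ lie on the arc spanned in this way by $B$. **Theorem (Clock Theorem Extended).** Let $T_1$, $T_2$ be the trails of two states $s_1$, $s_2$ of a 1-linkoid universe $U$, and suppose that $T_2$ is obtained from $T_1$ by one single or double exchange. If the exchange is indivisible, then it is clockwise or counterclockwise. If the exchange is clockwise (counterclockwise), then there is a finite sequence of clockwise (respectively counterclockwise) clock moves that carries $s_1$ to $s_2$. If moreover the exchange is indivisible, the sequence can be chosen so that the markers turn, in the given sense and in total, as follows. 1. Markers at crossings off the mid-line do not turn at all; in particular those at self-interactions of riders on the top or bottom parts do not. 2. Markers at the exchange sites turn by $90^\circ$. 3. Markers at cusps,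 in particular those between the mid-line and the top or bottom part, turn by $180^\circ$. 4. On a rider of the mid-line on which no cusp lies, no marker turns. The markers of an involved atom of the mid-line turn by $360^\circ$ each, and those of an atom that is not involved do not turn at all. 5. If $A$ and $B$ are atoms of the mid-line, $A$ rides on $B$, and every marker of $A$ turns, then every marker of $B$ turns. -/

import Mathlib

/- Combinatorial 1-linkoid universes in the 2-sphere, their clock states, trails and clock moves.

A connected 1-linkoid universe is a connected planar graph with one 4-valent vertex for each
crossing and two univalent vertices, the tail and the head.  It is recorded as a combinatorial map:
at a crossing `v` the four half-edges are `(v, 0), (v, 1), (v, 2), (v, 3)` in clockwise order. -/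

namespace Linkoid

/-- Half-edges: `Sum.inl (v, i)` is the `i`-th half-edge (in clockwise order) at the crossing `v`,
`Sum.inr false` is the half-edge at the tail and `Sum.inr true` the half-edge at the head. -/
abbrev Dart (V : Type*) := (V × ZMod 4) ⊕ Bool

/-- The half-edge at the tail. -/
abbrev tail {V : Type*} : Dart V := Sum.inr false

/-- The half-edge at the head. -/
abbrev head {V : Type*} : Dart V := Sum.inr true

/-- The `i`-th half-edge at the crossing `v`. -/
abbrev dart {V : Type*} (v : V) (i : ZMod 4) : Dart V := Sum.inl (v, i)

/-- The next half-edge in clockwise order around the same vertex. -/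
def rot {V : Type*} : Dart V → Dart V
  | Sum.inl (v, i) => Sum.inl (v, i + 1)
  | Sum.inr b => Sum.inr b

/-- The orbits of a map `f` (used for permutations of half-edges). -/
abbrev Orbit {α : Type*} (f : α → α) := Quot fun a b => b = f a

/-- A connected 1-linkoid universe in the sphere with crossing set `V`: `opp` sends a half-edge to
the other half of its edge.  Vertices, edges and regions are the orbits of `rot`, of `opp` and of
`opp ∘ rot`, and the sphere is singled out by Euler's formula. -/
structure OneLinkoidUniverse (V : Type*) where
  opp : Dart V → Dart V
  opp_opp : ∀ d, opp (opp d) = d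
  opp_ne : ∀ d, opp d ≠ d
  connected : ∀ a b : Dart V, Relation.ReflTransGen (fun x y => y = rot x ∨ y = opp x) a b
  planar : Nat.card (Orbit (rot : Dart V → Dart V)) + Nat.card (Orbit fun d => opp (rot d)) =
    Nat.card (Orbit opp) + 2

/-- The two senses of rotation in the plane. -/
inductive Sense
  | clockwise
  | counterclockwise

/-- The change of the position of a marker under a 90 degree turn. -/
def Sense.step : Sense → ZMod 4
  | clockwise => 1
  | counterclockwise => -1

/-- A choice of one of the two smoothings at each crossing: `false` opens a passage between the
corners `0` and `2`, and `true` a passage between the corners `1` and `3`.  (Corner `i` at `v` lies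
between the half-edges `i` and `i + 1`.) -/
abbrev Smoothing (V : Type*) := V → Bool

/-- The half-edge with which a half-edge is connected when the crossings are smoothed. -/
def join {V : Type*} (τ : Smoothing V) : Dart V → Dart V
  | Sum.inl (v, i) => Sum.inl (v, (if τ v then 1 else 3) - i)
  | Sum.inr b => Sum.inr b

/-- Markers `s v` sit in the corner `s v` of `v`; every crossing is smoothed in the direction of its
marker, that is, so that the marked corner is joined with the opposite one. -/
def smoothing {V : Type*} (s : V → ZMod 4) : Smoothing V :=
  fun v => decide (s v = 1 ∨ s v = 3)

/-- Resmoothing the sites in `E`. -/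
def resmooth {V : Type*} [DecidableEq V] (τ : Smoothing V) (E : Finset V) : Smoothing V :=
  fun v => if v ∈ E then !τ v else τ v

/-- The markers at the sites in `E` turn by 90 degrees in the sense `δ` between `s₁` and `s₂`. -/
def HasSense {V : Type*} (δ : Sense) (s₁ s₂ : V → ZMod 4) (E : Finset V) : Prop :=
  ∀ v ∈ E, s₂ v = s₁ v + δ.step

namespace OneLinkoidUniverse

variable {V : Type*} (U : OneLinkoidUniverse V)

/-- The regions of the universe. -/
abbrev Region := Orbit fun d : Dart V => U.opp (rot d)

/-- The region that contains the corner between `d` and `rot d`. -/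
def region (d : Dart V) : U.Region := Quot.mk _ d

/-- The starred (exterior) region: the one that contains the tail. -/
def star : U.Region := U.region tail

/-- A clock state: one marker at each crossing, placed in one of its four corners, such that each
unstarred region contains exactly one marker and the starred region none. -/
def IsState (s : V → ZMod 4) : Prop :=
  Set.BijOn (fun v => U.region (dart v (s v))) Set.univ {R | R ≠ U.star}

/-- A clock move in the sense `δ`, between states.  Either a single marker turns by 90 degrees
inside its region (the half-edge that it turns across has the same region on both sides, so it leads
to the head, possibly through a knotted portion), or the markers at two crossings turn by 90 degrees
and thereby exchange their two regions (which meet along the half-edges they turn across). -/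
def ClockMove (δ : Sense) (s s' : V → ZMod 4) : Prop :=
  U.IsState s ∧ U.IsState s' ∧
  ((∃ v, s' v = s v + δ.step ∧ (∀ u, u ≠ v → s' u = s u) ∧
      U.region (dart v (s' v)) = U.region (dart v (s v))) ∨
   (∃ v w, v ≠ w ∧ s' v = s v + δ.step ∧ s' w = s w + δ.step ∧
      (∀ u, u ≠ v → u ≠ w → s' u = s u) ∧
      U.region (dart v (s v)) ≠ U.region (dart w (s w)) ∧
      U.region (dart v (s' v)) = U.region (dart w (s w)) ∧
      U.region (dart w (s' w)) = U.region (dart v (s v))))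

/-- `U.ClockSequence δ s s' t`: there is a finite sequence of clock moves in the sense `δ` from `s`
to `s'` in which the marker at each crossing `v` makes `t v` turns by 90 degrees. -/
inductive ClockSequence (δ : Sense) : (V → ZMod 4) → (V → ZMod 4) → (V → ℕ) → Prop
  | refl (s : V → ZMod 4) : ClockSequence δ s s (fun _ => 0)
  | cons {s s' s'' : V → ZMod 4} {t : V → ℕ} (h : U.ClockMove δ s s')
      (hs : ClockSequence δ s' s'' t) :
      ClockSequence δ s s'' (fun v => (if s' v = s v then 0 else 1) + t v)

/-- The path from the tail in the smoothed universe: `walk τ k` is the half-edge along which the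
`k`-th edge of the path is entered; the half-edge `opp (walk τ k)` is where that edge ends. -/
def walk (τ : Smoothing V) : ℕ → Dart V
  | 0 => tail
  | k + 1 => join τ (U.opp (walk τ k))

/-- A trail: the path from the tail ends at the head after `2n + 1` edges, `n` being the number of
crossings, and it traverses each edge of the universe exactly once. -/
def IsTrail [Fintype V] (τ : Smoothing V) : Prop :=
  U.opp (U.walk τ (2 * Fintype.card V)) = head ∧
  ∀ d, ∃! k, k ≤ 2 * Fintype.card V ∧ (U.walk τ k = d ∨ U.walk τ k = U.opp d)

/-- The trail `τ'` is obtained from the trail `τ` by a single or double exchange at the sites `E`. -/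
def IsExchange [Fintype V] [DecidableEq V] (τ τ' : Smoothing V) (E : Finset V) : Prop :=
  U.IsTrail τ ∧ U.IsTrail τ' ∧ τ' = resmooth τ E ∧ (E.card = 1 ∨ E.card = 2)

/-- The sites `E` of an exchange on `τ` are not two sites each of which can be resmoothed on its own
(in that case the exchange would consist of two separate single exchanges). -/
def Indivisible [Fintype V] [DecidableEq V] (τ : Smoothing V) (E : Finset V) : Prop :=
  ¬ (E.card = 2 ∧ ∀ v ∈ E, U.IsTrail (resmooth τ {v}))

/-- At its `p`-th passage through a crossing the trail passes the crossing `v`. -/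
def PassesAt [Fintype V] (τ : Smoothing V) (p : ℕ) (v : V) : Prop :=
  p ≤ 2 * Fintype.card V ∧ ∃ i, U.walk τ p = dart v i

/-- The edge number `m` of the trail is the one with which the mid-line starts: it contains the
half-edge opposite to the half-edge at which the trail arrives at an exchange site for the first
time. -/
def StartsMidline [Fintype V] (τ : Smoothing V) (E : Finset V) (m : ℕ) : Prop :=
  m ≤ 2 * Fintype.card V ∧
  ∃ p i, ∃ v ∈ E, U.opp (U.walk τ p) = dart v i ∧ (∀ q ≤ p, ∀ u ∈ E, ¬ U.PassesAt τ q u) ∧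
    (U.walk τ m = dart v (i + 2) ∨ U.opp (U.walk τ m) = dart v (i + 2))

/-- The mid-line is the piece that contains the edge of `StartsMidline` when the trail is cut at the
exchange sites.  The `p`-th passage of the trail lies on it if it is a passage through a crossing
outside of `E` and no passage through an exchange site lies between it and that edge. -/
def OnMidline [Fintype V] (τ : Smoothing V) (E : Finset V) (p : ℕ) : Prop :=
  (∃ v, v ∉ E ∧ U.PassesAt τ p v) ∧
  ∃ m, U.StartsMidline τ E m ∧ ∀ q, min m p < q → q ≤ max m p → ∀ u ∈ E, ¬ U.PassesAt τ q u

/-- The site `v` is not an exchange site and does not lie on the mid-line. -/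
def OffMidline [Fintype V] (τ : Smoothing V) (E : Finset V) (v : V) : Prop :=
  v ∉ E ∧ ∀ p, U.PassesAt τ p v → ¬ U.OnMidline τ E p

/-- The site `v` is a cusp between the mid-line and another part of the trail. -/
def IsCusp [Fintype V] (τ : Smoothing V) (E : Finset V) (v : V) : Prop :=
  v ∉ E ∧ (∃ p, U.PassesAt τ p v ∧ U.OnMidline τ E p) ∧ ∃ p, U.PassesAt τ p v ∧ ¬ U.OnMidline τ E p

/-- The site `v` is a self-interaction site of the mid-line. -/
def IsSelfSite [Fintype V] (τ : Smoothing V) (E : Finset V) (v : V) : Prop :=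
  v ∉ E ∧ ∀ p, U.PassesAt τ p v → U.OnMidline τ E p

/-- A trail-rider on the mid-line: an arc of the mid-line, from its `a`-th to its `b`-th passage,
that has self-interactions and does not interact with the rest of the mid-line.  It may have cusps
in common with other parts of the trail. -/
def IsRider [Fintype V] (τ : Smoothing V) (E : Finset V) (a b : ℕ) : Prop :=
  (∀ p, a ≤ p → p ≤ b → U.OnMidline τ E p) ∧
  (∃ v p, U.IsSelfSite τ E v ∧ U.PassesAt τ p v ∧ a ≤ p ∧ p ≤ b) ∧
  ∀ v, U.IsSelfSite τ E v → ∀ p q, U.PassesAt τ p v → U.PassesAt τ q v →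
    a ≤ p → p ≤ b → a ≤ q ∧ q ≤ b

/-- The site `v` lies on the arc from the `a`-th to the `b`-th passage. -/
def LiesOn [Fintype V] (τ : Smoothing V) (a b : ℕ) (v : V) : Prop :=
  ∃ p, U.PassesAt τ p v ∧ a ≤ p ∧ p ≤ b

/-- An atom of the mid-line, given by its self-interaction sites.  The atoms are what is left when
the mid-line is decomposed by removing trail-riders until no further trail-rider can be removed: two
sites belong to the same atom when no trail-rider contains just one of them. -/
def IsAtom [Fintype V] (τ : Smoothing V) (E : Finset V) (A : Set V) : Prop :=
  ∃ u, U.IsSelfSite τ E u ∧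
    A = {v | U.IsSelfSite τ E v ∧
      ∀ a b, U.IsRider τ E a b → (U.LiesOn τ a b u ↔ U.LiesOn τ a b v)}

/-- The `p`-th passage lies on the arc of the trail spanned by the sites in `A`. -/
def InSpan [Fintype V] (τ : Smoothing V) (A : Set V) (p : ℕ) : Prop :=
  ∃ u ∈ A, ∃ v ∈ A, ∃ a b, U.PassesAt τ a u ∧ U.PassesAt τ b v ∧ a ≤ p ∧ p ≤ b

/-- The atom `A` is involved: a cusp between the mid-line and another part of the trail rides on it
(directly or on a rider of it). -/
def IsInvolved [Fintype V] (τ : Smoothing V) (E : Finset V) (A : Set V) : Prop :=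
  ∃ c p, U.IsCusp τ E c ∧ U.PassesAt τ p c ∧ U.OnMidline τ E p ∧ U.InSpan τ A p

/-- The atom `A` rides on the atom `B`. -/
def RidesOn [Fintype V] (τ : Smoothing V) (A B : Set V) : Prop :=
  A ≠ B ∧ ∀ v ∈ A, ∀ p, U.PassesAt τ p v → U.InSpan τ B p

end OneLinkoidUniverse

end Linkoid

/-!
A trail is continued at the head by walking back along itself.  The resulting tour passes all
`4n + 2` half-edges once (`IsTour`), and the region on its right changes only where it passes an
opened corner, that is, the corner of the marker or the opposite one.  Since the regions of the
markers are distinct and unstarred, the marker at each crossing sits in the opened corner that the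
tour passes first (`IsState.pos_lt_pos`); in particular the trail determines the state.  The pairs of
passages of opened corners are nested (`IsState.not_crossing`), because the region that is entered at
the first passage of a pair is left at the second one.  Changing the smoothing at some sites is a
surgery on the tour (`isTour_surgery_iff`), so that the question which changes lead to a trail becomes
one about the order of the passages.

For a sense of rotation, `near` and `far` denote the two passages of the opened corners of a
crossing.  An arc (`IsArc`) leads from one crossing to another one, or to the head, and contains at
its ends the half-edges across which the markers turn first.  If every crossing inside the arc is
passed twice there, the opened corners along the arc pair up, the same region lies along the whole of
it on either side, and turning the markers at its ends is a clock move (`IsArc.clockMove`).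
Otherwise the arc is cut at a crossing that it passes only once.  Nestedness says that the marker of
this crossing turns first across one of the two parts, and after this turn it faces the other part.
By induction the markers can be turned across every arc (`IsArc.exists_clockSequence`).  In total, the
marker of a crossing turns once by 90 degrees at an end of the arc and twice for each passage inside
it, unless it belongs to a local knot: a piece of the arc that passes each of its crossings twice
(`Frozen`, `turns`).

By the surgery criterion, a single exchange, or a double exchange that does not consist of two single
ones, takes place at the ends of such an arc (`Indivisible.exists_isMidline`), and the arc is the
mid-line of the exchange (`IsMidline.onMidline_iff`).  Since a trail comes from one state only, the
markers turned across the mid-line end up in the given second state.  Two separate single exchanges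
are performed one after the other, and the one that the trail passes last is performed first
(`exists_clockSequence_of_separate`).

It remains to recognize the local knots.  A rider without cusps is one.  A local knot that meets an
atom contains the arc spanned by it, so that no cusp can lie on this arc (`IsInvolved.not_frozen`).
Conversely, the smallest rider around a site begins and ends at passages through the atom of this site
(`IsRider.atom_of_minimal`); if the atom is not involved, this rider has no cusps and is a local knot
(`IsAtom.frozen`).
-/

/-! ### Tours of a smoothed universe -/

namespace Linkoid

/-- The half-edge `d` belongs to the crossing `v`. -/
def IsAt {V : Type*} (d : Dart V) (v : V) : Prop := ∃ i, d = dart v i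

theorem isAt_dart {V : Type*} (v : V) (i : ZMod 4) : IsAt (dart v i) v := ⟨i, rfl⟩

theorem isAt_dart_iff {V : Type*} {v u : V} {i : ZMod 4} : IsAt (dart v i) u ↔ u = v := by
  constructor
  · rintro ⟨j, h⟩
    simp only [Sum.inl.injEq, Prod.mk.injEq] at h
    exact h.1.symm
  · rintro rfl
    exact isAt_dart _ _

theorem IsAt.unique {V : Type*} {d : Dart V} {u v : V} (hu : IsAt d u) (hv : IsAt d v) : u = v := by
  obtain ⟨i, rfl⟩ := hv
  exact isAt_dart_iff.1 hu

theorem join_join {V : Type*} (τ : Smoothing V) (d : Dart V) : join τ (join τ d) = d := by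
  rcases d with ⟨v, i⟩ | b <;> simp [join]

theorem join_smoothing {V : Type*} (s : V → ZMod 4) (v : V) (i : ZMod 4) :
    join (smoothing s) (dart v i) = dart v (2 * s v + 3 - i) := by
  have key : ∀ a j : ZMod 4, (if (decide (a = 1 ∨ a = 3)) = true then (1 : ZMod 4) else 3) - j =
      2 * a + 3 - j := by decide
  exact congrArg (dart v) (key (s v) i)

theorem isAt_join {V : Type*} (τ : Smoothing V) {d : Dart V} {v : V} :
    IsAt (join τ d) v ↔ IsAt d v := by
  rcases d with ⟨u, i⟩ | b
  · simp only [join]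
    rw [isAt_dart_iff, isAt_dart_iff]
  · rfl

theorem join_congr {V : Type*} {τ τ' : Smoothing V} {d : Dart V}
    (h : ∀ v, IsAt d v → τ v = τ' v) : join τ d = join τ' d := by
  rcases d with ⟨u, i⟩ | b
  · simp only [join, h u ⟨i, rfl⟩]
  · rfl

namespace OneLinkoidUniverse

variable {V : Type*} (U : OneLinkoidUniverse V)

/-- One step of the tour around the smoothed universe, as a permutation of the half-edges: follow
the edge and pass through the crossing (or turn back at a univalent vertex). -/
def stepPerm (τ : Smoothing V) : Equiv.Perm (Dart V) where
  toFun d := join τ (U.opp d)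
  invFun d := U.opp (join τ d)
  left_inv d := by simp [join_join, U.opp_opp]
  right_inv d := by simp [join_join, U.opp_opp]

theorem walk_eq_iterate (τ : Smoothing V) (k : ℕ) : U.walk τ k = (U.stepPerm τ)^[k] tail := by
  induction k with
  | zero => rfl
  | succ k ih => rw [Function.iterate_succ_apply', ← ih]; rfl

/-- The walk from the tail, continued backwards after it has reached the head, visits all
half-edges.  This is equivalent to `IsTrail`: the smoothed universe has a single component. -/
def IsTour (τ : Smoothing V) : Prop := ∀ d, ∃ k, U.walk τ k = d

theorem walk_succ (τ : Smoothing V) (k : ℕ) :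
    U.walk τ (k + 1) = join τ (U.opp (U.walk τ k)) := rfl

/-- The position of a half-edge on the tour. -/
noncomputable def pos (τ : Smoothing V) (d : Dart V) : ℕ :=
  sInf {k | U.walk τ k = d}

variable {U} {τ : Smoothing V}

theorem IsTour.walk_pos (h : U.IsTour τ) (d : Dart V) : U.walk τ (U.pos τ d) = d :=
  Nat.sInf_mem (s := {k | U.walk τ k = d}) (h d)

theorem IsTour.pos_dart_pos (h : U.IsTour τ) (v : V) (i : ZMod 4) : 0 < U.pos τ (dart v i) := by
  rcases Nat.eq_zero_or_pos (U.pos τ (dart v i)) with h0 | h0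
  · have := h.walk_pos (dart v i)
    rw [h0] at this
    exact absurd this (by simp [walk])
  · exact h0

variable [Fintype V]

theorem card_dart : Fintype.card (Dart V) = 4 * Fintype.card V + 2 := by
  simp [Dart, ZMod.card, mul_comm]

theorem IsTour.minimalPeriod_eq (h : U.IsTour τ) :
    Function.minimalPeriod (U.stepPerm τ) tail = 4 * Fintype.card V + 2 := by
  classical
  have hinj := Function.iterate_injOn_Iio_minimalPeriod (f := U.stepPerm τ) (x := tail)
  have hpos : 0 < Function.minimalPeriod (U.stepPerm τ) (tail : Dart V) := by
    apply Function.minimalPeriod_pos_of_mem_periodicPts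
    exact (U.stepPerm τ).injective.mem_periodicPts _
  have hsurj : (Finset.range (Function.minimalPeriod (U.stepPerm τ) (tail : Dart V))).image
      (fun k => (U.stepPerm τ)^[k] tail) = Finset.univ := by
    rw [Finset.eq_univ_iff_forall]
    intro d
    obtain ⟨k, rfl⟩ := h d
    rw [walk_eq_iterate, ← Function.iterate_mod_minimalPeriod_eq]
    exact Finset.mem_image_of_mem _ (Finset.mem_range.2 (Nat.mod_lt _ hpos))
  have hc := congrArg Finset.card hsurj
  rw [Finset.card_image_of_injOn, Finset.card_range, Finset.card_univ, card_dart] at hc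
  · exact hc
  · intro a ha b hb hab
    exact hinj (by simpa using ha) (by simpa using hb) hab

theorem IsTour.walk_inj (h : U.IsTour τ) {j k : ℕ} (hj : j < 4 * Fintype.card V + 2)
    (hk : k < 4 * Fintype.card V + 2) (e : U.walk τ j = U.walk τ k) : j = k := by
  rw [← h.minimalPeriod_eq] at hj hk
  rw [walk_eq_iterate, walk_eq_iterate] at e
  exact Function.iterate_injOn_Iio_minimalPeriod hj hk e

theorem IsTour.exists_lt (h : U.IsTour τ) (d : Dart V) :
    ∃ k < 4 * Fintype.card V + 2, U.walk τ k = d := by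
  obtain ⟨k, rfl⟩ := h d
  refine ⟨k % (4 * Fintype.card V + 2), Nat.mod_lt _ (by omega), ?_⟩
  rw [walk_eq_iterate, walk_eq_iterate, ← h.minimalPeriod_eq, Function.iterate_mod_minimalPeriod_eq]

theorem IsTour.walk_len (h : U.IsTour τ) : U.walk τ (4 * Fintype.card V + 2) = tail := by
  rw [walk_eq_iterate, ← h.minimalPeriod_eq]
  exact Function.isPeriodicPt_minimalPeriod _ _

/-- The tour returns along the way on which it came. -/
theorem IsTour.opp_walk (h : U.IsTour τ) {k : ℕ} (hk : k < 4 * Fintype.card V + 2) :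
    U.opp (U.walk τ k) = U.walk τ (4 * Fintype.card V + 1 - k) := by
  have H : ∀ j, j ≤ 4 * Fintype.card V + 1 →
      U.opp (U.walk τ (4 * Fintype.card V + 1 - j)) = U.walk τ j := by
    intro j
    induction j with
    | zero =>
      intro _
      have h1 := h.walk_len
      rw [walk_succ] at h1
      have h2 := congrArg (join τ) h1
      rw [join_join] at h2
      exact h2
    | succ j ih =>
      intro hj
      have h1 := ih (by omega)
      have h2 : 4 * Fintype.card V + 1 - j = (4 * Fintype.card V + 1 - (j + 1)) + 1 := by omega
      rw [h2, walk_succ] at h1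
      rw [walk_succ, ← h1, U.opp_opp, join_join]
  have := H (4 * Fintype.card V + 1 - k) (by omega)
  rwa [show 4 * Fintype.card V + 1 - (4 * Fintype.card V + 1 - k) = k by omega] at this

theorem IsTour.join_walk (h : U.IsTour τ) {k : ℕ} (hk : 0 < k) (hk' : k < 4 * Fintype.card V + 2) :
    join τ (U.walk τ k) = U.walk τ (4 * Fintype.card V + 2 - k) := by
  obtain ⟨j, rfl⟩ : ∃ j, k = j + 1 := ⟨k - 1, by omega⟩
  rw [walk_succ, join_join, h.opp_walk (by omega)]
  congr 1
  omega

theorem IsTour.walk_head (h : U.IsTour τ) : U.walk τ (2 * Fintype.card V + 1) = head := by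
  obtain ⟨k, hk, hw⟩ := h.exists_lt head
  have h0 : 0 < k := by
    rcases Nat.eq_zero_or_pos k with rfl | h0
    · exact absurd hw (by simp [walk])
    · exact h0
  have h1 := h.join_walk h0 hk
  rw [hw] at h1
  have h2 : U.walk τ k = U.walk τ (4 * Fintype.card V + 2 - k) := by rw [hw, ← h1]; rfl
  have h3 := h.walk_inj hk (by omega) h2
  rw [← hw]
  congr 1
  omega

theorem isTrail_iff_isTour : U.IsTrail τ ↔ U.IsTour τ := by
  constructor
  · rintro ⟨hh, hu⟩
    have back : ∀ j, j ≤ 2 * Fintype.card V →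
        U.walk τ (2 * Fintype.card V + 1 + j) = U.opp (U.walk τ (2 * Fintype.card V - j)) := by
      intro j
      induction j with
      | zero =>
        intro _
        rw [Nat.add_zero, walk_succ, Nat.sub_zero, hh]
        rfl
      | succ j ih =>
        intro hj
        have e : 2 * Fintype.card V - j = (2 * Fintype.card V - (j + 1)) + 1 := by omega
        rw [← Nat.add_assoc, walk_succ, ih (by omega), U.opp_opp, e, walk_succ, join_join]
    intro d
    obtain ⟨k, ⟨hk, h | h⟩, -⟩ := hu d
    · exact ⟨k, h⟩
    · refine ⟨2 * Fintype.card V + 1 + (2 * Fintype.card V - k), ?_⟩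
      rw [back _ (by omega), show 2 * Fintype.card V - (2 * Fintype.card V - k) = k by omega, h,
        U.opp_opp]
  · intro h
    refine ⟨?_, fun d => ?_⟩
    · rw [h.opp_walk (by omega), show 4 * Fintype.card V + 1 - 2 * Fintype.card V =
        2 * Fintype.card V + 1 by omega, h.walk_head]
    · obtain ⟨k, hk, rfl⟩ := h.exists_lt d
      have ho := h.opp_walk hk
      rcases le_or_gt k (2 * Fintype.card V) with hle | hgt
      · refine ⟨k, ⟨hle, Or.inl rfl⟩, ?_⟩
        rintro j ⟨hj, e | e⟩
        · exact h.walk_inj (by omega) hk e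
        · rw [ho] at e
          have := h.walk_inj (by omega) (by omega) e
          omega
      · refine ⟨4 * Fintype.card V + 1 - k, ⟨by omega, Or.inr ho.symm⟩, ?_⟩
        rintro j ⟨hj, e | e⟩
        · have := h.walk_inj (by omega) hk e
          omega
        · rw [ho] at e
          exact h.walk_inj (by omega) (by omega) e

theorem IsTour.pos_lt (h : U.IsTour τ) (d : Dart V) : U.pos τ d < 4 * Fintype.card V + 2 := by
  obtain ⟨k, hk, hd⟩ := h.exists_lt d
  exact lt_of_le_of_lt (Nat.sInf_le (s := {k | U.walk τ k = d}) hd) hk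

theorem IsTour.pos_eq (h : U.IsTour τ) {k : ℕ} (hk : k < 4 * Fintype.card V + 2) {d : Dart V}
    (hd : U.walk τ k = d) : U.pos τ d = k :=
  h.walk_inj (h.pos_lt d) hk ((h.walk_pos d).trans hd.symm)

theorem IsTour.pos_join (h : U.IsTour τ) (v : V) (i : ZMod 4) :
    U.pos τ (join τ (dart v i)) = 4 * Fintype.card V + 2 - U.pos τ (dart v i) := by
  have h0 := h.pos_dart_pos v i
  have h1 := h.pos_lt (dart v i)
  apply h.pos_eq (by omega)
  rw [← h.join_walk h0 h1, h.walk_pos]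

end OneLinkoidUniverse

end Linkoid

/-! ### Regions along the tour -/

namespace Linkoid

theorem smoothing_eq_iff {V : Type*} {s s' : V → ZMod 4} {v : V} :
    smoothing s v = smoothing s' v ↔ s' v = s v ∨ s' v = s v + 2 := by
  have key : ∀ a b : ZMod 4, decide (a = 1 ∨ a = 3) = decide (b = 1 ∨ b = 3) ↔
      b = a ∨ b = a + 2 := by decide
  exact key _ _

theorem eq_add_cases (a i : ZMod 4) : i = a ∨ i = a + 1 ∨ i = a + 2 ∨ i = a + 3 := by
  revert a i
  decide

theorem dart_inj {V : Type*} {v : V} {i j : ZMod 4} : dart v i = dart v j ↔ i = j := by simp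

namespace OneLinkoidUniverse

variable {V : Type*} {U : OneLinkoidUniverse V} {s : V → ZMod 4}

theorem region_opp_rot (d : Dart V) : U.region (U.opp (rot d)) = U.region d :=
  (Quot.sound (r := fun a b : Dart V => b = U.opp (rot a)) rfl).symm

/-- The region on the right of the tour before it enters the `i`-th half-edge at `v`. -/
theorem region_walk_of_succ {k : ℕ} {v : V} {i : ZMod 4}
    (h : U.walk (smoothing s) (k + 1) = dart v i) :
    U.region (U.walk (smoothing s) k) = U.region (dart v (2 * s v + 2 - i)) := by
  have h1 := congrArg (join (smoothing s)) h
  rw [walk_succ, join_join, join_smoothing] at h1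
  have h2 := congrArg U.opp h1
  rw [U.opp_opp] at h2
  rw [h2, ← region_opp_rot (dart v (2 * s v + 2 - i))]
  congr 3
  ring

theorem region_walk_of_succ_univalent {k : ℕ} {b : Bool}
    (h : U.walk (smoothing s) (k + 1) = Sum.inr b) :
    U.region (U.walk (smoothing s) k) = U.region (Sum.inr b) := by
  have h1 := congrArg (join (smoothing s)) h
  rw [walk_succ, join_join] at h1
  have h2 := congrArg U.opp h1
  rw [U.opp_opp] at h2
  rw [h2]
  exact region_opp_rot (Sum.inr b)

/-- The region on the right of the tour changes only where it passes an opened corner. -/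
theorem region_walk_succ_cases (U : OneLinkoidUniverse V) (s : V → ZMod 4) (k : ℕ) :
    U.region (U.walk (smoothing s) (k + 1)) = U.region (U.walk (smoothing s) k) ∨
    ∃ v, (U.walk (smoothing s) (k + 1) = dart v (s v) ∧
        U.region (U.walk (smoothing s) k) = U.region (dart v (s v + 2))) ∨
      (U.walk (smoothing s) (k + 1) = dart v (s v + 2) ∧
        U.region (U.walk (smoothing s) k) = U.region (dart v (s v))) := by
  rcases hw : U.walk (smoothing s) (k + 1) with ⟨v, i⟩ | b
  · have h1 := region_walk_of_succ hw
    have a0 : ∀ a : ZMod 4, 2 * a + 2 - a = a + 2 := by decide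
    have a1 : ∀ a : ZMod 4, 2 * a + 2 - (a + 1) = a + 1 := by decide
    have a2 : ∀ a : ZMod 4, 2 * a + 2 - (a + 2) = a := by decide
    have a3 : ∀ a : ZMod 4, 2 * a + 2 - (a + 3) = a + 3 := by decide
    rcases eq_add_cases (s v) i with rfl | rfl | rfl | rfl
    · rw [a0] at h1
      exact Or.inr ⟨v, Or.inl ⟨rfl, h1⟩⟩
    · rw [a1] at h1
      exact Or.inl h1.symm
    · rw [a2] at h1
      exact Or.inr ⟨v, Or.inr ⟨rfl, h1⟩⟩
    · rw [a3] at h1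
      exact Or.inl h1.symm
  · exact Or.inl (region_walk_of_succ_univalent hw).symm

/-- Where the tour first passes an opened corner of `v`. -/
noncomputable def firstPos (U : OneLinkoidUniverse V) (s : V → ZMod 4) (v : V) : ℕ :=
  min (U.pos (smoothing s) (dart v (s v))) (U.pos (smoothing s) (dart v (s v + 2)))

/-- The starred region, and the regions entered when an opened corner is passed first. -/
noncomputable def entered (U : OneLinkoidUniverse V) (s : V → ZMod 4) : Option V → U.Region
  | none => U.star
  | some v => U.region (U.walk (smoothing s) (U.firstPos s v))

theorem IsState.inj (hs : U.IsState s) {u v : V}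
    (h : U.region (dart u (s u)) = U.region (dart v (s v))) : u = v :=
  hs.injOn (Set.mem_univ u) (Set.mem_univ v) h

theorem IsState.ne_star (hs : U.IsState s) (v : V) : U.region (dart v (s v)) ≠ U.star :=
  hs.mapsTo (Set.mem_univ v)

variable [Fintype V]

/-- Every region that the tour meets was met at its beginning or was entered where an opened corner of
some crossing was passed for the first time. -/
theorem exists_entered (h : U.IsTour (smoothing s)) :
    ∀ k < 4 * Fintype.card V + 2, ∃ o, U.region (U.walk (smoothing s) k) = U.entered s o ∧
      ∀ v, o = some v → U.firstPos s v ≤ k := by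
  intro k
  induction k using Nat.strong_induction_on with
  | _ k ih =>
    intro hk
    rcases k with _ | k
    · exact ⟨none, rfl, by simp⟩
    -- the two passages of an opened corner separate the same two regions
    have aux : ∀ v i, U.walk (smoothing s) (k + 1) = dart v i →
        U.pos (smoothing s) (dart v (2 * s v + 2 - i)) = U.firstPos s v →
        U.pos (smoothing s) (dart v (2 * s v + 2 - i)) < k + 1 →
        ∃ o, U.region (U.walk (smoothing s) (k + 1)) = U.entered s o ∧
          ∀ v, o = some v → U.firstPos s v ≤ k + 1 := by
      intro v i hw hp hlt
      have h0 := h.pos_dart_pos v (2 * s v + 2 - i)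
      have h1 := h.walk_pos (dart v (2 * s v + 2 - i))
      obtain ⟨j, hj⟩ : ∃ j, U.pos (smoothing s) (dart v (2 * s v + 2 - i)) = j + 1 :=
        ⟨_, (Nat.succ_pred_eq_of_pos h0).symm⟩
      rw [hj] at h1 hlt
      have h2 := region_walk_of_succ h1
      rw [show 2 * s v + 2 - (2 * s v + 2 - i) = i by ring] at h2
      obtain ⟨o, ho, ho'⟩ := ih j (by omega) (by omega)
      exact ⟨o, by rw [hw, ← h2, ho], fun v hv => (ho' v hv).trans (by omega)⟩
    rcases region_walk_succ_cases U s k with hr | ⟨v, ⟨hw, -⟩ | ⟨hw, -⟩⟩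
    · obtain ⟨o, ho, ho'⟩ := ih k (by omega) (by omega)
      exact ⟨o, by rw [hr, ho], fun v hv => (ho' v hv).trans (by omega)⟩
    · have hp := h.pos_eq hk hw
      rcases le_or_gt (U.pos (smoothing s) (dart v (s v)))
        (U.pos (smoothing s) (dart v (s v + 2))) with hle | hlt
      · have hf : U.firstPos s v = k + 1 := by rw [firstPos, min_eq_left hle, hp]
        exact ⟨some v, by rw [entered, hf], by rintro _ ⟨⟩; exact hf.le⟩
      · apply aux v _ hw
        · rw [show 2 * s v + 2 - s v = s v + 2 by ring, firstPos, min_eq_right hlt.le]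
        · rw [show 2 * s v + 2 - s v = s v + 2 by ring]
          omega
    · have hp := h.pos_eq hk hw
      rcases lt_or_ge (U.pos (smoothing s) (dart v (s v)))
        (U.pos (smoothing s) (dart v (s v + 2))) with hlt | hle
      · apply aux v _ hw
        · rw [show 2 * s v + 2 - (s v + 2) = s v by ring, firstPos, min_eq_left hlt.le]
        · rw [show 2 * s v + 2 - (s v + 2) = s v by ring]
          omega
      · have hf : U.firstPos s v = k + 1 := by rw [firstPos, min_eq_right hle, hp]
        exact ⟨some v, by rw [entered, hf], by rintro _ ⟨⟩; exact hf.le⟩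

/-- The marker at a crossing sits in the opened corner that is passed first by the tour.  Otherwise
the tour would leave the region of the marker there, although it has met only the starred region and
regions of other markers so far. -/
theorem IsState.pos_lt_pos (hs : U.IsState s) (h : U.IsTour (smoothing s)) (v : V) :
    U.pos (smoothing s) (dart v (s v)) < U.pos (smoothing s) (dart v (s v + 2)) := by
  suffices H : ∀ k v, U.firstPos s v = k →
      U.pos (smoothing s) (dart v (s v)) < U.pos (smoothing s) (dart v (s v + 2)) from H _ v rfl
  intro k
  induction k using Nat.strong_induction_on with
  | _ k ih =>
    intro v hk
    by_contra hlt
    have hle := not_lt.1 hlt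
    have h0 := h.pos_dart_pos v (s v + 2)
    have h1 := h.walk_pos (dart v (s v + 2))
    have h2 := h.pos_lt (dart v (s v + 2))
    rw [firstPos, min_eq_right hle] at hk
    obtain ⟨j, rfl⟩ : ∃ j, k = j + 1 := ⟨k - 1, by omega⟩
    rw [hk] at h1
    have h3 := region_walk_of_succ h1
    rw [show 2 * s v + 2 - (s v + 2) = s v by ring] at h3
    obtain ⟨o, ho, ho'⟩ := exists_entered h j (by omega)
    rcases o with _ | u
    · exact hs.ne_star v (h3.symm.trans ho)
    · have hu := ho' u rfl
      have h4 := ih _ (by omega) u rfl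
      have h5 : U.entered s (some u) = U.region (dart u (s u)) := by
        rw [entered, firstPos, min_eq_left h4.le, h.walk_pos]
      have h6 : u = v := hs.inj (h5.symm.trans (ho.symm.trans h3))
      subst h6
      rw [firstPos, min_eq_right hle] at hu
      omega

/-- A trail comes from at most one state. -/
theorem IsState.eq_of_smoothing_eq {s' : V → ZMod 4} (hs : U.IsState s) (hs' : U.IsState s')
    (h : U.IsTour (smoothing s)) (e : smoothing s = smoothing s') : s = s' := by
  funext v
  rcases smoothing_eq_iff.1 (congrFun e v) with h1 | h1
  · exact h1.symm
  · have h2 := hs.pos_lt_pos h v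
    have h3 := hs'.pos_lt_pos (e ▸ h) v
    rw [← e, h1, show s v + 2 + 2 = s v + 4 by ring, show (4 : ZMod 4) = 0 by decide,
      add_zero] at h3
    omega

/-- Between the two passages of the opened corners of `v` the tour stays in regions that it has not
met before. -/
theorem exists_region_of_mem_interval (hs : U.IsState s) (h : U.IsTour (smoothing s)) (v : V) :
    ∀ k, U.pos (smoothing s) (dart v (s v)) ≤ k → k < U.pos (smoothing s) (dart v (s v + 2)) →
      ∃ u, U.region (U.walk (smoothing s) k) = U.region (dart u (s u)) ∧
        U.pos (smoothing s) (dart v (s v)) ≤ U.pos (smoothing s) (dart u (s u)) ∧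
        U.pos (smoothing s) (dart u (s u)) ≤ k := by
  intro k
  induction k using Nat.strong_induction_on with
  | _ k ih =>
    intro hk hk'
    rcases hk.eq_or_lt with hk0 | hk0
    · exact ⟨v, by rw [← hk0, h.walk_pos], le_rfl, hk⟩
    have hN := h.pos_lt (dart v (s v + 2))
    obtain ⟨j, rfl⟩ : ∃ j, k = j + 1 := ⟨k - 1, by omega⟩
    obtain ⟨u, hu, hu1, hu2⟩ := ih j (by omega) (by omega) (by omega)
    rcases region_walk_succ_cases U s j with hr | ⟨w, ⟨hw, -⟩ | ⟨hw, hr⟩⟩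
    · exact ⟨u, hr.trans hu, hu1, by omega⟩
    · have hp := h.pos_eq (by omega) hw
      exact ⟨w, by rw [hw], by omega, hp.le⟩
    · have hp := h.pos_eq (by omega) hw
      have huw : u = w := hs.inj (hu.symm.trans hr)
      subst huw
      have hne : u ≠ v := by
        rintro rfl
        omega
      have hlt : U.pos (smoothing s) (dart v (s v)) < U.pos (smoothing s) (dart u (s u)) := by
        refine lt_of_le_of_ne hu1 fun e => hne ?_
        have := h.walk_pos (dart u (s u))
        rw [← e, h.walk_pos] at this
        exact (isAt_dart_iff.1 ⟨_, this⟩)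
      have h1 := h.walk_pos (dart u (s u))
      obtain ⟨i, hi⟩ : ∃ i, U.pos (smoothing s) (dart u (s u)) = i + 1 :=
        ⟨_, (Nat.succ_pred_eq_of_pos (by omega)).symm⟩
      rw [hi] at h1
      have h2 := region_walk_of_succ h1
      rw [show 2 * s u + 2 - s u = s u + 2 by ring] at h2
      obtain ⟨z, hz, hz1, hz2⟩ := ih i (by omega) (by omega) (by omega)
      exact ⟨z, by rw [hw, ← h2, hz], hz1, by omega⟩

/-- The pairs of passages of opened corners are nested. -/
theorem IsState.not_crossing (hs : U.IsState s) (h : U.IsTour (smoothing s)) {v w : V}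
    (h1 : U.pos (smoothing s) (dart v (s v)) < U.pos (smoothing s) (dart w (s w)))
    (h2 : U.pos (smoothing s) (dart w (s w)) < U.pos (smoothing s) (dart v (s v + 2)))
    (h3 : U.pos (smoothing s) (dart v (s v + 2)) < U.pos (smoothing s) (dart w (s w + 2))) :
    False := by
  have hw := h.walk_pos (dart v (s v + 2))
  obtain ⟨j, hj⟩ : ∃ j, U.pos (smoothing s) (dart v (s v + 2)) = j + 1 :=
    ⟨_, (Nat.succ_pred_eq_of_pos (by omega)).symm⟩
  rw [hj] at hw
  have hr := region_walk_of_succ hw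
  rw [show 2 * s v + 2 - (s v + 2) = s v by ring] at hr
  obtain ⟨u, hu, hu1, hu2⟩ := exists_region_of_mem_interval hs h w j (by omega) (by omega)
  have : u = v := hs.inj (hu.symm.trans hr)
  subst this
  omega

end OneLinkoidUniverse

end Linkoid

/-! ### Near and far passages of a crossing -/

namespace Linkoid

/-- The half-edge across which a marker in the corner `a` turns first in the sense `δ`. -/
def Sense.lead (δ : Sense) (a : ZMod 4) : ZMod 4 :=
  match δ with
  | clockwise => a + 1
  | counterclockwise => a

theorem Sense.lead_add_step (δ : Sense) (a : ZMod 4) :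
    δ.lead (a + δ.step) = δ.lead a + δ.step := by
  cases δ <;> simp [Sense.lead, Sense.step]

theorem Sense.two_mul_step (δ : Sense) : 2 * δ.step = 2 := by
  cases δ <;> decide

theorem Sense.eq_cases (δ : Sense) (a i : ZMod 4) :
    i = a ∨ i = a + δ.step ∨ i = a + 2 ∨ i = a - δ.step := by
  revert a i
  cases δ <;> decide

namespace OneLinkoidUniverse

variable {V : Type*} {U : OneLinkoidUniverse V} {s : V → ZMod 4}

/-- The position on the tour at which it leaves `v` after it has arrived along the half-edge across
which the marker of `v` turns first. -/
noncomputable def near (U : OneLinkoidUniverse V) (s : V → ZMod 4) (δ : Sense) (v : V) : ℕ :=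
  U.pos (smoothing s) (dart v (δ.lead (s v) + δ.step))

/-- The position on the tour of the other passage that pairs up with `near`.  If the marker turns
clockwise, `far` and `near` are the positions of its corner and of the opposite one.  If it turns
counterclockwise, they are the positions of the same two passages on the way back, so that `far`
belongs to the opposite corner. -/
noncomputable def far (U : OneLinkoidUniverse V) (s : V → ZMod 4) (δ : Sense) (v : V) : ℕ :=
  U.pos (smoothing s) (dart v (δ.lead (s v) - δ.step))

theorem far_pos (h : U.IsTour (smoothing s)) (δ : Sense) (v : V) : 0 < U.far s δ v :=
  h.pos_dart_pos _ _

theorem walk_near (h : U.IsTour (smoothing s)) (δ : Sense) (v : V) :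
    U.walk (smoothing s) (U.near s δ v) = dart v (δ.lead (s v) + δ.step) := h.walk_pos _

theorem walk_far (h : U.IsTour (smoothing s)) (δ : Sense) (v : V) :
    U.walk (smoothing s) (U.far s δ v) = dart v (δ.lead (s v) - δ.step) := h.walk_pos _

theorem near_clockwise (v : V) :
    U.near s .clockwise v = U.pos (smoothing s) (dart v (s v + 2)) := by
  rw [near]
  congr 2
  generalize s v = a
  revert a
  decide

theorem far_clockwise (v : V) : U.far s .clockwise v = U.pos (smoothing s) (dart v (s v)) := by
  rw [far]
  congr 2
  generalize s v = a
  revert a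
  decide

theorem join_of_ne {τ τ' : Smoothing V} {v : V} (hv : τ' v ≠ τ v) {d : Dart V} {i : ZMod 4}
    (h : join τ d = dart v i) : join τ' d = dart v (i + 2) := by
  rcases d with ⟨u, j⟩ | b
  · simp only [join, Sum.inl.injEq, Prod.mk.injEq] at h
    obtain ⟨rfl, rfl⟩ := h
    simp only [join, Sum.inl.injEq, Prod.mk.injEq, true_and]
    have key : ∀ j : ZMod 4, ∀ a b : Bool, a ≠ b →
        (if a = true then (1 : ZMod 4) else 3) - j =
          (if b = true then (1 : ZMod 4) else 3) - j + 2 := by decide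
    exact key j _ _ hv
  · simp [join] at h

variable [Fintype V]

theorem near_lt (h : U.IsTour (smoothing s)) (δ : Sense) (v : V) :
    U.near s δ v < 4 * Fintype.card V + 2 := h.pos_lt _

theorem pos_lead (h : U.IsTour (smoothing s)) (δ : Sense) (v : V) :
    U.pos (smoothing s) (dart v (δ.lead (s v))) = 4 * Fintype.card V + 2 - U.near s δ v := by
  rw [near, ← h.pos_join, join_smoothing]
  congr 2
  generalize s v = a
  revert a
  cases δ <;> decide

theorem pos_lead_add_two (h : U.IsTour (smoothing s)) (δ : Sense) (v : V) :
    U.pos (smoothing s) (dart v (δ.lead (s v) + 2)) =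
      4 * Fintype.card V + 2 - U.far s δ v := by
  rw [far, ← h.pos_join, join_smoothing]
  congr 2
  generalize s v = a
  revert a
  cases δ <;> decide

theorem walk_sub_near (h : U.IsTour (smoothing s)) (δ : Sense) (v : V) :
    U.walk (smoothing s) (4 * Fintype.card V + 2 - U.near s δ v) = dart v (δ.lead (s v)) := by
  rw [← pos_lead h, h.walk_pos]

theorem walk_sub_far (h : U.IsTour (smoothing s)) (δ : Sense) (v : V) :
    U.walk (smoothing s) (4 * Fintype.card V + 2 - U.far s δ v) =
      dart v (δ.lead (s v) + 2) := by
  rw [← pos_lead_add_two h, h.walk_pos]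

theorem near_counterclockwise (h : U.IsTour (smoothing s)) (v : V) :
    U.near s .counterclockwise v =
      4 * Fintype.card V + 2 - U.pos (smoothing s) (dart v (s v)) := by
  rw [near, ← h.pos_join, join_smoothing]
  congr 2
  generalize s v = a
  revert a
  decide

theorem far_counterclockwise (h : U.IsTour (smoothing s)) (v : V) :
    U.far s .counterclockwise v =
      4 * Fintype.card V + 2 - U.pos (smoothing s) (dart v (s v + 2)) := by
  rw [far, ← h.pos_join, join_smoothing]
  congr 2
  generalize s v = a
  revert a
  decide

theorem far_lt_near (hs : U.IsState s) (h : U.IsTour (smoothing s)) (δ : Sense) (v : V) :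
    U.far s δ v < U.near s δ v := by
  have h1 := hs.pos_lt_pos h v
  have h2 := h.pos_lt (dart v (s v + 2))
  cases δ
  · rwa [near_clockwise, far_clockwise]
  · rw [near_counterclockwise h, far_counterclockwise h]
    omega

theorem not_far_near_crossing (hs : U.IsState s) (h : U.IsTour (smoothing s)) (δ : Sense) {v w : V}
    (h1 : U.far s δ v < U.far s δ w) (h2 : U.far s δ w < U.near s δ v)
    (h3 : U.near s δ v < U.near s δ w) : False := by
  cases δ
  · rw [far_clockwise, far_clockwise] at h1
    rw [far_clockwise, near_clockwise] at h2
    rw [near_clockwise, near_clockwise] at h3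
    exact hs.not_crossing h h1 h2 h3
  · rw [far_counterclockwise h, far_counterclockwise h] at h1
    rw [far_counterclockwise h, near_counterclockwise h] at h2
    rw [near_counterclockwise h, near_counterclockwise h] at h3
    exact hs.not_crossing h (v := w) (w := v) (by omega) (by omega) (by omega)

theorem isAt_walk_iff (h : U.IsTour (smoothing s)) (δ : Sense) {v : V} {k : ℕ}
    (hk : k < 4 * Fintype.card V + 2) :
    IsAt (U.walk (smoothing s) k) v ↔ k = U.far s δ v ∨ k = U.near s δ v ∨
      k = 4 * Fintype.card V + 2 - U.far s δ v ∨ k = 4 * Fintype.card V + 2 - U.near s δ v := by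
  constructor
  · rintro ⟨i, hi⟩
    have hp := h.pos_eq hk hi
    rcases δ.eq_cases (δ.lead (s v)) i with rfl | rfl | rfl | rfl
    · rw [pos_lead h] at hp
      omega
    · exact Or.inr (Or.inl hp.symm)
    · rw [pos_lead_add_two h] at hp
      omega
    · exact Or.inl hp.symm
  · rintro (rfl | rfl | rfl | rfl)
    · exact ⟨_, walk_far h δ v⟩
    · exact ⟨_, walk_near h δ v⟩
    · exact ⟨_, walk_sub_far h δ v⟩
    · exact ⟨_, walk_sub_near h δ v⟩

theorem walk_ne_middle (h : U.IsTour (smoothing s)) {v : V} {k : ℕ}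
    (hv : IsAt (U.walk (smoothing s) k) v) : k ≠ 2 * Fintype.card V + 1 := by
  rintro rfl
  rw [h.walk_head] at hv
  obtain ⟨i, hi⟩ := hv
  simp at hi

theorem far_near_ne_middle (h : U.IsTour (smoothing s)) (δ : Sense) (v : V) :
    U.far s δ v ≠ 2 * Fintype.card V + 1 ∧ U.near s δ v ≠ 2 * Fintype.card V + 1 :=
  ⟨walk_ne_middle h ⟨_, walk_far h δ v⟩, walk_ne_middle h ⟨_, walk_near h δ v⟩⟩

theorem far_add_near_ne (h : U.IsTour (smoothing s)) (δ : Sense) (v : V) :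
    U.far s δ v ≠ 4 * Fintype.card V + 2 - U.near s δ v := by
  intro e
  have h1 := walk_far h δ v
  rw [e, walk_sub_near h, dart_inj] at h1
  generalize s v = a at h1
  revert a
  cases δ <;> decide

/-- Different crossings have different passages. -/
theorem slots_ne (h : U.IsTour (smoothing s)) (δ : Sense) {v w : V} (hvw : v ≠ w) :
    U.far s δ v ≠ U.far s δ w ∧ U.far s δ v ≠ U.near s δ w ∧ U.near s δ v ≠ U.far s δ w ∧
    U.near s δ v ≠ U.near s δ w ∧
    U.far s δ v ≠ 4 * Fintype.card V + 2 - U.far s δ w ∧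
    U.far s δ v ≠ 4 * Fintype.card V + 2 - U.near s δ w ∧
    U.near s δ v ≠ 4 * Fintype.card V + 2 - U.far s δ w ∧
    U.near s δ v ≠ 4 * Fintype.card V + 2 - U.near s δ w := by
  have key : ∀ {j k : ℕ}, IsAt (U.walk (smoothing s) j) v → IsAt (U.walk (smoothing s) k) w →
      j ≠ k := by
    rintro j k hj hk rfl
    exact hvw (hj.unique hk)
  have f1 : IsAt (U.walk (smoothing s) (U.far s δ v)) v := ⟨_, walk_far h δ v⟩
  have f2 : IsAt (U.walk (smoothing s) (U.near s δ v)) v := ⟨_, walk_near h δ v⟩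
  have g1 : IsAt (U.walk (smoothing s) (U.far s δ w)) w := ⟨_, walk_far h δ w⟩
  have g2 : IsAt (U.walk (smoothing s) (U.near s δ w)) w := ⟨_, walk_near h δ w⟩
  have g3 := (⟨_, walk_sub_far h δ w⟩ : IsAt _ w)
  have g4 := (⟨_, walk_sub_near h δ w⟩ : IsAt _ w)
  exact ⟨key f1 g1, key f1 g2, key f2 g1, key f2 g2, key f1 g3, key f1 g4, key f2 g3, key f2 g4⟩

/-! ### Balanced pieces of the tour -/

/-- If the opened corners that are passed between two positions pair up, then the tour is in the
same region at both positions. -/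
theorem region_walk_eq_of_balanced (hs : U.IsState s) (h : U.IsTour (smoothing s)) :
    ∀ m a b, b - a ≤ m → a ≤ b → b < 4 * Fintype.card V + 2 →
      (∀ v, (a < U.pos (smoothing s) (dart v (s v)) ∧ U.pos (smoothing s) (dart v (s v)) ≤ b) ↔
        (a < U.pos (smoothing s) (dart v (s v + 2)) ∧
          U.pos (smoothing s) (dart v (s v + 2)) ≤ b)) →
      U.region (U.walk (smoothing s) a) = U.region (U.walk (smoothing s) b) := by
  intro m
  induction m with
  | zero =>
    intro a b hm hab _ _
    rw [show a = b by omega]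
  | succ m ih =>
    intro a b hm hab hb hbal
    rcases hab.eq_or_lt with rfl | hab'
    · rfl
    by_cases hv : ∃ v, U.walk (smoothing s) (a + 1) = dart v (s v) ∨
        U.walk (smoothing s) (a + 1) = dart v (s v + 2)
    · obtain ⟨v, hv | hv⟩ := hv
      · have hp := h.pos_eq (by omega) hv
        have hr := region_walk_of_succ hv
        rw [show 2 * s v + 2 - s v = s v + 2 by ring] at hr
        have hy := (hbal v).1 (by omega)
        have hxy := hs.pos_lt_pos h v
        have := ih (U.pos (smoothing s) (dart v (s v + 2))) b (by omega) (by omega) hb (by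
          intro u
          have hu := hs.pos_lt_pos h u
          constructor
          · intro hx
            have := (hbal u).1 (by omega)
            omega
          · intro hx
            have h1 := (hbal u).2 (by omega)
            refine ⟨?_, h1.2⟩
            by_contra hle
            by_cases huv : u = v
            · subst huv
              omega
            · have n1 : U.pos (smoothing s) (dart u (s u)) ≠
                  U.pos (smoothing s) (dart v (s v + 2)) := by
                intro e
                have := h.walk_pos (dart u (s u))
                rw [e, h.walk_pos] at this
                exact huv (isAt_dart_iff.1 ⟨_, this⟩)
              have n2 : U.pos (smoothing s) (dart u (s u)) ≠
                  U.pos (smoothing s) (dart v (s v)) := by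
                intro e
                have := h.walk_pos (dart u (s u))
                rw [e, h.walk_pos] at this
                exact huv (isAt_dart_iff.1 ⟨_, this⟩)
              exact hs.not_crossing h (v := v) (w := u) (by omega) (by omega) (by omega))
        rw [hr, ← this, h.walk_pos]
      · have hp := h.pos_eq (by omega) hv
        have h1 := hs.pos_lt_pos h v
        have h2 := (hbal v).2 (by omega)
        omega
    · have hr : U.region (U.walk (smoothing s) a) = U.region (U.walk (smoothing s) (a + 1)) := by
        rcases region_walk_succ_cases U s a with hr | ⟨v, ⟨hw, -⟩ | ⟨hw, -⟩⟩
        · exact hr.symm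
        · exact absurd ⟨v, Or.inl hw⟩ hv
        · exact absurd ⟨v, Or.inr hw⟩ hv
      rw [hr]
      apply ih (a + 1) b (by omega) (by omega) hb
      intro v
      have n1 : U.pos (smoothing s) (dart v (s v)) ≠ a + 1 := by
        intro e
        exact hv ⟨v, Or.inl (by rw [← e, h.walk_pos])⟩
      have n2 : U.pos (smoothing s) (dart v (s v + 2)) ≠ a + 1 := by
        intro e
        exact hv ⟨v, Or.inr (by rw [← e, h.walk_pos])⟩
      have := hbal v
      omega

/-! ### Resmoothing as surgery on the tour -/

/-- The tour after a change of the smoothing at the sites in `E`: where the old tour comes to a site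
in `E`, the new one jumps to the position of the opposite half-edge.  The new smoothing gives a tour
exactly when all positions can be reached. -/
theorem isTour_surgery_iff (h : U.IsTour (smoothing s)) (δ : Sense) {τ' : Smoothing V} {E : V → Prop}
    (hE : ∀ z, E z ↔ τ' z ≠ smoothing s z) :
    U.IsTour τ' ↔ ∀ Z : ℕ → Prop, Z 0 →
      (∀ k, k + 1 < 4 * Fintype.card V + 2 →
        (∀ z, E z → k + 1 ≠ U.far s δ z ∧ k + 1 ≠ U.near s δ z ∧
          k + 1 ≠ 4 * Fintype.card V + 2 - U.far s δ z ∧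
          k + 1 ≠ 4 * Fintype.card V + 2 - U.near s δ z) → Z k → Z (k + 1)) →
      (∀ z, E z → (Z (U.far s δ z - 1) → Z (U.near s δ z)) ∧
        (Z (U.near s δ z - 1) → Z (U.far s δ z)) ∧
        (Z (4 * Fintype.card V + 2 - U.far s δ z - 1) →
          Z (4 * Fintype.card V + 2 - U.near s δ z)) ∧
        (Z (4 * Fintype.card V + 2 - U.near s δ z - 1) →
          Z (4 * Fintype.card V + 2 - U.far s δ z))) →
      ∀ k < 4 * Fintype.card V + 2, Z k := by
  have two : ∀ a : ZMod 4, a + 2 + 2 = a := by decide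
  have p1 : ∀ a : ZMod 4, a + δ.step + 2 = a - δ.step := by cases δ <;> decide
  have p2 : ∀ a : ZMod 4, a - δ.step + 2 = a + δ.step := by cases δ <;> decide
  -- one step of the new tour, seen on the old one
  have stepEq : ∀ k, k + 1 < 4 * Fintype.card V + 2 →
      (∀ z, E z → ¬ IsAt (U.walk (smoothing s) (k + 1)) z) →
      join τ' (U.opp (U.walk (smoothing s) k)) = U.walk (smoothing s) (k + 1) := by
    intro k _ hk
    rw [walk_succ]
    refine join_congr fun v hv => ?_
    by_contra hne
    exact hk v ((hE v).2 hne) (by rw [walk_succ, isAt_join]; exact hv)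
  have stepJump : ∀ k z i, E z → U.walk (smoothing s) (k + 1) = dart z i →
      join τ' (U.opp (U.walk (smoothing s) k)) = dart z (i + 2) := by
    intro k z i hz hw
    exact join_of_ne ((hE z).1 hz) hw
  constructor
  · intro h' Z h0 hstep hjump
    have H : ∀ j, Z (U.pos (smoothing s) (U.walk τ' j)) := by
      intro j
      induction j with
      | zero => rwa [h.pos_eq (d := U.walk τ' 0) (k := 0) (by omega) rfl]
      | succ j ih =>
        obtain ⟨k, hk, hw⟩ := h.exists_lt (U.walk τ' j)
        rw [h.pos_eq hk hw] at ih
        rw [walk_succ, ← hw]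
        rcases Nat.lt_or_ge (k + 1) (4 * Fintype.card V + 2) with hlt | hge
        · by_cases hz : ∃ z, E z ∧ IsAt (U.walk (smoothing s) (k + 1)) z
          · obtain ⟨z, hz, i, hi⟩ := hz
            rw [stepJump k z i hz hi]
            have hp := h.pos_eq hlt hi
            obtain ⟨j1, j2, j3, j4⟩ := hjump z hz
            rcases δ.eq_cases (δ.lead (s z)) i with rfl | rfl | rfl | rfl
            · rw [pos_lead h] at hp
              rw [pos_lead_add_two h]
              apply j4
              rwa [hp]
            · rw [p1]
              apply j2
              rw [near, hp]
              exact ih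
            · rw [pos_lead_add_two h] at hp
              rw [two, pos_lead h]
              apply j3
              rwa [hp]
            · rw [p2]
              apply j1
              rw [far, hp]
              exact ih
          · push Not at hz
            rw [stepEq k hlt hz, h.pos_eq hlt rfl]
            refine hstep k hlt (fun z hzE => ?_) ih
            have := hz z hzE
            rw [isAt_walk_iff h δ hlt] at this
            push Not at this
            exact this
        · rw [h.opp_walk hk, show 4 * Fintype.card V + 1 - k = 0 by omega,
            show join τ' (U.walk (smoothing s) 0) = U.walk (smoothing s) 0 from rfl]
          rwa [h.pos_eq (k := 0) (by omega) rfl]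
    intro k hk
    obtain ⟨j, hj⟩ := h' (U.walk (smoothing s) k)
    have := H j
    rwa [hj, h.pos_eq hk rfl] at this
  · intro H d
    obtain ⟨k, hk, rfl⟩ := h.exists_lt d
    have jump : ∀ z, E z → ∀ i, (∃ j, U.walk τ' j =
        U.walk (smoothing s) (U.pos (smoothing s) (dart z i) - 1)) →
        ∃ j, U.walk τ' j = dart z (i + 2) := by
      rintro z hz i ⟨j, hj⟩
      have h0 := h.pos_dart_pos z i
      refine ⟨j + 1, ?_⟩
      rw [walk_succ, hj]
      apply stepJump _ z i hz
      rw [Nat.sub_add_cancel h0, h.walk_pos]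
    refine H (fun k => ∃ j, U.walk τ' j = U.walk (smoothing s) k) ⟨0, rfl⟩ ?_ ?_ k hk
    · rintro k hk hk' ⟨j, hj⟩
      refine ⟨j + 1, ?_⟩
      rw [walk_succ, hj]
      refine stepEq k hk fun z hz => ?_
      rw [isAt_walk_iff h δ hk]
      have := hk' z hz
      tauto
    · intro z hz
      refine ⟨fun hj => ?_, fun hj => ?_, fun hj => ?_, fun hj => ?_⟩
      · obtain ⟨j, hj⟩ := jump z hz _ hj
        exact ⟨j, by rw [hj, walk_near h, p2]⟩
      · obtain ⟨j, hj⟩ := jump z hz _ hj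
        exact ⟨j, by rw [hj, walk_far h, p1]⟩
      · rw [← pos_lead_add_two h] at hj
        obtain ⟨j, hj⟩ := jump z hz _ hj
        exact ⟨j, by rw [hj, walk_sub_near h, two]⟩
      · rw [← pos_lead h] at hj
        obtain ⟨j, hj⟩ := jump z hz _ hj
        exact ⟨j, by rw [hj, walk_sub_far h]⟩

end OneLinkoidUniverse

end Linkoid

/-! ### Arcs across which the markers turn -/

namespace Linkoid

namespace OneLinkoidUniverse

variable {V : Type*} {U : OneLinkoidUniverse V} {s : V → ZMod 4} {δ : Sense} {γ : ℕ → Dart V}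
  {v w : V} {o : Option V} {a b : ℕ}

/-- The half-edge at the far end of an arc that ends at `o`: the head if `o` is `none`, and otherwise
the half-edge across which the marker of the crossing turns first. -/
def arcEnd (δ : Sense) (s : V → ZMod 4) : Option V → Dart V
  | none => head
  | some w => dart w (δ.lead (s w))

/-- The half-edges `γ a, …, γ (b - 1)` form a path in the universe smoothed by the state `s`, from the
crossing `v` to the crossing `o`, or to the head if `o` is `none`.  At either end it contains the
half-edge across which the marker of the crossing turns first in the sense `δ`, and it passes the end
crossings nowhere else. -/
structure IsArc (U : OneLinkoidUniverse V) (δ : Sense) (γ : ℕ → Dart V) (s : V → ZMod 4) (v : V)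
    (o : Option V) (a b : ℕ) : Prop where
  lt : a < b
  ne : some v ≠ o
  start : γ a = dart v (δ.lead (s v))
  step : ∀ k, a ≤ k → k + 1 < b → γ (k + 1) = join (smoothing s) (U.opp (γ k))
  inner : ∀ k, a < k → k < b → ∃ u, IsAt (γ k) u ∧ u ≠ v ∧ some u ≠ o
  finish : U.opp (γ (b - 1)) = arcEnd δ s o

theorem region_opp_dart (U : OneLinkoidUniverse V) (v : V) (i : ZMod 4) :
    U.region (U.opp (dart v (i + 1))) = U.region (dart v i) :=
  region_opp_rot (dart v i)

theorem near_pos (h : U.IsTour (smoothing s)) (δ : Sense) (v : V) : 0 < U.near s δ v :=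
  h.pos_dart_pos _ _

variable [Fintype V]

/-- The arc is a piece of the tour. -/
theorem IsArc.walk_eq (h : U.IsTour (smoothing s)) (A : U.IsArc δ γ s v o a b) :
    ∀ j, a + j < b → 4 * Fintype.card V + 2 - U.near s δ v + j < 4 * Fintype.card V + 2 ∧
      U.walk (smoothing s) (4 * Fintype.card V + 2 - U.near s δ v + j) = γ (a + j) := by
  intro j
  induction j with
  | zero =>
    intro _
    have := far_pos h δ v
    have h1 := h.pos_dart_pos v (δ.lead (s v) + δ.step)
    rw [← near] at h1
    exact ⟨by omega, by rw [Nat.add_zero, walk_sub_near h, ← A.start, Nat.add_zero]⟩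
  | succ j ih =>
    intro hj
    obtain ⟨h1, h2⟩ := ih (by omega)
    have h3 : U.walk (smoothing s) (4 * Fintype.card V + 2 - U.near s δ v + (j + 1)) =
        γ (a + (j + 1)) := by
      rw [← Nat.add_assoc, walk_succ, h2, ← A.step (a + j) (by omega) (by omega), Nat.add_assoc]
    refine ⟨?_, h3⟩
    by_contra hge
    have e : 4 * Fintype.card V + 2 - U.near s δ v + (j + 1) = 4 * Fintype.card V + 2 := by omega
    rw [e, h.walk_len] at h3
    obtain ⟨u, ⟨i, hu⟩, -⟩ := A.inner (a + (j + 1)) (by omega) hj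
    rw [hu] at h3
    simp at h3

/-- The position on the tour where an arc that ends at `o` is left. -/
noncomputable def arcStop (U : OneLinkoidUniverse V) (s : V → ZMod 4) (δ : Sense) : Option V → ℕ
  | none => 2 * Fintype.card V + 1
  | some w => U.near s δ w

theorem IsArc.arcStop_eq (h : U.IsTour (smoothing s)) (A : U.IsArc δ γ s v o a b) :
    4 * Fintype.card V + 2 - U.near s δ v + (b - a) = U.arcStop s δ o := by
  have hab := A.lt
  obtain ⟨h1, h2⟩ := A.walk_eq h (b - 1 - a) (by omega)
  rw [show a + (b - 1 - a) = b - 1 by omega] at h2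
  have h3 := A.finish
  rw [← h2, h.opp_walk h1] at h3
  rcases o with _ | w
  · have h4 := h.walk_inj (by omega) (by omega) (h3.trans h.walk_head.symm)
    simp only [arcStop]
    omega
  · have h5 := near_pos h δ w
    have h6 := near_lt h δ w
    have h4 := h.walk_inj (by omega) (by omega) (h3.trans (walk_sub_near h δ w).symm)
    simp only [arcStop]
    omega

/-- A passage strictly inside the piece of the tour is a passage of the arc. -/
theorem IsArc.exists_index (h : U.IsTour (smoothing s)) (A : U.IsArc δ γ s v o a b) {p : ℕ}
    (h1 : 4 * Fintype.card V + 2 - U.near s δ v < p) (h2 : p < U.arcStop s δ o) :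
    ∃ k, a < k ∧ k < b ∧ U.walk (smoothing s) p = γ k ∧
      p = 4 * Fintype.card V + 2 - U.near s δ v + (k - a) := by
  have h3 := A.arcStop_eq h
  have hab := A.lt
  obtain ⟨-, h5⟩ := A.walk_eq h (p - (4 * Fintype.card V + 2 - U.near s δ v)) (by omega)
  refine ⟨a + (p - (4 * Fintype.card V + 2 - U.near s δ v)), by omega, by omega, ?_, by omega⟩
  rw [← h5]
  congr 1
  omega

/-- The end crossings of an arc are not passed strictly inside it. -/
theorem IsArc.not_end (h : U.IsTour (smoothing s)) (A : U.IsArc δ γ s v o a b) {u : V}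
    (hu : u = v ∨ some u = o) {p : ℕ} (hp : IsAt (U.walk (smoothing s) p) u) :
    p ≤ 4 * Fintype.card V + 2 - U.near s δ v ∨ U.arcStop s δ o ≤ p := by
  by_contra hcon
  push Not at hcon
  obtain ⟨k, hk1, hk2, hk, -⟩ := A.exists_index h hcon.1 hcon.2
  rw [hk] at hp
  obtain ⟨z, hz, hzv, hzo⟩ := A.inner k hk1 hk2
  have := hp.unique hz
  subst this
  rcases hu with hu | hu
  · exact hzv hu
  · exact hzo hu

/-- Numerical position of an arc that ends at the head. -/
theorem IsArc.bounds_none (hs : U.IsState s) (h : U.IsTour (smoothing s))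
    (A : U.IsArc δ γ s v none a b) :
    U.far s δ v < 4 * Fintype.card V + 2 - U.near s δ v ∧
      4 * Fintype.card V + 2 - U.near s δ v < 2 * Fintype.card V + 1 := by
  have h1 := A.arcStop_eq h
  have hab := A.lt
  have hf := far_lt_near hs h δ v
  have hn := near_lt h δ v
  have hm := far_near_ne_middle h δ v
  have hfn := far_add_near_ne h δ v
  have e1 := A.not_end h (Or.inl rfl) ⟨_, walk_far h δ v⟩
  have e2 := A.not_end h (Or.inl rfl) ⟨_, walk_sub_far h δ v⟩
  simp only [arcStop] at h1 e1 e2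
  omega

/-- Numerical position of an arc that ends at a crossing. -/
theorem IsArc.bounds_some (hs : U.IsState s) (h : U.IsTour (smoothing s))
    (A : U.IsArc δ γ s v (some w) a b) :
    v ≠ w ∧ 4 * Fintype.card V + 2 - U.near s δ v < U.near s δ w ∧
      U.far s δ w < 4 * Fintype.card V + 2 - U.near s δ v ∧
      U.far s δ v < 4 * Fintype.card V + 2 - U.near s δ w ∧
      (U.near s δ w < 2 * Fintype.card V + 1 ∨ 2 * Fintype.card V + 1 <
        4 * Fintype.card V + 2 - U.near s δ v) ∧
      (U.far s δ v < 4 * Fintype.card V + 2 - U.near s δ v ∨ U.near s δ w < U.far s δ v) ∧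
      (U.far s δ w < 4 * Fintype.card V + 2 - U.near s δ w ∨ U.near s δ v < U.far s δ w) := by
  have hvw : v ≠ w := fun e => A.ne (congrArg some e)
  have h1 := A.arcStop_eq h
  have hab := A.lt
  have hfv := far_lt_near hs h δ v
  have hfw := far_lt_near hs h δ w
  have hnv := near_lt h δ v
  have hnw := near_lt h δ w
  have hmv := far_near_ne_middle h δ v
  have hmw := far_near_ne_middle h δ w
  have hfn := far_add_near_ne h δ v
  have hfn' := far_add_near_ne h δ w
  have hne := slots_ne h δ hvw
  have e1 := A.not_end h (Or.inl rfl) ⟨_, walk_far h δ v⟩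
  have e2 := A.not_end h (Or.inl rfl) ⟨_, walk_sub_far h δ v⟩
  have e3 := A.not_end h (Or.inr rfl) ⟨_, walk_far h δ w⟩
  have e4 := A.not_end h (Or.inr rfl) ⟨_, walk_sub_far h δ w⟩
  have e5 : 2 * Fintype.card V + 1 ≤ 4 * Fintype.card V + 2 - U.near s δ v ∨
      U.near s δ w ≤ 2 * Fintype.card V + 1 := by
    by_contra hcon
    push Not at hcon
    obtain ⟨k, hk1, hk2, hk, -⟩ := A.exists_index h hcon.1 hcon.2
    obtain ⟨z, ⟨i, hz⟩, -⟩ := A.inner k hk1 hk2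
    rw [h.walk_head, hz] at hk
    simp at hk
  simp only [arcStop] at h1 e1 e2 e3 e4
  refine ⟨hvw, ?_⟩
  omega

/-- Where the arc passes a crossing that it does not pass a second time, the marker of that crossing
turns first across one of the two half-edges of this passage. -/
theorem IsArc.cusp (hs : U.IsState s) (h : U.IsTour (smoothing s)) (A : U.IsArc δ γ s v o a b)
    {c : V} {κ : ℕ} (h1 : a < κ) (h2 : κ < b) (hc : IsAt (γ κ) c)
    (honce : ∀ k, a < k → k < b → k ≠ κ → ¬ IsAt (γ k) c) :
    γ κ = dart c (δ.lead (s c) + δ.step) ∨ γ κ = dart c (δ.lead (s c)) := by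
  obtain ⟨hK, hKw⟩ := A.walk_eq h (κ - a) (by omega)
  rw [show a + (κ - a) = κ by omega] at hKw
  have hlen := A.arcStop_eq h
  have hab := A.lt
  obtain ⟨z, hz, hzv, hzo⟩ := A.inner κ h1 h2
  have := hc.unique hz
  subst this
  have hno : ∀ p, IsAt (U.walk (smoothing s) p) c →
      p ≠ 4 * Fintype.card V + 2 - U.near s δ v + (κ - a) →
      p ≤ 4 * Fintype.card V + 2 - U.near s δ v ∨ U.arcStop s δ o ≤ p := by
    intro p hp hpne
    by_contra hcon
    push Not at hcon
    obtain ⟨k, hk1, hk2, hk, hpk⟩ := A.exists_index h hcon.1 hcon.2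
    rw [hk] at hp
    exact honce k hk1 hk2 (fun e => hpne (by rw [hpk, e])) hp
  rw [← hKw] at hc
  have hcases := (isAt_walk_iff h δ hK).1 hc
  rw [← hKw]
  obtain ⟨K, hKdef⟩ : ∃ K, K = 4 * Fintype.card V + 2 - U.near s δ v + (κ - a) := ⟨_, rfl⟩
  rw [← hKdef] at hcases hno ⊢
  rcases hcases with e | e | e | e
  rotate_left
  · exact Or.inl (by rw [e, walk_near h])
  rotate_left
  · exact Or.inr (by rw [e, walk_sub_near h])
  all_goals
    exfalso
    have hfc := far_lt_near hs h δ c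
    have hnc := near_lt h δ c
    have hfnc := far_add_near_ne h δ c
    have n1 := hno _ ⟨_, walk_near h δ c⟩ (by omega)
    have n2 := hno _ ⟨_, walk_sub_near h δ c⟩ (by omega)
    have hcv := (slots_ne h δ hzv).2.2.2.1
    have hnv := near_lt h δ v
    clear hno hK hKw hc
  · rcases o with _ | w
    · obtain ⟨b1, b2⟩ := A.bounds_none hs h
      have hmc := (far_near_ne_middle h δ c).2
      simp only [arcStop] at n1 n2 hlen
      exact not_far_near_crossing hs h δ (v := v) (w := c) (by omega) (by omega) (by omega)
    · obtain ⟨-, -, b1, -⟩ := A.bounds_some hs h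
      have hcw := (slots_ne h δ (fun e : c = w => hzo (congrArg some e))).2.2.2.1
      simp only [arcStop] at n1 hlen
      clear n2
      exact not_far_near_crossing hs h δ (v := w) (w := c) (by omega) (by omega) (by omega)
  · rcases o with _ | w
    · obtain ⟨b1, b2⟩ := A.bounds_none hs h
      have hmc := (far_near_ne_middle h δ c).2
      simp only [arcStop] at n1 n2 hlen
      exact not_far_near_crossing hs h δ (v := v) (w := c) (by omega) (by omega) (by omega)
    · obtain ⟨-, -, -, b1, -⟩ := A.bounds_some hs h
      simp only [arcStop] at n2 hlen
      clear n1
      exact not_far_near_crossing hs h δ (v := v) (w := c) (by omega) (by omega) (by omega)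

end OneLinkoidUniverse

end Linkoid

/-! ### A single clock move -/

namespace Linkoid

namespace OneLinkoidUniverse

variable {V : Type*} {U : OneLinkoidUniverse V} {s : V → ZMod 4} {δ : Sense} {γ : ℕ → Dart V}
  {v w : V} {o : Option V} {a b : ℕ}

/-- Every crossing that the arc passes strictly inside is passed twice there. -/
def ArcClosed (γ : ℕ → Dart V) (a b : ℕ) : Prop :=
  ∀ j c, a < j → j < b → IsAt (γ j) c → ∃ k, a < k ∧ k < b ∧ k ≠ j ∧ IsAt (γ k) c

/-- The marker turns across the half-edge `δ.lead (s v)`: from the region on its left to the one on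
its right if `δ` is clockwise, and vice versa otherwise. -/
theorem region_turn (U : OneLinkoidUniverse V) (s : V → ZMod 4) (δ : Sense) (v : V) :
    (δ = .clockwise ∧
      U.region (dart v (s v)) = U.region (U.opp (dart v (δ.lead (s v)))) ∧
      U.region (dart v (s v + δ.step)) = U.region (dart v (δ.lead (s v)))) ∨
    (δ = .counterclockwise ∧
      U.region (dart v (s v)) = U.region (dart v (δ.lead (s v))) ∧
      U.region (dart v (s v + δ.step)) = U.region (U.opp (dart v (δ.lead (s v))))) := by
  cases δ
  · refine Or.inl ⟨rfl, ?_, ?_⟩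
    · simp only [Sense.lead]
      rw [region_opp_dart]
    · rfl
  · refine Or.inr ⟨rfl, rfl, ?_⟩
    simp only [Sense.lead, Sense.step]
    rw [← region_opp_dart U v (s v + -1), neg_add_cancel_right]

variable [Fintype V]

theorem IsArc.closed_walk (h : U.IsTour (smoothing s)) (A : U.IsArc δ γ s v o a b)
    (hcl : ArcClosed γ a b) {p : ℕ} {c : V} (hp : IsAt (U.walk (smoothing s) p) c)
    (h1 : 4 * Fintype.card V + 2 - U.near s δ v < p) (h2 : p < U.arcStop s δ o) :
    ∃ q, q ≠ p ∧ 4 * Fintype.card V + 2 - U.near s δ v < q ∧ q < U.arcStop s δ o ∧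
      (q = U.far s δ c ∨ q = U.near s δ c ∨ q = 4 * Fintype.card V + 2 - U.far s δ c ∨
        q = 4 * Fintype.card V + 2 - U.near s δ c) := by
  obtain ⟨j, hj1, hj2, hj, hpj⟩ := A.exists_index h h1 h2
  rw [hj] at hp
  obtain ⟨k, hk1, hk2, hkj, hk⟩ := hcl j c hj1 hj2 hp
  have hlen := A.arcStop_eq h
  obtain ⟨hq1, hq2⟩ := A.walk_eq h (k - a) (by omega)
  rw [show a + (k - a) = k by omega] at hq2
  rw [← hq2] at hk
  exact ⟨_, by omega, by omega, by omega, (isAt_walk_iff h δ hq1).1 hk⟩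

theorem IsArc.closed_none (hs : U.IsState s) (h : U.IsTour (smoothing s))
    (A : U.IsArc δ γ s v none a b) (hcl : ArcClosed γ a b) (c : V) :
    (4 * Fintype.card V + 2 - U.near s δ v < U.far s δ c ∧ U.far s δ c < U.near s δ v) ↔
    (4 * Fintype.card V + 2 - U.near s δ v < U.near s δ c ∧ U.near s δ c < U.near s δ v) := by
  obtain ⟨b1, b2⟩ := A.bounds_none hs h
  have hfc := far_lt_near hs h δ c
  have hnc := near_lt h δ c
  have hmc := far_near_ne_middle h δ c
  have K : ∀ p, IsAt (U.walk (smoothing s) p) c → 4 * Fintype.card V + 2 - U.near s δ v < p →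
      p < 2 * Fintype.card V + 1 → ∃ q, q ≠ p ∧ 4 * Fintype.card V + 2 - U.near s δ v < q ∧
        q < 2 * Fintype.card V + 1 ∧ (q = U.far s δ c ∨ q = U.near s δ c ∨
          q = 4 * Fintype.card V + 2 - U.far s δ c ∨ q = 4 * Fintype.card V + 2 - U.near s δ c) :=
    fun p hp h1 h2 => A.closed_walk h hcl hp h1 h2
  constructor
  · rintro ⟨h1, h2⟩
    rcases lt_or_ge (U.far s δ c) (2 * Fintype.card V + 1) with hlt | hge
    · obtain ⟨q, hq⟩ := K _ ⟨_, walk_far h δ c⟩ h1 hlt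
      omega
    · obtain ⟨q, hq⟩ := K _ ⟨_, walk_sub_far h δ c⟩ (by omega) (by omega)
      omega
  · rintro ⟨h1, h2⟩
    rcases lt_or_ge (U.near s δ c) (2 * Fintype.card V + 1) with hlt | hge
    · obtain ⟨q, hq⟩ := K _ ⟨_, walk_near h δ c⟩ h1 hlt
      omega
    · obtain ⟨q, hq⟩ := K _ ⟨_, walk_sub_near h δ c⟩ (by omega) (by omega)
      omega

theorem IsArc.closed_some (hs : U.IsState s) (h : U.IsTour (smoothing s))
    (A : U.IsArc δ γ s v (some w) a b) (hcl : ArcClosed γ a b) (c : V) :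
    ((4 * Fintype.card V + 2 - U.near s δ v < U.far s δ c ∧ U.far s δ c < U.near s δ w) ↔
      (4 * Fintype.card V + 2 - U.near s δ v < U.near s δ c ∧ U.near s δ c < U.near s δ w)) ∧
    ((4 * Fintype.card V + 2 - U.near s δ w < U.far s δ c ∧ U.far s δ c < U.near s δ v) ↔
      (4 * Fintype.card V + 2 - U.near s δ w < U.near s δ c ∧ U.near s δ c < U.near s δ v)) := by
  obtain ⟨hvw, b0, b1, b2, b3, -⟩ := A.bounds_some hs h
  have hfc := far_lt_near hs h δ c
  have hnc := near_lt h δ c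
  have hnv := near_lt h δ v
  have hnw := near_lt h δ w
  -- an opened passage from one side of the arc to the other side would cross one at its ends
  have x1 : ¬ ((4 * Fintype.card V + 2 - U.near s δ v < U.far s δ c ∧
      U.far s δ c < U.near s δ w) ∧ 4 * Fintype.card V + 2 - U.near s δ w < U.near s δ c ∧
        U.near s δ c < U.near s δ v) := by
    rintro ⟨⟨h1, h2⟩, h3, h4⟩
    exact not_far_near_crossing hs h δ (v := w) (w := c) (by omega) (by omega) (by omega)
  have x2 : ¬ ((4 * Fintype.card V + 2 - U.near s δ v < U.near s δ c ∧
      U.near s δ c < U.near s δ w) ∧ 4 * Fintype.card V + 2 - U.near s δ w < U.far s δ c ∧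
        U.far s δ c < U.near s δ v) := by
    rintro ⟨⟨h1, h2⟩, h3, h4⟩
    exact not_far_near_crossing hs h δ (v := v) (w := c) (by omega) (by omega) (by omega)
  have K : ∀ p, IsAt (U.walk (smoothing s) p) c → 4 * Fintype.card V + 2 - U.near s δ v < p →
      p < U.near s δ w → ∃ q, q ≠ p ∧ 4 * Fintype.card V + 2 - U.near s δ v < q ∧
        q < U.near s δ w ∧ (q = U.far s δ c ∨ q = U.near s δ c ∨
          q = 4 * Fintype.card V + 2 - U.far s δ c ∨ q = 4 * Fintype.card V + 2 - U.near s δ c) :=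
    fun p hp h1 h2 => A.closed_walk h hcl hp h1 h2
  refine ⟨⟨?_, ?_⟩, ?_, ?_⟩
  · rintro ⟨h1, h2⟩
    obtain ⟨q, q1, q2, q3, rfl | rfl | rfl | rfl⟩ := K _ ⟨_, walk_far h δ c⟩ h1 h2 <;> omega
  · rintro ⟨h1, h2⟩
    obtain ⟨q, q1, q2, q3, rfl | rfl | rfl | rfl⟩ := K _ ⟨_, walk_near h δ c⟩ h1 h2 <;> omega
  · rintro ⟨h1, h2⟩
    obtain ⟨q, q1, q2, q3, rfl | rfl | rfl | rfl⟩ := K _ ⟨_, walk_sub_far h δ c⟩ (by omega) (by omega) <;> omega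
  · rintro ⟨h1, h2⟩
    obtain ⟨q, q1, q2, q3, rfl | rfl | rfl | rfl⟩ := K _ ⟨_, walk_sub_near h δ c⟩ (by omega) (by omega) <;> omega

/-- The positions of the opened corners in terms of the near and far passages. -/
theorem near_far_cases (h : U.IsTour (smoothing s)) (δ : Sense) (c : V) :
    (U.far s δ c = U.pos (smoothing s) (dart c (s c)) ∧
      U.near s δ c = U.pos (smoothing s) (dart c (s c + 2))) ∨
    (U.near s δ c = 4 * Fintype.card V + 2 - U.pos (smoothing s) (dart c (s c)) ∧
      U.far s δ c = 4 * Fintype.card V + 2 - U.pos (smoothing s) (dart c (s c + 2))) := by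
  cases δ
  · exact Or.inl ⟨far_clockwise c, near_clockwise c⟩
  · exact Or.inr ⟨near_counterclockwise h c, far_counterclockwise h c⟩

theorem IsArc.region_none (hs : U.IsState s) (h : U.IsTour (smoothing s))
    (A : U.IsArc δ γ s v none a b) (hcl : ArcClosed γ a b) :
    U.region (dart v (s v + δ.step)) = U.region (dart v (s v)) := by
  obtain ⟨b1, b2⟩ := A.bounds_none hs h
  have hnv := near_lt h δ v
  have key := region_walk_eq_of_balanced hs h _ (4 * Fintype.card V + 2 - U.near s δ v)
    (U.near s δ v - 1) le_rfl (by omega) (by omega) (by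
      intro c
      have h1 := A.closed_none hs h hcl c
      have p1 := h.pos_dart_pos c (s c)
      have p2 := h.pos_dart_pos c (s c + 2)
      have p3 := h.pos_lt (dart c (s c))
      have p4 := h.pos_lt (dart c (s c + 2))
      rcases near_far_cases h δ c with ⟨e1, e2⟩ | ⟨e1, e2⟩ <;> rw [e1, e2] at h1 <;> omega)
  have ho := h.opp_walk (k := 4 * Fintype.card V + 2 - U.near s δ v) (by omega)
  rw [show 4 * Fintype.card V + 1 - (4 * Fintype.card V + 2 - U.near s δ v) =
    U.near s δ v - 1 by omega] at ho
  rw [← ho, walk_sub_near h] at key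
  rcases region_turn U s δ v with ⟨-, r1, r2⟩ | ⟨-, r1, r2⟩
  · rw [r1, r2, key]
  · rw [r1, r2, key]

theorem IsArc.region_some (hs : U.IsState s) (h : U.IsTour (smoothing s))
    (A : U.IsArc δ γ s v (some w) a b) (hcl : ArcClosed γ a b) :
    U.region (dart v (s v + δ.step)) = U.region (dart w (s w)) ∧
      U.region (dart w (s w + δ.step)) = U.region (dart v (s v)) := by
  obtain ⟨hvw, b0, b1, b2, -⟩ := A.bounds_some hs h
  have hnv := near_lt h δ v
  have hnw := near_lt h δ w
  have hbal := A.closed_some hs h hcl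
  have key1 := region_walk_eq_of_balanced hs h _ (4 * Fintype.card V + 2 - U.near s δ v)
    (U.near s δ w - 1) le_rfl (by omega) (by omega) (by
      intro c
      obtain ⟨h1, h2⟩ := hbal c
      have p1 := h.pos_dart_pos c (s c)
      have p2 := h.pos_dart_pos c (s c + 2)
      have p3 := h.pos_lt (dart c (s c))
      have p4 := h.pos_lt (dart c (s c + 2))
      rcases near_far_cases h δ c with ⟨e1, e2⟩ | ⟨e1, e2⟩ <;> rw [e1, e2] at h1 h2 <;> omega)
  have key2 := region_walk_eq_of_balanced hs h _ (4 * Fintype.card V + 2 - U.near s δ w)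
    (U.near s δ v - 1) le_rfl (by omega) (by omega) (by
      intro c
      obtain ⟨h1, h2⟩ := hbal c
      have p1 := h.pos_dart_pos c (s c)
      have p2 := h.pos_dart_pos c (s c + 2)
      have p3 := h.pos_lt (dart c (s c))
      have p4 := h.pos_lt (dart c (s c + 2))
      rcases near_far_cases h δ c with ⟨e1, e2⟩ | ⟨e1, e2⟩ <;> rw [e1, e2] at h1 h2 <;> omega)
  have ho1 := h.opp_walk (k := 4 * Fintype.card V + 2 - U.near s δ v) (by omega)
  rw [show 4 * Fintype.card V + 1 - (4 * Fintype.card V + 2 - U.near s δ v) =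
    U.near s δ v - 1 by omega] at ho1
  have ho2 := h.opp_walk (k := 4 * Fintype.card V + 2 - U.near s δ w) (by omega)
  rw [show 4 * Fintype.card V + 1 - (4 * Fintype.card V + 2 - U.near s δ w) =
    U.near s δ w - 1 by omega] at ho2
  rw [← ho2, walk_sub_near h, walk_sub_near h] at key1
  rw [← ho1, walk_sub_near h, walk_sub_near h] at key2
  rcases region_turn U s δ v with ⟨e, r1, r2⟩ | ⟨e, r1, r2⟩ <;>
    rcases region_turn U s δ w with ⟨e', r3, r4⟩ | ⟨e', r3, r4⟩
  · exact ⟨by rw [r2, r3, key1], by rw [r4, r1, key2]⟩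
  · rw [e] at e'
    cases e'
  · rw [e] at e'
    cases e'
  · exact ⟨by rw [r2, r3, key2], by rw [r4, r1, key1]⟩

end OneLinkoidUniverse

/-! ### The tour after a clock move -/

/-- The order in which a tour passes its pieces after a single exchange. -/
theorem single_surgery {N f m : ℕ} {Z : ℕ → Prop} (hf : 0 < f) (hfm : f < m) (hm : m < N - m)
    (h0 : Z 0)
    (hstep : ∀ k, k + 1 < N → k + 1 ≠ f → k + 1 ≠ N - m → k + 1 ≠ N - f → k + 1 ≠ m →
      Z k → Z (k + 1))
    (j1 : Z (f - 1) → Z (N - m)) (j2 : Z (N - m - 1) → Z f) (j3 : Z (N - f - 1) → Z m)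
    (j4 : Z (m - 1) → Z (N - f)) : ∀ k < N, Z k := by
  have run : ∀ c j, c + j < N → (∀ i, c < i → i ≤ c + j → i ≠ f ∧ i ≠ N - m ∧ i ≠ N - f ∧ i ≠ m) →
      Z c → Z (c + j) := by
    intro c j
    induction j with
    | zero => exact fun _ _ hc => hc
    | succ j ih =>
      intro hj hi hc
      obtain ⟨i1, i2, i3, i4⟩ := hi (c + j + 1) (by omega) (by omega)
      exact hstep _ hj i1 i2 i3 i4 (ih (by omega) (fun i h1 h2 => hi i h1 (by omega)) hc)
  have run' : ∀ c d, c ≤ d → d < N → (∀ i, c < i → i ≤ d → i ≠ f ∧ i ≠ N - m ∧ i ≠ N - f ∧ i ≠ m) →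
      Z c → Z d := by
    intro c d hcd hd hi hc
    have := run c (d - c) (by omega) (fun i h1 h2 => hi i h1 (by omega)) hc
    rwa [show c + (d - c) = d by omega] at this
  have z1 := j1 (run' 0 (f - 1) (by omega) (by omega) (fun i h1 h2 => by omega) h0)
  have z2 := j3 (run' (N - m) (N - f - 1) (by omega) (by omega) (fun i h1 h2 => by omega) z1)
  have z3 := j2 (run' m (N - m - 1) (by omega) (by omega) (fun i h1 h2 => by omega) z2)
  have z4 := j4 (run' f (m - 1) (by omega) (by omega) (fun i h1 h2 => by omega) z3)
  intro k hk
  rcases lt_or_ge k f with h1 | h1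
  · exact run' 0 k (by omega) hk (fun i h1 h2 => by omega) h0
  rcases lt_or_ge k m with h2 | h2
  · exact run' f k (by omega) hk (fun i h1 h2 => by omega) z3
  rcases lt_or_ge k (N - m) with h3 | h3
  · exact run' m k (by omega) hk (fun i h1 h2 => by omega) z2
  rcases lt_or_ge k (N - f) with h4 | h4
  · exact run' (N - m) k (by omega) hk (fun i h1 h2 => by omega) z1
  · exact run' (N - f) k (by omega) hk (fun i h1 h2 => by omega) z4

/-- The order in which a tour passes its pieces after a double exchange. -/
theorem double_surgery {N f g m l : ℕ} {Z : ℕ → Prop} (hf : 0 < f) (hg : 0 < g) (hgm : g < m)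
    (hml : m < l) (hl : l < N - l) (hfg : f < g ∨ l < f ∧ f < N - l ∧ f ≠ N - f) (h0 : Z 0)
    (hstep : ∀ k, k + 1 < N → (k + 1 ≠ f ∧ k + 1 ≠ N - m ∧ k + 1 ≠ N - f ∧ k + 1 ≠ m) →
      (k + 1 ≠ g ∧ k + 1 ≠ l ∧ k + 1 ≠ N - g ∧ k + 1 ≠ N - l) → Z k → Z (k + 1))
    (i1 : Z (f - 1) → Z (N - m)) (i2 : Z (N - m - 1) → Z f) (i3 : Z (N - f - 1) → Z m)
    (i4 : Z (m - 1) → Z (N - f))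
    (j1 : Z (g - 1) → Z l) (j2 : Z (l - 1) → Z g) (j3 : Z (N - g - 1) → Z (N - l))
    (j4 : Z (N - l - 1) → Z (N - g)) : ∀ k < N, Z k := by
  have run : ∀ c j, c + j < N → (∀ i, c < i → i ≤ c + j →
      (i ≠ f ∧ i ≠ N - m ∧ i ≠ N - f ∧ i ≠ m) ∧ (i ≠ g ∧ i ≠ l ∧ i ≠ N - g ∧ i ≠ N - l)) →
      Z c → Z (c + j) := by
    intro c j
    induction j with
    | zero => exact fun _ _ hc => hc
    | succ j ih =>
      intro hj hi hc
      obtain ⟨i1, i2⟩ := hi (c + j + 1) (by omega) (by omega)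
      exact hstep _ hj i1 i2 (ih (by omega) (fun i h1 h2 => hi i h1 (by omega)) hc)
  have run' : ∀ c d, c ≤ d → d < N → (∀ i, c < i → i ≤ d →
      (i ≠ f ∧ i ≠ N - m ∧ i ≠ N - f ∧ i ≠ m) ∧ (i ≠ g ∧ i ≠ l ∧ i ≠ N - g ∧ i ≠ N - l)) →
      Z c → Z d := by
    intro c d hcd hd hi hc
    have := run c (d - c) (by omega) (fun i h1 h2 => hi i h1 (by omega)) hc
    rwa [show c + (d - c) = d by omega] at this
  rcases hfg with hfg | ⟨hlf, hfl, hff⟩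
  · have z1 := i1 (run' 0 (f - 1) (by omega) (by omega) (fun i h1 h2 => by omega) h0)
    have z2 := j3 (run' (N - m) (N - g - 1) (by omega) (by omega) (fun i h1 h2 => by omega) z1)
    have z3 := i2 (run' (N - l) (N - m - 1) (by omega) (by omega) (fun i h1 h2 => by omega) z2)
    have z4 := j1 (run' f (g - 1) (by omega) (by omega) (fun i h1 h2 => by omega) z3)
    have z5 := j4 (run' l (N - l - 1) (by omega) (by omega) (fun i h1 h2 => by omega) z4)
    have z6 := i3 (run' (N - g) (N - f - 1) (by omega) (by omega) (fun i h1 h2 => by omega) z5)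
    have z7 := j2 (run' m (l - 1) (by omega) (by omega) (fun i h1 h2 => by omega) z6)
    have z8 := i4 (run' g (m - 1) (by omega) (by omega) (fun i h1 h2 => by omega) z7)
    intro k hk
    rcases lt_or_ge k f with h1 | h1
    · exact run' 0 k (by omega) hk (fun i h1 h2 => by omega) h0
    rcases lt_or_ge k g with h2 | h2
    · exact run' f k (by omega) hk (fun i h1 h2 => by omega) z3
    rcases lt_or_ge k m with h3 | h3
    · exact run' g k (by omega) hk (fun i h1 h2 => by omega) z7
    rcases lt_or_ge k l with h4 | h4
    · exact run' m k (by omega) hk (fun i h1 h2 => by omega) z6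
    rcases lt_or_ge k (N - l) with h5 | h5
    · exact run' l k (by omega) hk (fun i h1 h2 => by omega) z4
    rcases lt_or_ge k (N - m) with h6 | h6
    · exact run' (N - l) k (by omega) hk (fun i h1 h2 => by omega) z2
    rcases lt_or_ge k (N - g) with h7 | h7
    · exact run' (N - m) k (by omega) hk (fun i h1 h2 => by omega) z1
    rcases lt_or_ge k (N - f) with h8 | h8
    · exact run' (N - g) k (by omega) hk (fun i h1 h2 => by omega) z5
    · exact run' (N - f) k (by omega) hk (fun i h1 h2 => by omega) z8
  · rcases lt_or_gt_of_ne hff with hff | hff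
    · have z1 := j1 (run' 0 (g - 1) (by omega) (by omega) (fun i h1 h2 => by omega) h0)
      have z2 := i1 (run' l (f - 1) (by omega) (by omega) (fun i h1 h2 => by omega) z1)
      have z3 := j3 (run' (N - m) (N - g - 1) (by omega) (by omega) (fun i h1 h2 => by omega) z2)
      have z4 := i2 (run' (N - l) (N - m - 1) (by omega) (by omega) (fun i h1 h2 => by omega) z3)
      have z5 := i3 (run' f (N - f - 1) (by omega) (by omega) (fun i h1 h2 => by omega) z4)
      have z6 := j2 (run' m (l - 1) (by omega) (by omega) (fun i h1 h2 => by omega) z5)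
      have z7 := i4 (run' g (m - 1) (by omega) (by omega) (fun i h1 h2 => by omega) z6)
      have z8 := j4 (run' (N - f) (N - l - 1) (by omega) (by omega) (fun i h1 h2 => by omega) z7)
      intro k hk
      rcases lt_or_ge k g with h1 | h1
      · exact run' 0 k (by omega) hk (fun i h1 h2 => by omega) h0
      rcases lt_or_ge k m with h2 | h2
      · exact run' g k (by omega) hk (fun i h1 h2 => by omega) z6
      rcases lt_or_ge k l with h3 | h3
      · exact run' m k (by omega) hk (fun i h1 h2 => by omega) z5
      rcases lt_or_ge k f with h4 | h4
      · exact run' l k (by omega) hk (fun i h1 h2 => by omega) z1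
      rcases lt_or_ge k (N - f) with h5 | h5
      · exact run' f k (by omega) hk (fun i h1 h2 => by omega) z4
      rcases lt_or_ge k (N - l) with h6 | h6
      · exact run' (N - f) k (by omega) hk (fun i h1 h2 => by omega) z7
      rcases lt_or_ge k (N - m) with h7 | h7
      · exact run' (N - l) k (by omega) hk (fun i h1 h2 => by omega) z3
      rcases lt_or_ge k (N - g) with h8 | h8
      · exact run' (N - m) k (by omega) hk (fun i h1 h2 => by omega) z2
      · exact run' (N - g) k (by omega) hk (fun i h1 h2 => by omega) z8
    · have z1 := j1 (run' 0 (g - 1) (by omega) (by omega) (fun i h1 h2 => by omega) h0)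
      have z2 := i3 (run' l (N - f - 1) (by omega) (by omega) (fun i h1 h2 => by omega) z1)
      have z3 := j2 (run' m (l - 1) (by omega) (by omega) (fun i h1 h2 => by omega) z2)
      have z4 := i4 (run' g (m - 1) (by omega) (by omega) (fun i h1 h2 => by omega) z3)
      have z5 := i1 (run' (N - f) (f - 1) (by omega) (by omega) (fun i h1 h2 => by omega) z4)
      have z6 := j3 (run' (N - m) (N - g - 1) (by omega) (by omega) (fun i h1 h2 => by omega) z5)
      have z7 := i2 (run' (N - l) (N - m - 1) (by omega) (by omega) (fun i h1 h2 => by omega) z6)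
      have z8 := j4 (run' f (N - l - 1) (by omega) (by omega) (fun i h1 h2 => by omega) z7)
      intro k hk
      rcases lt_or_ge k g with h1 | h1
      · exact run' 0 k (by omega) hk (fun i h1 h2 => by omega) h0
      rcases lt_or_ge k m with h2 | h2
      · exact run' g k (by omega) hk (fun i h1 h2 => by omega) z3
      rcases lt_or_ge k l with h3 | h3
      · exact run' m k (by omega) hk (fun i h1 h2 => by omega) z2
      rcases lt_or_ge k (N - f) with h4 | h4
      · exact run' l k (by omega) hk (fun i h1 h2 => by omega) z1
      rcases lt_or_ge k f with h5 | h5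
      · exact run' (N - f) k (by omega) hk (fun i h1 h2 => by omega) z4
      rcases lt_or_ge k (N - l) with h6 | h6
      · exact run' f k (by omega) hk (fun i h1 h2 => by omega) z7
      rcases lt_or_ge k (N - m) with h7 | h7
      · exact run' (N - l) k (by omega) hk (fun i h1 h2 => by omega) z6
      rcases lt_or_ge k (N - g) with h8 | h8
      · exact run' (N - m) k (by omega) hk (fun i h1 h2 => by omega) z5
      · exact run' (N - g) k (by omega) hk (fun i h1 h2 => by omega) z8

end Linkoid

/-! ### Turning the markers across an arc -/

namespace Linkoid

theorem Sense.add_step_ne (δ : Sense) (a : ZMod 4) : a + δ.step ≠ a := by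
  revert a
  cases δ <;> decide

theorem smoothing_add_step_ne {V : Type*} {s s' : V → ZMod 4} {v : V} {δ : Sense}
    (h : s' v = s v + δ.step) : smoothing s' v ≠ smoothing s v := by
  intro e
  have h1 := smoothing_eq_iff.1 e
  rw [h] at h1
  generalize s v = x at h1
  revert x
  cases δ <;> decide

namespace OneLinkoidUniverse

variable {V : Type*} {U : OneLinkoidUniverse V} {s : V → ZMod 4} {δ : Sense} {γ : ℕ → Dart V}
  {v w : V} {o : Option V} {a b : ℕ}

theorem ClockSequence.trans {s s' s'' : V → ZMod 4} {t t' : V → ℕ} (h : U.ClockSequence δ s s' t)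
    (h' : U.ClockSequence δ s' s'' t') : U.ClockSequence δ s s'' (fun v => t v + t' v) := by
  induction h with
  | refl s => simpa using h'
  | cons hm _ ih =>
    have := ClockSequence.cons hm (ih h')
    simpa only [Nat.add_assoc] using this

theorem ClockMove.eq_or {s s' : V → ZMod 4} (h : U.ClockMove δ s s') (v : V) :
    s' v = s v ∨ s' v = s v + δ.step := by
  obtain ⟨-, -, ⟨u, h1, h2, -⟩ | ⟨u, w, -, h1, h2, h3, -⟩⟩ := h
  · by_cases e : v = u
    · exact Or.inr (e ▸ h1)
    · exact Or.inl (h2 v e)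
  · by_cases e : v = u
    · exact Or.inr (e ▸ h1)
    · by_cases e' : v = w
      · exact Or.inr (e' ▸ h2)
      · exact Or.inl (h3 v e e')

theorem ClockSequence.apply_eq {s s' : V → ZMod 4} {t : V → ℕ} (h : U.ClockSequence δ s s' t)
    (v : V) : s' v = s v + t v • δ.step := by
  induction h with
  | refl s => simp
  | @cons s s' s'' t hm _ ih =>
    rw [ih]
    rcases hm.eq_or v with e | e
    · simp [e]
    · have hne : s' v ≠ s v := by
        rw [e]
        exact δ.add_step_ne _
      simp only [if_neg hne]
      rw [e, add_nsmul, one_nsmul, add_assoc]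

/-- The crossing `u` is passed on a closed piece of the arc: a piece on which every crossing that is
passed at all is passed twice.  Such a piece is a local knot, and its markers do not turn. -/
def Frozen (γ : ℕ → Dart V) (a b : ℕ) (u : V) : Prop :=
  ∃ c d, a < c ∧ d < b ∧ (∃ p, c ≤ p ∧ p ≤ d ∧ IsAt (γ p) u) ∧
    ∀ p, c ≤ p → p ≤ d → ∀ z, IsAt (γ p) z → ∃ q, c ≤ q ∧ q ≤ d ∧ q ≠ p ∧ IsAt (γ q) z

open Classical in
/-- The number of turns by 90 degrees that the marker at `u` makes when the markers are turned across
the arc: one at the ends of the arc, and otherwise two for each passage of the arc, unless the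
crossing belongs to a local knot. -/
noncomputable def turns (γ : ℕ → Dart V) (v : V) (o : Option V) (a b : ℕ) (u : V) : ℕ :=
  if u = v ∨ some u = o then 1 else if Frozen γ a b u then 0 else
    2 * ((Finset.Ioo a b).filter fun k => IsAt (γ k) u).card

theorem turns_of_end {u : V} (hu : u = v ∨ some u = o) : turns γ v o a b u = 1 := if_pos hu

theorem turns_of_not_isAt {u : V} (h1 : u ≠ v) (h2 : some u ≠ o)
    (h : ∀ k, a < k → k < b → ¬ IsAt (γ k) u) : turns γ v o a b u = 0 := by
  classical
  rw [turns, if_neg (by tauto)]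
  split_ifs
  · rfl
  · rw [Finset.card_eq_zero.2, Nat.mul_zero]
    rw [Finset.filter_eq_empty_iff]
    intro k hk
    rw [Finset.mem_Ioo] at hk
    exact h k hk.1 hk.2

theorem turns_of_frozen {u : V} (h1 : u ≠ v) (h2 : some u ≠ o) (h : Frozen γ a b u) :
    turns γ v o a b u = 0 := by
  rw [turns, if_neg (by tauto), if_pos h]

open Classical in
theorem turns_of_not_frozen {u : V} (h1 : u ≠ v) (h2 : some u ≠ o) (h : ¬ Frozen γ a b u) :
    turns γ v o a b u = 2 * ((Finset.Ioo a b).filter fun k => IsAt (γ k) u).card := by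
  rw [turns, if_neg (by tauto), if_neg h]

theorem even_turns {u : V} (h1 : u ≠ v) (h2 : some u ≠ o) : Even (turns γ v o a b u) := by
  rw [turns, if_neg (by tauto)]
  split_ifs
  · exact Even.zero
  · exact even_two_mul _

theorem ClockSequence.smoothing_eq {s s' : V → ZMod 4} {t : V → ℕ} (h : U.ClockSequence δ s s' t)
    {u : V} (hu : Even (t u)) : smoothing s u = smoothing s' u := by
  obtain ⟨n, hn⟩ := hu
  rw [smoothing_eq_iff, h.apply_eq u, hn, ← two_mul, mul_nsmul', nsmul_eq_mul, nsmul_eq_mul]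
  have e : ((2 : ℕ) : ZMod 4) * (((n : ℕ) : ZMod 4) * δ.step) = (n : ZMod 4) * 2 := by
    rw [← δ.two_mul_step]
    push_cast
    ring
  have key : ∀ x y : ZMod 4, x + y * 2 = x ∨ x + y * 2 = x + 2 := by decide
  rw [e]
  exact key _ _

/-- The numbers of turns add up when an arc is cut at a crossing that it passes only once. -/
theorem turns_add {c : V} {κ : ℕ} (h1 : a < κ) (h2 : κ < b) (hc : IsAt (γ κ) c)
    (honce : ∀ k, a < k → k < b → k ≠ κ → ¬ IsAt (γ k) c)
    (hinner : ∀ k, a < k → k < b → ∃ u, IsAt (γ k) u ∧ u ≠ v ∧ some u ≠ o)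
    (hvo : some v ≠ o)
    (htwo : ∀ u p q r, IsAt (γ p) u → IsAt (γ q) u → IsAt (γ r) u → a < p → p < b → a < q → q < b →
      a < r → r < b → p = q ∨ q = r ∨ p = r) (u : V) :
    turns γ v (some c) a κ u + turns γ c o κ b u = turns γ v o a b u := by
  classical
  have hnv : ∀ k, a < k → k < b → ¬ IsAt (γ k) v := by
    intro k k1 k2 hk
    obtain ⟨z, hz, hzv, -⟩ := hinner k k1 k2
    exact hzv (hz.unique hk)
  have hno : ∀ w, some w = o → ∀ k, a < k → k < b → ¬ IsAt (γ k) w := by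
    intro w hw k k1 k2 hk
    obtain ⟨z, hz, -, hzo⟩ := hinner k k1 k2
    exact hzo ((hz.unique hk) ▸ hw)
  have hcv : c ≠ v := fun e => hnv κ h1 h2 (e ▸ hc)
  have hco : some c ≠ o := fun e => hno c e κ h1 h2 hc
  by_cases huv : u = v
  · subst huv
    rw [turns_of_end (Or.inl rfl), turns_of_end (Or.inl rfl),
      turns_of_not_isAt hcv.symm hvo (fun k k1 k2 => hnv k (by omega) k2)]
  by_cases huo : some u = o
  · have huc : some u ≠ some c := fun e => hco (by rw [← e, huo])
    rw [turns_of_end (v := c) (Or.inr huo), turns_of_end (v := v) (Or.inr huo),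
      turns_of_not_isAt huv huc (fun k k1 k2 => hno u huo k k1 (by omega))]
  by_cases huc : u = c
  · subst huc
    rw [turns_of_end (Or.inr rfl), turns_of_end (Or.inl rfl), turns_of_not_frozen huv huo]
    · rw [Finset.card_eq_one.2]
      refine ⟨κ, ?_⟩
      ext k
      rw [Finset.mem_filter, Finset.mem_Ioo, Finset.mem_singleton]
      constructor
      · rintro ⟨⟨k1, k2⟩, hk⟩
        by_contra hne
        exact honce k k1 k2 hne hk
      · rintro rfl
        exact ⟨⟨h1, h2⟩, hc⟩
    · rintro ⟨c', d', i1, i2, ⟨p, p1, p2, hp⟩, hcl⟩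
      obtain ⟨q, q1, q2, qp, hq⟩ := hcl p p1 p2 u hp
      by_cases hpk : p = κ
      · exact honce q (by omega) (by omega) (by omega) hq
      · exact honce p (by omega) (by omega) hpk hp
  have huc' : some u ≠ some c := fun e => huc (Option.some.inj e)
  have hnk : ¬ IsAt (γ κ) u := fun e => huc (e.unique hc)
  by_cases f1 : Frozen γ a κ u
  · have f : Frozen γ a b u := by
      obtain ⟨c', d', i1, i2, i3⟩ := f1
      exact ⟨c', d', i1, by omega, i3⟩
    rw [turns_of_frozen huv huc' f1, turns_of_frozen huv huo f,
      turns_of_not_isAt huc huo]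
    intro r r1 r2 hr
    obtain ⟨c', d', i1, i2, ⟨p, p1, p2, hp⟩, hcl⟩ := f1
    obtain ⟨q, q1, q2, qp, hq⟩ := hcl p p1 p2 u hp
    have := htwo u p q r hp hq hr (by omega) (by omega) (by omega) (by omega) (by omega) r2
    omega
  by_cases f2 : Frozen γ κ b u
  · have f : Frozen γ a b u := by
      obtain ⟨c', d', i1, i2, i3⟩ := f2
      exact ⟨c', d', by omega, i2, i3⟩
    rw [turns_of_frozen huc huo f2, turns_of_frozen huv huo f,
      turns_of_not_isAt huv huc']
    intro r r1 r2 hr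
    obtain ⟨c', d', i1, i2, ⟨p, p1, p2, hp⟩, hcl⟩ := f2
    obtain ⟨q, q1, q2, qp, hq⟩ := hcl p p1 p2 u hp
    have := htwo u p q r hp hq hr (by omega) (by omega) (by omega) (by omega) (by omega) (by omega)
    omega
  have f : ¬ Frozen γ a b u := by
    rintro ⟨c', d', i1, i2, ⟨p, p1, p2, hp⟩, hcl⟩
    rcases lt_or_ge d' κ with hd | hd
    · exact f1 ⟨c', d', i1, hd, ⟨p, p1, p2, hp⟩, hcl⟩
    rcases lt_or_ge κ c' with hc' | hc'
    · exact f2 ⟨c', d', hc', i2, ⟨p, p1, p2, hp⟩, hcl⟩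
    obtain ⟨q, q1, q2, qp, hq⟩ := hcl κ hc' hd c hc
    exact honce q (by omega) (by omega) qp hq
  rw [turns_of_not_frozen huv huc' f1, turns_of_not_frozen huc huo f2,
    turns_of_not_frozen huv huo f, ← Nat.mul_add, ← Finset.card_union_of_disjoint]
  · congr 2
    ext k
    simp only [Finset.mem_union, Finset.mem_filter, Finset.mem_Ioo]
    constructor
    · rintro (⟨⟨k1, k2⟩, hk⟩ | ⟨⟨k1, k2⟩, hk⟩)
      · exact ⟨⟨k1, by omega⟩, hk⟩
      · exact ⟨⟨by omega, k2⟩, hk⟩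
    · rintro ⟨⟨k1, k2⟩, hk⟩
      rcases lt_trichotomy k κ with hl | rfl | hg
      · exact Or.inl ⟨⟨k1, hl⟩, hk⟩
      · exact absurd hk hnk
      · exact Or.inr ⟨⟨hg, k2⟩, hk⟩
  · rw [Finset.disjoint_left]
    intro k hk hk'
    simp only [Finset.mem_filter, Finset.mem_Ioo] at hk hk'
    omega

variable [Fintype V]

/-- No crossing is passed more than twice by an arc. -/
theorem IsArc.at_most_two (h : U.IsTour (smoothing s)) (A : U.IsArc δ γ s v o a b) (u : V)
    (p q r : ℕ) (hp : IsAt (γ p) u) (hq : IsAt (γ q) u) (hr : IsAt (γ r) u) (p1 : a < p)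
    (p2 : p < b) (q1 : a < q) (q2 : q < b) (r1 : a < r) (r2 : r < b) : p = q ∨ q = r ∨ p = r := by
  have hlen := A.arcStop_eq h
  have key : ∀ k, a < k → k < b → IsAt (γ k) u → ∃ K, K = 4 * Fintype.card V + 2 - U.near s δ v +
      (k - a) ∧ K ≠ 2 * Fintype.card V + 1 ∧
      (K = U.far s δ u ∨ K = U.near s δ u ∨ K = 4 * Fintype.card V + 2 - U.far s δ u ∨
        K = 4 * Fintype.card V + 2 - U.near s δ u) := by
    intro k k1 k2 hk
    obtain ⟨i1, i2⟩ := A.walk_eq h (k - a) (by omega)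
    rw [show a + (k - a) = k by omega] at i2
    rw [← i2] at hk
    exact ⟨_, rfl, walk_ne_middle h hk, (isAt_walk_iff h δ i1).1 hk⟩
  have mid : 2 * Fintype.card V + 1 ≤ 4 * Fintype.card V + 2 - U.near s δ v ∨
      4 * Fintype.card V + 2 - U.near s δ v + (b - a) ≤ 2 * Fintype.card V + 1 := by
    by_contra hcon
    push Not at hcon
    rw [hlen] at hcon
    obtain ⟨k, hk1, hk2, hk, -⟩ := A.exists_index h hcon.1 hcon.2
    obtain ⟨z, ⟨i, hz⟩, -⟩ := A.inner k hk1 hk2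
    rw [h.walk_head, hz] at hk
    simp at hk
  have sum : ∀ i j, a < i → i < b → a < j → j < b →
      4 * Fintype.card V + 2 - U.near s δ v + (i - a) ≠ 2 * Fintype.card V + 1 →
      4 * Fintype.card V + 2 - U.near s δ v + (i - a) +
        (4 * Fintype.card V + 2 - U.near s δ v + (j - a)) ≠ 4 * Fintype.card V + 2 := by
    intro i j _ _ _ _ _
    omega
  obtain ⟨P, eP, mP, hP⟩ := key p p1 p2 hp
  obtain ⟨Q, eQ, mQ, hQ⟩ := key q q1 q2 hq
  obtain ⟨R, eR, mR, hR⟩ := key r r1 r2 hr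
  have hf : U.far s δ u < 4 * Fintype.card V + 2 := h.pos_lt _
  have hn := near_lt h δ u
  have same : ∀ i j f : ℕ, f < 4 * Fintype.card V + 2 → i + j ≠ 4 * Fintype.card V + 2 →
      (i = f ∨ i = 4 * Fintype.card V + 2 - f) → (j = f ∨ j = 4 * Fintype.card V + 2 - f) →
      i = j := by
    intro i j f _ _ _ _
    omega
  have hPQ : P + Q ≠ 4 * Fintype.card V + 2 := by
    rw [eP, eQ]
    exact sum p q p1 p2 q1 q2 (eP ▸ mP)
  have hQR : Q + R ≠ 4 * Fintype.card V + 2 := by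
    rw [eQ, eR]
    exact sum q r q1 q2 r1 r2 (eQ ▸ mQ)
  have hPR : P + R ≠ 4 * Fintype.card V + 2 := by
    rw [eP, eR]
    exact sum p r p1 p2 r1 r2 (eP ▸ mP)
  have cls : ∀ i f n f' n' : ℕ, (i = f ∨ i = n ∨ i = f' ∨ i = n') →
      (i = f ∨ i = f') ∨ (i = n ∨ i = n') := by
    intro i f n f' n' hi
    rcases hi with hi | hi | hi | hi
    exacts [Or.inl (Or.inl hi), Or.inr (Or.inl hi), Or.inl (Or.inr hi), Or.inr (Or.inr hi)]
  have hfin : P = Q ∨ Q = R ∨ P = R := by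
    rcases cls _ _ _ _ _ hP with cP | cP <;> rcases cls _ _ _ _ _ hQ with cQ | cQ
    · exact Or.inl (same P Q _ hf hPQ cP cQ)
    · rcases cls _ _ _ _ _ hR with cR | cR
      · exact Or.inr (Or.inr (same P R _ hf hPR cP cR))
      · exact Or.inr (Or.inl (same Q R _ hn hQR cQ cR))
    · rcases cls _ _ _ _ _ hR with cR | cR
      · exact Or.inr (Or.inl (same Q R _ hf hQR cQ cR))
      · exact Or.inr (Or.inr (same P R _ hn hPR cP cR))
    · exact Or.inl (same P Q _ hn hPQ cP cQ)
  clear hP hQ hR mid mP mQ mR sum same hPQ hQR hPR hf hn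
  omega

/-- The new smoothing gives a tour when the smoothing changes at the ends of an arc. -/
theorem IsArc.isTour_none (hs : U.IsState s) (h : U.IsTour (smoothing s))
    (A : U.IsArc δ γ s v none a b) {τ' : Smoothing V}
    (hE : ∀ z, z = v ↔ τ' z ≠ smoothing s z) : U.IsTour τ' := by
  rw [isTour_surgery_iff h δ hE]
  intro Z h0 hstep hjump
  have hf := far_pos h δ v
  have hnl := near_lt h δ v
  obtain ⟨b1, b2⟩ := A.bounds_none hs h
  obtain ⟨j1, j2, j3, j4⟩ := hjump v rfl
  have e : 4 * Fintype.card V + 2 - (4 * Fintype.card V + 2 - U.near s δ v) = U.near s δ v := by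
    omega
  refine single_surgery (f := U.far s δ v) (m := 4 * Fintype.card V + 2 - U.near s δ v) hf b1
    (by omega) h0 ?_ (by rwa [e]) (by rwa [e]) j3 j4
  intro k hk k1 k2 k3 k4
  refine hstep k hk ?_
  rintro z rfl
  rw [e] at k2
  exact ⟨k1, k2, k3, k4⟩

theorem IsArc.isTour_some (hs : U.IsState s) (h : U.IsTour (smoothing s))
    (A : U.IsArc δ γ s v (some w) a b) {s' : V → ZMod 4}
    (hE : ∀ z, (z = v ∨ z = w) ↔ smoothing s' z ≠ smoothing s z) : U.IsTour (smoothing s') := by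
  rw [isTour_surgery_iff h δ hE]
  intro Z h0 hstep hjump
  obtain ⟨hvw, b0, b1, b2, b3, b4, b5⟩ := A.bounds_some hs h
  obtain ⟨i1, i2, i3, i4⟩ := hjump v (Or.inl rfl)
  obtain ⟨j1, j2, j3, j4⟩ := hjump w (Or.inr rfl)
  have c1 := fun p q r => not_far_near_crossing hs h δ (v := v) (w := w) p q r
  have c2 := fun p q r => not_far_near_crossing hs h δ (v := w) (w := v) p q r
  have hf := far_pos h δ v
  have hgf := far_pos h δ w
  have hnl := near_lt h δ v
  have hgn := near_lt h δ w
  have hfl := far_lt_near hs h δ v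
  have hgl := far_lt_near hs h δ w
  have hfv := (far_near_ne_middle h δ v).1
  have hfw := (far_near_ne_middle h δ w).1
  have hne := slots_ne h δ hvw
  have hstep' : ∀ k, k + 1 < 4 * Fintype.card V + 2 →
      (k + 1 ≠ U.far s δ v ∧ k + 1 ≠ U.near s δ v ∧
        k + 1 ≠ 4 * Fintype.card V + 2 - U.far s δ v ∧
        k + 1 ≠ 4 * Fintype.card V + 2 - U.near s δ v) →
      (k + 1 ≠ U.far s δ w ∧ k + 1 ≠ U.near s δ w ∧
        k + 1 ≠ 4 * Fintype.card V + 2 - U.far s δ w ∧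
        k + 1 ≠ 4 * Fintype.card V + 2 - U.near s δ w) → Z k → Z (k + 1) := by
    intro k hk k1 k2
    refine hstep k hk ?_
    rintro z (rfl | rfl)
    · exact k1
    · exact k2
  clear hstep hjump hE A
  generalize U.far s δ v = f at *
  generalize U.far s δ w = g at *
  generalize U.near s δ v = n at *
  generalize U.near s δ w = l at *
  generalize hN : 4 * Fintype.card V + 2 = N at *
  have e : N - (N - n) = n := by omega
  have e' : N - (N - l) = l := by omega
  rcases b3 with b3 | b3
  · refine double_surgery (f := f) (g := g) (m := N - n) (l := l) hf hgf b1 b0 (by omega)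
      ?_ h0 ?_ (by rwa [e]) (by rwa [e]) i3 i4 j1 j2 j3 j4
    · rcases b4 with b4 | b4
      · left
        by_contra hcon
        exact c2 (by omega) (by omega) (by omega)
      · exact Or.inr ⟨b4, b2, by omega⟩
    · rw [e]
      exact hstep'
  · refine double_surgery (f := g) (g := f) (m := N - l) (l := n) hgf hf b2 (by omega)
      (by omega) ?_ h0 ?_ (by rwa [e']) (by rwa [e']) j3 j4 i1 i2 i3 i4
    · rcases b5 with b5 | b5
      · left
        by_contra hcon
        exact c1 (by omega) (by omega) (by omega)
      · exact Or.inr ⟨b5, b1, by omega⟩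
    · rw [e']
      exact fun k hk k1 k2 => hstep' k hk k2 k1

open Classical in
/-- If an arc is closed, the markers at its ends turn by a single clock move. -/
theorem IsArc.clockMove (hs : U.IsState s) (h : U.IsTour (smoothing s))
    (A : U.IsArc δ γ s v o a b) (hcl : ArcClosed γ a b) {s' : V → ZMod 4}
    (hs' : ∀ u, s' u = if u = v ∨ some u = o then s u + δ.step else s u) :
    U.ClockMove δ s s' ∧ U.IsTour (smoothing s') := by
  have hE : ∀ z, (z = v ∨ some z = o) ↔ smoothing s' z ≠ smoothing s z := by
    intro z
    constructor
    · intro hz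
      exact smoothing_add_step_ne (by rw [hs', if_pos hz])
    · intro hz
      by_contra hn
      apply hz
      rw [smoothing, smoothing, hs', if_neg hn]
  have hv : s' v = s v + δ.step := by rw [hs', if_pos (Or.inl rfl)]
  rcases o with _ | w
  · have hu : ∀ u, u ≠ v → s' u = s u := by
      intro u hu
      rw [hs', if_neg (by simpa using hu)]
    have hr := A.region_none hs h hcl
    refine ⟨⟨hs, ?_, Or.inl ⟨v, hv, hu, by rw [hv, hr]⟩⟩,
      A.isTour_none hs h (fun z => by simpa using hE z)⟩
    have e : (fun u => U.region (dart u (s' u))) = fun u => U.region (dart u (s u)) := by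
      funext u
      by_cases huv : u = v
      · subst huv
        rw [hv, hr]
      · rw [hu u huv]
    rw [IsState, e]
    exact hs
  · have hvw : v ≠ w := fun e => A.ne (congrArg some e)
    have hw : s' w = s w + δ.step := by rw [hs', if_pos (Or.inr rfl)]
    have hu : ∀ u, u ≠ v → u ≠ w → s' u = s u := by
      intro u h1 h2
      rw [hs', if_neg (by simp [h1, h2])]
    obtain ⟨hr1, hr2⟩ := A.region_some hs h hcl
    have hmove : U.IsState s' := by
      have e : (fun u => U.region (dart u (s' u))) =
          (fun u => U.region (dart u (s u))) ∘ Equiv.swap v w := by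
        funext u
        rw [Function.comp_apply]
        by_cases huv : u = v
        · subst huv
          rw [hv, hr1, Equiv.swap_apply_left]
        · by_cases huw : u = w
          · subst huw
            rw [hw, hr2, Equiv.swap_apply_right]
          · rw [hu u huv huw, Equiv.swap_apply_of_ne_of_ne huv huw]
      rw [IsState, e]
      exact Set.BijOn.comp hs (Set.bijOn_univ.2 (Equiv.swap v w).bijective)
    refine ⟨⟨hs, hmove, Or.inr ⟨v, w, hvw, hv, hw, hu, ?_, by rw [hv, hr1], by rw [hw, hr2]⟩⟩,
      A.isTour_some hs h (fun z => by simpa using hE z)⟩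
    exact fun e => hvw (hs.inj e)

end OneLinkoidUniverse

end Linkoid

namespace Linkoid

namespace OneLinkoidUniverse

variable {V : Type*} {U : OneLinkoidUniverse V} {s : V → ZMod 4} {δ : Sense} {γ : ℕ → Dart V}
  {v w : V} {o : Option V} {a b : ℕ}

theorem join_dart_lead_add_step (s : V → ZMod 4) (δ : Sense) (v : V) :
    join (smoothing s) (dart v (δ.lead (s v) + δ.step)) = dart v (δ.lead (s v)) := by
  rw [join_smoothing, dart_inj]
  generalize s v = x
  revert x
  cases δ <;> decide

theorem join_dart_lead (s : V → ZMod 4) (δ : Sense) (v : V) :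
    join (smoothing s) (dart v (δ.lead (s v))) = dart v (δ.lead (s v) + δ.step) := by
  rw [← join_dart_lead_add_step s δ v, join_join]

theorem arcEnd_congr {s s' : V → ZMod 4} (h : ∀ w, o = some w → s' w = s w) :
    arcEnd δ s' o = arcEnd δ s o := by
  rcases o with _ | w
  · rfl
  · simp only [arcEnd, h w rfl]

/-- The part of an arc in front of a passage through `c`, if the marker at `c` turns first across
this part. -/
theorem IsArc.before (A : U.IsArc δ γ s v o a b) {c : V} {κ : ℕ} (h1 : a < κ) (h2 : κ < b)
    (honce : ∀ k, a < k → k < b → k ≠ κ → ¬ IsAt (γ k) c) {s' : V → ZMod 4}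
    (hκ : join (smoothing s) (γ κ) = dart c (δ.lead (s' c)))
    (hv : s' v = s v)
    (hs' : ∀ u, (∃ k, a < k ∧ k < κ ∧ IsAt (γ k) u) → smoothing s' u = smoothing s u) :
    U.IsArc δ γ s' v (some c) a κ := by
  obtain ⟨z, hz, hzv, hzo⟩ := A.inner κ h1 h2
  have hcz : c = z := by
    have : IsAt (join (smoothing s) (γ κ)) c := ⟨_, hκ⟩
    exact ((isAt_join _).1 this).unique hz
  subst hcz
  refine ⟨h1, fun e => hzv (Option.some.inj e).symm, by rw [A.start, hv], ?_, ?_, ?_⟩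
  · intro k k1 k2
    rw [A.step k k1 (by omega)]
    refine join_congr fun u hu => (hs' u ⟨k + 1, by omega, k2, ?_⟩).symm
    rw [A.step k k1 (by omega), isAt_join]
    exact hu
  · intro k k1 k2
    obtain ⟨u, hu, huv, -⟩ := A.inner k k1 (by omega)
    refine ⟨u, hu, huv, ?_⟩
    rintro ⟨⟩
    exact honce k k1 (by omega) (by omega) hu
  · have e := A.step (κ - 1) (by omega) (by omega)
    rw [show κ - 1 + 1 = κ by omega] at e
    rw [e, join_join] at hκ
    exact hκ

/-- The part of an arc behind a passage through `c`, if the marker at `c` turns first across this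
part. -/
theorem IsArc.after (A : U.IsArc δ γ s v o a b) {c : V} {κ : ℕ} (h1 : a < κ) (h2 : κ < b)
    (honce : ∀ k, a < k → k < b → k ≠ κ → ¬ IsAt (γ k) c) {s' : V → ZMod 4}
    (hκ : γ κ = dart c (δ.lead (s' c)))
    (ho : ∀ w, o = some w → s' w = s w)
    (hs' : ∀ u, (∃ k, κ < k ∧ k < b ∧ IsAt (γ k) u) → smoothing s' u = smoothing s u) :
    U.IsArc δ γ s' c o κ b := by
  obtain ⟨z, hz, hzv, hzo⟩ := A.inner κ h1 h2
  have hcz : c = z := IsAt.unique ⟨_, hκ⟩ hz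
  subst hcz
  refine ⟨h2, hzo, hκ, ?_, ?_, by rw [A.finish, arcEnd_congr ho]⟩
  · intro k k1 k2
    rw [A.step k (by omega) k2]
    refine join_congr fun u hu => (hs' u ⟨k + 1, by omega, k2, ?_⟩).symm
    rw [A.step k (by omega) k2, isAt_join]
    exact hu
  · intro k k1 k2
    obtain ⟨u, hu, -, huo⟩ := A.inner k (by omega) k2
    refine ⟨u, hu, ?_, huo⟩
    rintro rfl
    exact honce k (by omega) k2 (by omega) hu

variable [Fintype V]

/-- The markers can be turned across every arc.  If the arc passes a crossing only once, it is cut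
there, and the marker of this crossing tells which part comes first; otherwise a single clock move
suffices. -/
theorem IsArc.exists_clockSequence (δ : Sense) (γ : ℕ → Dart V) : ∀ n a b, b - a ≤ n →
    ∀ (s : V → ZMod 4) (v : V) (o : Option V), U.IsState s → U.IsTour (smoothing s) →
      U.IsArc δ γ s v o a b → ∃ s', U.IsState s' ∧ U.IsTour (smoothing s') ∧
        U.ClockSequence δ s s' (turns γ v o a b) := by
  classical
  intro n
  induction n with
  | zero =>
    intro a b hab s v o _ _ A
    have := A.lt
    omega
  | succ n ih =>
    intro a b hab s v o hs h A
    have hov : ∀ w, o = some w → v ≠ w := fun w hw e => A.ne (by rw [hw, e])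
    have hnv : ∀ k, a < k → k < b → ¬ IsAt (γ k) v := by
      intro k k1 k2 hk
      obtain ⟨z, hz, hzv, -⟩ := A.inner k k1 k2
      exact hzv (hz.unique hk)
    have hno : ∀ w, o = some w → ∀ k, a < k → k < b → ¬ IsAt (γ k) w := by
      intro w hw k k1 k2 hk
      obtain ⟨z, hz, -, hzo⟩ := A.inner k k1 k2
      exact hzo ((hz.unique hk) ▸ hw.symm)
    by_cases hcl : ArcClosed γ a b
    · obtain ⟨hmove, htour⟩ := A.clockMove hs h hcl
        (s' := fun u => if u = v ∨ some u = o then s u + δ.step else s u) (fun u => rfl)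
      refine ⟨_, hmove.2.1, htour, ?_⟩
      have hseq := ClockSequence.cons hmove (ClockSequence.refl _)
      convert hseq using 1
      funext u
      by_cases hu : u = v ∨ some u = o
      · rw [turns_of_end hu, if_pos hu, if_neg (δ.add_step_ne _)]
      · rw [if_neg hu, if_pos rfl]
        push Not at hu
        by_cases hex : ∃ k, a < k ∧ k < b ∧ IsAt (γ k) u
        · obtain ⟨k, k1, k2, hk⟩ := hex
          refine turns_of_frozen hu.1 hu.2 ⟨a + 1, b - 1, by omega, by omega,
            ⟨k, by omega, by omega, hk⟩, ?_⟩
          intro p p1 p2 z hz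
          obtain ⟨q, q1, q2, qp, hq⟩ := hcl p z (by omega) (by omega) hz
          exact ⟨q, by omega, by omega, qp, hq⟩
        · push Not at hex
          exact turns_of_not_isAt hu.1 hu.2 hex
    · simp only [ArcClosed] at hcl
      push Not at hcl
      obtain ⟨κ, c, h1, h2, hc, honce⟩ := hcl
      have hcv : c ≠ v := fun e => hnv κ h1 h2 (e ▸ hc)
      have hco : some c ≠ o := fun e => hno c e.symm κ h1 h2 hc
      have hadd := turns_add h1 h2 hc honce A.inner A.ne (A.at_most_two h)
      rcases A.cusp hs h h1 h2 hc honce with hκ | hκ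
      · have hκ' : join (smoothing s) (γ κ) = dart c (δ.lead (s c)) := by
          rw [hκ, join_dart_lead_add_step]
        have A1 : U.IsArc δ γ s v (some c) a κ :=
          A.before h1 h2 honce hκ' rfl (fun _ _ => rfl)
        obtain ⟨s', hs', h', seq⟩ := ih a κ (by omega) s v (some c) hs h A1
        have hc' : s' c = s c + δ.step := by
          rw [seq.apply_eq, turns_of_end (Or.inr rfl), one_nsmul]
        have A2 : U.IsArc δ γ s' c o κ b := by
          refine A.after h1 h2 honce ?_ ?_ ?_
          · rw [hκ, hc', δ.lead_add_step]
          · intro w hw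
            rw [seq.apply_eq, turns_of_not_isAt (hov w hw).symm
              (fun e => hco (by rw [hw, e])) (fun k k1 k2 => hno w hw k k1 (by omega)), zero_nsmul,
              add_zero]
          · rintro u ⟨k, k1, k2, hk⟩
            refine (seq.smoothing_eq (even_turns ?_ ?_)).symm
            · rintro rfl
              exact hnv k (by omega) k2 hk
            · rintro ⟨⟩
              exact honce k (by omega) k2 (by omega) hk
        obtain ⟨s'', hs'', h'', seq'⟩ := ih κ b (by omega) s' c o hs' h' A2
        refine ⟨s'', hs'', h'', ?_⟩
        have := seq.trans seq'
        rwa [funext hadd] at this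
      · have A1 : U.IsArc δ γ s c o κ b :=
          A.after h1 h2 honce hκ (fun _ _ => rfl) (fun _ _ => rfl)
        obtain ⟨s', hs', h', seq⟩ := ih κ b (by omega) s c o hs h A1
        have hc' : s' c = s c + δ.step := by
          rw [seq.apply_eq, turns_of_end (Or.inl rfl), one_nsmul]
        have hκ' : join (smoothing s) (γ κ) = dart c (δ.lead (s' c)) := by
          rw [hκ, join_dart_lead, hc', δ.lead_add_step]
        have A2 : U.IsArc δ γ s' v (some c) a κ := by
          refine A.before h1 h2 honce hκ' ?_ ?_
          · rw [seq.apply_eq, turns_of_not_isAt hcv.symm A.ne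
              (fun k k1 k2 => hnv k (by omega) k2), zero_nsmul, add_zero]
          · rintro u ⟨k, k1, k2, hk⟩
            refine (seq.smoothing_eq (even_turns ?_ ?_)).symm
            · rintro rfl
              exact honce k (by omega) (by omega) (by omega) hk
            · intro e
              exact hno u e.symm k k1 (by omega) hk
        obtain ⟨s'', hs'', h'', seq'⟩ := ih a κ (by omega) s' v (some c) hs' h' A2
        refine ⟨s'', hs'', h'', ?_⟩
        have := seq.trans seq'
        rw [← funext hadd]
        simpa only [Nat.add_comm] using this

end OneLinkoidUniverse

end Linkoid

/-! ### The position of an exchange on the tour -/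

namespace Linkoid

namespace OneLinkoidUniverse

variable {V : Type*} {U : OneLinkoidUniverse V} {s : V → ZMod 4} {δ : Sense}
  {v w : V} {o : Option V}

variable [Fintype V]

/-- The other sense of rotation exchanges the two directions of the tour. -/
theorem near_far_counterclockwise (h : U.IsTour (smoothing s)) (v : V) :
    U.near s .counterclockwise v = 4 * Fintype.card V + 2 - U.far s .clockwise v ∧
      U.far s .counterclockwise v = 4 * Fintype.card V + 2 - U.near s .clockwise v := by
  rw [near_counterclockwise h, far_counterclockwise h, near_clockwise, far_clockwise]
  exact ⟨rfl, rfl⟩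

theorem exists_opposite (h : U.IsTour (smoothing s)) (δ : Sense) : ∃ δ' : Sense, ∀ v,
    U.near s δ' v = 4 * Fintype.card V + 2 - U.far s δ v ∧
      U.far s δ' v = 4 * Fintype.card V + 2 - U.near s δ v := by
  cases δ
  · exact ⟨.counterclockwise, near_far_counterclockwise h⟩
  · refine ⟨.clockwise, fun v => ?_⟩
    obtain ⟨h1, h2⟩ := near_far_counterclockwise h v
    have h3 := near_lt h .clockwise v
    have h4 : U.far s .clockwise v < 4 * Fintype.card V + 2 := h.pos_lt _
    omega

theorem exists_isAt_walk (h : U.IsTour (smoothing s)) {k : ℕ} (h0 : 0 < k)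
    (hk : k < 4 * Fintype.card V + 2) (hm : k ≠ 2 * Fintype.card V + 1) :
    ∃ u, IsAt (U.walk (smoothing s) k) u := by
  rcases hw : U.walk (smoothing s) k with ⟨u, i⟩ | b
  · exact ⟨u, i, rfl⟩
  · cases b
    · have := h.walk_inj hk (by omega) (hw.trans (show tail = U.walk (smoothing s) 0 from rfl))
      omega
    · exact absurd (h.walk_inj hk (by omega) (hw.trans h.walk_head.symm)) hm

/-- The piece of the trail from its passage at `4n + 2 - near v` to the head, or to the near passage
of the crossing `o`, is the mid-line of an exchange in the sense `δ` at `v` and `o`. -/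
def IsMidline (U : OneLinkoidUniverse V) (s : V → ZMod 4) (δ : Sense) (v : V) : Option V → Prop
  | none => U.far s δ v < 4 * Fintype.card V + 2 - U.near s δ v ∧
      4 * Fintype.card V + 2 - U.near s δ v < 2 * Fintype.card V + 1
  | some w => v ≠ w ∧ U.far s δ w < 4 * Fintype.card V + 2 - U.near s δ v ∧
      4 * Fintype.card V + 2 - U.near s δ v < U.near s δ w ∧
      U.near s δ w < 2 * Fintype.card V + 1 ∧
      (U.far s δ v < U.far s δ w ∨
        U.near s δ w < U.far s δ v ∧ U.far s δ v < 4 * Fintype.card V + 2 - U.near s δ w)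

theorem IsMidline.not_end (h : U.IsTour (smoothing s)) (M : U.IsMidline s δ v o) {u : V}
    (hu : u = v ∨ some u = o) {k : ℕ} (h1 : 4 * Fintype.card V + 2 - U.near s δ v < k)
    (h2 : k < U.arcStop s δ o) : ¬ IsAt (U.walk (smoothing s) k) u := by
  have hnv := near_lt h δ v
  rcases o with _ | w
  · obtain ⟨m1, m2⟩ := M
    simp only [arcStop] at h2
    rcases hu with rfl | hu
    · rw [isAt_walk_iff h δ (by omega)]
      omega
    · cases hu
  · obtain ⟨hvw, m1, m2, m3, m4⟩ := M
    simp only [arcStop] at h2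
    have hnw := near_lt h δ w
    rcases hu with rfl | hu
    · rw [isAt_walk_iff h δ (by omega)]
      omega
    · cases hu
      rw [isAt_walk_iff h δ (by omega)]
      omega

theorem IsMidline.lt_arcStop (M : U.IsMidline s δ v o) :
    4 * Fintype.card V + 2 - U.near s δ v < U.arcStop s δ o ∧
      U.arcStop s δ o ≤ 2 * Fintype.card V + 1 := by
  rcases o with _ | w
  · obtain ⟨m1, m2⟩ := M
    exact ⟨m2, le_rfl⟩
  · obtain ⟨hvw, m1, m2, m3, m4⟩ := M
    exact ⟨m2, m3.le⟩

theorem IsMidline.isArc (h : U.IsTour (smoothing s)) (M : U.IsMidline s δ v o) :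
    U.IsArc δ (U.walk (smoothing s)) s v o (4 * Fintype.card V + 2 - U.near s δ v)
      (U.arcStop s δ o) := by
  obtain ⟨l1, l2⟩ := M.lt_arcStop
  refine ⟨l1, ?_, walk_sub_near h δ v, fun k _ _ => rfl, ?_, ?_⟩
  · rintro rfl
    exact M.1 rfl
  · intro k k1 k2
    obtain ⟨u, hu⟩ := exists_isAt_walk h (k := k) (by omega) (by omega) (by omega)
    refine ⟨u, hu, ?_, ?_⟩
    · intro e
      exact M.not_end h (Or.inl e) k1 k2 hu
    · intro e
      exact M.not_end h (Or.inr e) k1 k2 hu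
  · rw [h.opp_walk (by omega)]
    rcases o with _ | w
    · simp only [arcStop, arcEnd]
      rw [show 4 * Fintype.card V + 1 - (2 * Fintype.card V + 1 - 1) =
        2 * Fintype.card V + 1 by omega, h.walk_head]
    · have := near_pos h δ w
      simp only [arcStop, arcEnd] at l2 ⊢
      rw [show 4 * Fintype.card V + 1 - (U.near s δ w - 1) =
        4 * Fintype.card V + 2 - U.near s δ w by omega, walk_sub_near h]

/-- If both passages of `w` are on the same side of the trail, then resmoothing `w` splits off a
loop.  To get a trail, another site that is passed once on this loop has to be resmoothed. -/
theorem exists_linked (hs : U.IsState s) (h : U.IsTour (smoothing s)) (δ : Sense)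
    {τ' : Smoothing V} {E : V → Prop} (hE : ∀ z, E z ↔ τ' z ≠ smoothing s z) (h' : U.IsTour τ')
    (hw : E w) (hside : U.near s δ w < 2 * Fintype.card V + 1 ∨
      2 * Fintype.card V + 1 < U.far s δ w) :
    ∃ z, E z ∧ z ≠ w ∧
      ¬ (((U.far s δ w < U.far s δ z ∧ U.far s δ z < U.near s δ w) ∨
          4 * Fintype.card V + 2 - U.near s δ w < U.far s δ z ∧
            U.far s δ z < 4 * Fintype.card V + 2 - U.far s δ w) ↔
        ((U.far s δ w < U.near s δ z ∧ U.near s δ z < U.near s δ w) ∨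
          4 * Fintype.card V + 2 - U.near s δ w < U.near s δ z ∧
            U.near s δ z < 4 * Fintype.card V + 2 - U.far s δ w)) := by
  by_contra hcon
  push Not at hcon
  have hf := far_pos h δ w
  have hfn := far_lt_near hs h δ w
  have hn := near_lt h δ w
  have key := (isTour_surgery_iff h δ hE).1 h'
    (fun k => ¬ ((U.far s δ w ≤ k ∧ k < U.near s δ w) ∨
      4 * Fintype.card V + 2 - U.near s δ w ≤ k ∧ k < 4 * Fintype.card V + 2 - U.far s δ w))
    (by omega) (by
      intro k hk hz
      obtain ⟨z1, z2, z3, z4⟩ := hz w hw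
      omega) (by
      intro z hz
      by_cases hzw : z = w
      · subst hzw
        refine ⟨?_, ?_, ?_, ?_⟩ <;> omega
      · have hc := hcon z hz hzw
        have hzf := far_pos h δ z
        have hzn := near_pos h δ z
        have hzf' : U.far s δ z < 4 * Fintype.card V + 2 := h.pos_lt _
        have hzn' := near_lt h δ z
        obtain ⟨n1, n2, n3, n4, n5, n6, n7, n8⟩ := slots_ne h δ hzw
        refine ⟨?_, ?_, ?_, ?_⟩ <;> omega)
    (U.far s δ w) (by omega)
  omega

theorem IsMidline.isTour_resmooth (hs : U.IsState s) (h : U.IsTour (smoothing s))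
    (M : U.IsMidline s δ v none) {τ' : Smoothing V} (hE : ∀ z, z = v ↔ τ' z ≠ smoothing s z) :
    U.IsTour τ' :=
  (M.isArc h).isTour_none hs h hE

/-- A crossing whose passages are on different sides of the trail is the site of a single exchange,
in one of the two senses. -/
theorem exists_isMidline_none (hs : U.IsState s) (h : U.IsTour (smoothing s)) (v : V)
    (hside : ∀ δ, ¬ U.near s δ v < 2 * Fintype.card V + 1) : ∃ δ, U.IsMidline s δ v none := by
  have h1 := hside .clockwise
  have h2 := hside .counterclockwise
  obtain ⟨e1, e2⟩ := near_far_counterclockwise h v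
  have hm := far_near_ne_middle h .clockwise v
  have hfn := far_add_near_ne h .clockwise v
  have hn := near_lt h .clockwise v
  have hl := far_lt_near hs h .clockwise v
  rcases lt_or_gt_of_ne hfn with hlt | hgt
  · exact ⟨.clockwise, by simp only [IsMidline]; omega⟩
  · exact ⟨.counterclockwise, by simp only [IsMidline]; omega⟩

theorem exists_isMidline_some (hs : U.IsState s) (h : U.IsTour (smoothing s)) {τ' : Smoothing V}
    (hvw : v ≠ w) (hE : ∀ z, (z = v ∨ z = w) ↔ τ' z ≠ smoothing s z) (h' : U.IsTour τ')
    (hside : U.near s δ w < 2 * Fintype.card V + 1) :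
    (∃ δ', U.IsMidline s δ' v (some w)) ∨ ∃ δ', U.IsMidline s δ' w (some v) := by
  obtain ⟨z, hz, hzw, hlink⟩ := exists_linked hs h δ hE h' (Or.inr rfl) (Or.inl hside)
  have hzv : z = v := hz.resolve_right hzw
  subst hzv
  have c1 := fun p q r => not_far_near_crossing hs h δ (v := z) (w := w) p q r
  have c2 := fun p q r => not_far_near_crossing hs h δ (v := w) (w := z) p q r
  have hfz := far_lt_near hs h δ z
  have hfw := far_lt_near hs h δ w
  have hnz := near_lt h δ z
  have hpw := far_pos h δ w
  obtain ⟨n1, n2, n3, n4, n5, n6, n7, n8⟩ := slots_ne h δ hvw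
  have k1 : ¬ (U.far s δ w < U.far s δ z ∧ U.far s δ z < U.near s δ w) := by
    rintro ⟨i1, i2⟩
    rcases lt_or_ge (U.near s δ z) (U.near s δ w) with i3 | i3
    · omega
    · exact c2 i1 i2 (by omega)
  have k2 : ¬ (U.far s δ w < U.near s δ z ∧ U.near s δ z < U.near s δ w) := by
    rintro ⟨i1, i2⟩
    rcases lt_or_ge (U.far s δ z) (U.far s δ w) with i3 | i3
    · exact c1 i3 i1 i2
    · omega
  by_cases k3 : 4 * Fintype.card V + 2 - U.near s δ w < U.far s δ z ∧
      U.far s δ z < 4 * Fintype.card V + 2 - U.far s δ w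
  · right
    obtain ⟨δ', hδ'⟩ := exists_opposite h δ
    obtain ⟨e1, e2⟩ := hδ' z
    obtain ⟨e3, e4⟩ := hδ' w
    refine ⟨δ', hvw.symm, ?_⟩
    rw [e1, e2, e3, e4]
    omega
  · left
    refine ⟨δ, hvw, ?_⟩
    omega

open Classical in
/-- Turning the markers across the mid-line gives the state of the exchanged trail. -/
theorem IsMidline.clockSequence {s' : V → ZMod 4} (hs : U.IsState s) (h : U.IsTour (smoothing s))
    (hs' : U.IsState s') (M : U.IsMidline s δ v o)
    (hE : ∀ z, (z = v ∨ some z = o) ↔ smoothing s' z ≠ smoothing s z) :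
    U.ClockSequence δ s s' (turns (U.walk (smoothing s)) v o
      (4 * Fintype.card V + 2 - U.near s δ v) (U.arcStop s δ o)) := by
  obtain ⟨t, ht, ht', seq⟩ :=
    IsArc.exists_clockSequence δ _ _ _ _ le_rfl s v o hs h (M.isArc h)
  have e : smoothing t = smoothing s' := by
    funext z
    by_cases hz : z = v ∨ some z = o
    · have h1 := (hE z).1 hz
      have h2 : smoothing t z ≠ smoothing s z := by
        apply smoothing_add_step_ne (δ := δ)
        rw [seq.apply_eq, turns_of_end hz, one_nsmul]
      revert h1 h2
      cases smoothing t z <;> cases smoothing s' z <;> cases smoothing s z <;> simp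
    · have h1 : smoothing s' z = smoothing s z := by
        by_contra hne
        exact hz ((hE z).2 hne)
      push Not at hz
      rw [h1, seq.smoothing_eq (even_turns hz.1 hz.2)]
  have := ht.eq_of_smoothing_eq hs' ht' e
  rwa [this] at seq

end OneLinkoidUniverse

end Linkoid

/-! ### Two separate single exchanges -/

namespace Linkoid

theorem Sense.step_injective {δ δ' : Sense} (h : δ.step = δ'.step) : δ = δ' := by
  cases δ <;> cases δ' <;> first | rfl | exact absurd h (by decide)

namespace OneLinkoidUniverse

variable {V : Type*} {U : OneLinkoidUniverse V} {s : V → ZMod 4} {δ : Sense}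
  {v w : V} {o : Option V}

theorem walk_congr {τ τ' : Smoothing V} {k : ℕ}
    (h : ∀ j, 0 < j → j ≤ k → ∀ z, IsAt (U.walk τ j) z → τ z = τ' z) :
    U.walk τ' k = U.walk τ k := by
  induction k with
  | zero => rfl
  | succ k ih =>
    rw [walk_succ, ih (fun j h1 h2 => h j h1 (by omega)), walk_succ]
    refine (join_congr fun z hz => h (k + 1) (by omega) le_rfl z ?_).symm
    rw [walk_succ, isAt_join]
    exact hz

variable [Fintype V]

/-- The trail passes every crossing exactly twice. -/
theorem exists_passages (hs : U.IsState s) (h : U.IsTour (smoothing s)) (u : V) :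
    ∃ p q, 0 < p ∧ p < q ∧ q < 2 * Fintype.card V + 1 ∧
      ∀ k, k < 2 * Fintype.card V + 1 → (IsAt (U.walk (smoothing s) k) u ↔ k = p ∨ k = q) := by
  have hf := far_pos h .clockwise u
  have hfn := far_lt_near hs h .clockwise u
  have hn := near_lt h .clockwise u
  have hm := far_near_ne_middle h .clockwise u
  have hne := far_add_near_ne h .clockwise u
  have key : ∀ f n : ℕ, 0 < f → f < n → n < 4 * Fintype.card V + 2 →
      f ≠ 2 * Fintype.card V + 1 → n ≠ 2 * Fintype.card V + 1 →
      f ≠ 4 * Fintype.card V + 2 - n → ∃ p q, 0 < p ∧ p < q ∧ q < 2 * Fintype.card V + 1 ∧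
      ∀ k, k < 2 * Fintype.card V + 1 → ((k = f ∨ k = n ∨ k = 4 * Fintype.card V + 2 - f ∨
        k = 4 * Fintype.card V + 2 - n) ↔ k = p ∨ k = q) := by
    intro f n h1 h2 h3 h4 h5 h6
    rcases lt_or_ge n (2 * Fintype.card V + 1) with i | i
    · exact ⟨f, n, by omega, by omega, by omega, fun k hk => by omega⟩
    · rcases lt_or_ge f (2 * Fintype.card V + 1) with j | j
      · rcases lt_or_ge f (4 * Fintype.card V + 2 - n) with l | l
        · exact ⟨f, _, by omega, l, by omega, fun k hk => by omega⟩
        · exact ⟨4 * Fintype.card V + 2 - n, f, by omega, by omega, by omega,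
            fun k hk => by omega⟩
      · exact ⟨4 * Fintype.card V + 2 - n, 4 * Fintype.card V + 2 - f, by omega, by omega,
          by omega, fun k hk => by omega⟩
  obtain ⟨p, q, h0, h1, h2, h3⟩ := key _ _ hf hfn hn hm.1 hm.2 hne
  exact ⟨p, q, h0, h1, h2, fun k hk => by rw [isAt_walk_iff h .clockwise (by omega), h3 k hk]⟩

theorem not_near_lt_of_single (hs : U.IsState s) (h : U.IsTour (smoothing s)) {τ' : Smoothing V}
    (hE : ∀ z, z = v ↔ τ' z ≠ smoothing s z) (h' : U.IsTour τ') (δ : Sense) :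
    ¬ U.near s δ v < 2 * Fintype.card V + 1 := by
  intro hside
  obtain ⟨z, hz, hzv, -⟩ := exists_linked hs h δ hE h' rfl (Or.inl hside)
  exact hzv hz

/-- The position of the passages of `v`, in the order of the trail, whatever the sense is. -/
theorem IsMidline.clockwise_cases (h : U.IsTour (smoothing s)) (M : U.IsMidline s δ v none) :
    ∃ p q, p = U.far s δ v ∧ q = 4 * Fintype.card V + 2 - U.near s δ v ∧ 0 < p ∧ p < q ∧
      q < 2 * Fintype.card V + 1 ∧
      ((U.far s .clockwise v = p ∧ U.near s .clockwise v = 4 * Fintype.card V + 2 - q) ∨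
        U.far s .clockwise v = q ∧ U.near s .clockwise v = 4 * Fintype.card V + 2 - p) := by
  obtain ⟨m1, m2⟩ := M
  have h1 := near_lt h δ v
  have h2 := far_pos h δ v
  have h3 := near_lt h .clockwise v
  have h4 : U.far s .clockwise v < 4 * Fintype.card V + 2 := h.pos_lt _
  refine ⟨_, _, rfl, rfl, h2, m1, m2, ?_⟩
  cases δ
  · left
    omega
  · right
    obtain ⟨e1, e2⟩ := near_far_counterclockwise h v
    omega

/-- Two sites that can be resmoothed separately, and also together, are passed one after the other
by the trail. -/
theorem passages_separate (hs : U.IsState s) (h : U.IsTour (smoothing s)) {τ' : Smoothing V}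
    {δ' : Sense} (hvw : v ≠ w) (hE : ∀ z, (z = v ∨ z = w) ↔ τ' z ≠ smoothing s z)
    (h' : U.IsTour τ') (M : U.IsMidline s δ v none) (M' : U.IsMidline s δ' w none)
    (hlt : 4 * Fintype.card V + 2 - U.near s δ v < 4 * Fintype.card V + 2 - U.near s δ' w) :
    4 * Fintype.card V + 2 - U.near s δ v < U.far s δ' w := by
  have c1 := fun p q r => not_far_near_crossing hs h .clockwise (v := v) (w := w) p q r
  have c2 := fun p q r => not_far_near_crossing hs h .clockwise (v := w) (w := v) p q r
  obtain ⟨n1, n2, n3, n4, n5, n6, n7, n8⟩ := slots_ne h .clockwise hvw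
  obtain ⟨p, q, hp, hq, h1, h2, h3, hv⟩ := M.clockwise_cases h
  obtain ⟨a, b, ha, hb, h4, h5, h6, hw⟩ := M'.clockwise_cases h
  rw [← hq, ← hb] at hlt
  rw [← hq, ← ha]
  have hS := (isTour_surgery_iff h .clockwise hE).1 h'
  by_contra hcon
  clear hp hq ha hb
  have hpa : p < a := by
    by_contra hpa
    rcases hv with ⟨e1, e2⟩ | ⟨e1, e2⟩ <;> rcases hw with ⟨e3, e4⟩ | ⟨e3, e4⟩ <;>
      simp only [e1, e2, e3, e4] at c1 c2
    · exact c2 (by omega) (by omega) (by omega)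
    · exact c1 (by omega) (by omega) (by omega)
    · exact c2 (by omega) (by omega) (by omega)
    · exact c1 (by omega) (by omega) (by omega)
  have haq : a < q := by
    rcases hv with ⟨e1, e2⟩ | ⟨e1, e2⟩ <;> rcases hw with ⟨e3, e4⟩ | ⟨e3, e4⟩ <;>
      omega
  -- otherwise these pieces of the tour would become a component of their own
  have key := hS (fun k => ¬ ((p ≤ k ∧ k < a) ∨ (q ≤ k ∧ k < b) ∨
      (4 * Fintype.card V + 2 - b ≤ k ∧ k < 4 * Fintype.card V + 2 - q) ∨
      4 * Fintype.card V + 2 - a ≤ k ∧ k < 4 * Fintype.card V + 2 - p)) (by omega) (by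
    intro k hk hz
    have z1 := hz v (Or.inl rfl)
    have z2 := hz w (Or.inr rfl)
    rcases hv with ⟨e1, e2⟩ | ⟨e1, e2⟩ <;> rcases hw with ⟨e3, e4⟩ | ⟨e3, e4⟩ <;>
      rw [e1, e2] at z1 <;> rw [e3, e4] at z2 <;> omega) (by
    rintro z (rfl | rfl)
    · rcases hv with ⟨e1, e2⟩ | ⟨e1, e2⟩ <;> rw [e1, e2] <;>
        refine ⟨?_, ?_, ?_, ?_⟩ <;> omega
    · rcases hw with ⟨e3, e4⟩ | ⟨e3, e4⟩ <;> rw [e3, e4] <;>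
        refine ⟨?_, ?_, ?_, ?_⟩ <;> omega) p (by omega)
  omega

/-- Two separate single exchanges in the same sense: the site passed last is exchanged first. -/
theorem exists_clockSequence_of_separate {s' : V → ZMod 4} {δ' : Sense} (hs : U.IsState s)
    (h : U.IsTour (smoothing s)) (hs' : U.IsState s') (h' : U.IsTour (smoothing s')) (hvw : v ≠ w)
    (hE : ∀ z, (z = v ∨ z = w) ↔ smoothing s' z ≠ smoothing s z)
    (hv : s' v = s v + δ.step) (hw : s' w = s w + δ.step)
    (M : U.IsMidline s δ' v none) {δ'' : Sense} (M' : U.IsMidline s δ'' w none)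
    (hlt : 4 * Fintype.card V + 2 - U.near s δ' v < 4 * Fintype.card V + 2 - U.near s δ'' w) :
    ∃ t, U.ClockSequence δ s s' t := by
  classical
  have hsep := passages_separate hs h hvw hE h' M M' hlt
  obtain ⟨m1, m2⟩ := M
  have M'' := M'
  obtain ⟨m3, m4⟩ := M''
  have hnv := near_lt h δ' v
  have hnw := near_lt h δ'' w
  obtain ⟨r, hr, hr', seq⟩ :=
    IsArc.exists_clockSequence δ'' _ _ _ _ le_rfl s w none hs h (M'.isArc h)
  have hrv : r v = s v := by
    rw [seq.apply_eq, turns_of_not_isAt hvw (by simp), zero_nsmul, add_zero]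
    intro k k1 k2
    simp only [arcStop] at k2
    rw [isAt_walk_iff h δ' (by omega)]
    omega
  have hrw : r w = s w + δ''.step := by
    rw [seq.apply_eq, turns_of_end (Or.inl rfl), one_nsmul]
  have hrE : ∀ z, z ≠ w → smoothing s z = smoothing r z := fun z hz =>
    seq.smoothing_eq (even_turns hz (by simp))
  have hrE' : ∀ z, z = v ↔ smoothing s' z ≠ smoothing r z := by
    intro z
    by_cases hzw : z = w
    · subst hzw
      have e1 := (hE z).1 (Or.inr rfl)
      have e2 : smoothing r z ≠ smoothing s z := smoothing_add_step_ne hrw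
      constructor
      · exact fun e => absurd e.symm hvw
      · intro e
        exfalso
        revert e e1 e2
        cases smoothing r z <;> cases smoothing s' z <;> cases smoothing s z <;> simp
    · rw [← hrE z hzw, ← hE z]
      simp [hzw]
  obtain ⟨ε, Mr⟩ := exists_isMidline_none hr hr' v
    (fun ε => not_near_lt_of_single hr hr' hrE' h' ε)
  have seq' := Mr.clockSequence hr hr' hs' (fun z => by simpa using hrE' z)
  have hεv : s' v = r v + ε.step := by
    rw [seq'.apply_eq, turns_of_end (Or.inl rfl), one_nsmul]
  have hε : ε = δ := by
    apply Sense.step_injective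
    rw [hv, hrv] at hεv
    exact (add_left_cancel hεv).symm
  subst hε
  -- the trail of `r` agrees with that of `s` up to the first passage through `w`
  have hwalk : ∀ k, k < U.far s δ'' w → U.walk (smoothing r) k = U.walk (smoothing s) k := by
    intro k hk
    refine walk_congr fun j j1 j2 z hz => hrE z ?_
    rintro rfl
    rw [isAt_walk_iff h δ'' (by omega)] at hz
    omega
  have hμ : 4 * Fintype.card V + 2 - U.near r ε v < U.far s δ'' w := by
    obtain ⟨p, q, h1, h2, h3, h4⟩ := exists_passages hr hr' v
    have i1 := (h4 (U.far s δ' v) (by omega)).1 (by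
      rw [hwalk _ (by omega)]
      exact ⟨_, walk_far h δ' v⟩)
    have i2 := (h4 (4 * Fintype.card V + 2 - U.near s δ' v) (by omega)).1 (by
      rw [hwalk _ (by omega)]
      exact ⟨_, walk_sub_near h δ' v⟩)
    have i3 := (h4 (4 * Fintype.card V + 2 - U.near r ε v) Mr.2).1 ⟨_, walk_sub_near hr' ε v⟩
    omega
  have hwt : s' w = r w := by
    rw [seq'.apply_eq]
    by_cases hf : Frozen (U.walk (smoothing r)) (4 * Fintype.card V + 2 - U.near r ε v)
        (U.arcStop r ε none) w
    · rw [turns_of_frozen hvw.symm (by simp) hf, zero_nsmul, add_zero]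
    · rw [turns_of_not_frozen hvw.symm (by simp) hf]
      obtain ⟨p, q, h1, h2, h3, h4⟩ := exists_passages hr hr' w
      have hle : ∀ k, k < 2 * Fintype.card V + 1 → IsAt (U.walk (smoothing r) k) w →
          U.far s δ'' w ≤ k := by
        intro k hk hkw
        by_contra hcon
        rw [hwalk k (by omega), isAt_walk_iff h δ'' (by omega)] at hkw
        omega
      have hp := hle p (by omega) ((h4 p (by omega)).2 (Or.inl rfl))
      have hcard : (Finset.Ioo (4 * Fintype.card V + 2 - U.near r ε v)
          (U.arcStop r ε none)).filter (fun k => IsAt (U.walk (smoothing r) k) w) = {p, q} := by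
        ext k
        simp only [arcStop, Finset.mem_filter, Finset.mem_Ioo, Finset.mem_insert,
          Finset.mem_singleton]
        constructor
        · rintro ⟨⟨k1, k2⟩, hk⟩
          exact (h4 k k2).1 hk
        · intro hk
          exact ⟨⟨by omega, by omega⟩, (h4 k (by omega)).2 hk⟩
      rw [hcard, Finset.card_pair (by omega)]
      have : ∀ x y : ZMod 4, x + (2 * 2) • y = x := by decide
      exact this _ _
  have hδ : δ'' = ε := by
    apply Sense.step_injective
    rw [hwt, hrw] at hw
    exact add_left_cancel hw
  subst hδ
  exact ⟨_, seq.trans seq'⟩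

end OneLinkoidUniverse

end Linkoid

/-! ### Riders and atoms of the mid-line -/

namespace Linkoid

namespace OneLinkoidUniverse

variable {V : Type*} [Fintype V] {U : OneLinkoidUniverse V} {τ : Smoothing V} {E : Finset V}
  {u v : V} {a b c d p q : ℕ} {A B : Set V}

theorem PassesAt.unique (h : U.PassesAt τ p u) (h' : U.PassesAt τ p v) : u = v :=
  IsAt.unique h.2 h'.2

theorem OnMidline.cusp_or_selfSite (hp : U.OnMidline τ E p) (h : U.PassesAt τ p v) :
    U.IsCusp τ E v ∨ U.IsSelfSite τ E v := by
  obtain ⟨⟨w, hw, hpw⟩, -⟩ := id hp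
  obtain rfl := h.unique hpw
  by_cases hall : ∀ q, U.PassesAt τ q v → U.OnMidline τ E q
  · exact Or.inr ⟨hw, hall⟩
  · push Not at hall
    exact Or.inl ⟨hw, ⟨p, h, hp⟩, hall⟩

theorem IsCusp.not_selfSite (h : U.IsCusp τ E v) : ¬ U.IsSelfSite τ E v := by
  obtain ⟨-, -, q, hq, hq'⟩ := h
  exact fun h' => hq' (h'.2 q hq)

theorem IsSelfSite.liesOn_iff (h : U.IsSelfSite τ E v) (R : U.IsRider τ E a b)
    (hp : U.PassesAt τ p v) : U.LiesOn τ a b v ↔ a ≤ p ∧ p ≤ b := by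
  constructor
  · rintro ⟨q, hq, q1, q2⟩
    exact R.2.2 v h q p hq hp q1 q2
  · exact fun hab => ⟨p, hp, hab⟩

/-- Removing from a rider a part of it that does not interact with the rest leaves a rider. -/
theorem IsRider.shrink (R : U.IsRider τ E a b) (hac : a ≤ c) (hdb : d ≤ b)
    (hv : U.IsSelfSite τ E v) (hl : U.LiesOn τ c d v)
    (hcl : ∀ z, U.IsSelfSite τ E z → ∀ p q, U.PassesAt τ p z → U.PassesAt τ q z →
      c ≤ p → p ≤ d → a ≤ q → q ≤ b → c ≤ q ∧ q ≤ d) : U.IsRider τ E c d := by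
  obtain ⟨p, hp, p1, p2⟩ := hl
  refine ⟨fun k k1 k2 => R.1 k (by omega) (by omega), ⟨v, p, hv, hp, p1, p2⟩, ?_⟩
  intro z hz p q hp hq p1 p2
  obtain ⟨q1, q2⟩ := R.2.2 z hz p q hp hq (by omega) (by omega)
  exact hcl z hz p q hp hq p1 p2 q1 q2

/-- Either end of a smallest rider that contains `v` is a passage through the atom of `v`: an end at
a cusp could be cut off, and so could the part of the rider inside or outside another rider. -/
theorem IsRider.atom_of_minimal (R : U.IsRider τ E a b) (hv : U.IsSelfSite τ E v)
    (hl : U.LiesOn τ a b v)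
    (hmin : ∀ c d, a ≤ c → d ≤ b → U.IsRider τ E c d → U.LiesOn τ c d v → c = a ∧ d = b)
    {e : ℕ} (he : e = a ∨ e = b) :
    ∃ u, U.PassesAt τ e u ∧ U.IsSelfSite τ E u ∧
      ∀ c d, U.IsRider τ E c d → (U.LiesOn τ c d v ↔ U.LiesOn τ c d u) := by
  obtain ⟨r, hr, r1, r2⟩ := hl
  have hon : U.OnMidline τ E e := R.1 e (by omega) (by omega)
  obtain ⟨⟨u, -, hu⟩, -⟩ := id hon
  have hself : U.IsSelfSite τ E u := by
    refine (hon.cusp_or_selfSite hu).resolve_left fun hc => ?_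
    have hz : ∀ z, U.IsSelfSite τ E z → ∀ k, U.PassesAt τ k z → k ≠ e := by
      rintro z hz k hk rfl
      obtain rfl := hk.unique hu
      exact hc.not_selfSite hz
    have hre := hz v hv r hr
    rcases he with rfl | rfl
    · have l : U.LiesOn τ (e + 1) b v := ⟨r, hr, by omega, r2⟩
      have := hmin (e + 1) b (by omega) le_rfl (R.shrink (by omega) le_rfl hv l (by
        intro z z1 p q _ hq _ _ q1 q2
        have := hz z z1 q hq
        omega)) l
      omega
    · have l : U.LiesOn τ a (e - 1) v := ⟨r, hr, by omega, by omega⟩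
      have := hmin a (e - 1) le_rfl (by omega) (R.shrink le_rfl (by omega) hv l (by
        intro z z1 p q _ hq _ _ q1 q2
        have := hz z z1 q hq
        omega)) l
      omega
  refine ⟨u, hu, hself, fun c d R' => ⟨?_, ?_⟩⟩
  · intro l
    obtain ⟨k1, k2⟩ := (hv.liesOn_iff R' hr).1 l
    have l' : U.LiesOn τ (max a c) (min b d) v := ⟨r, hr, by omega, by omega⟩
    have := hmin _ _ (by omega) (by omega) (R.shrink (by omega) (by omega) hv l' (by
      intro z z1 p q hp hq p1 p2 q1 q2
      have := R'.2.2 z z1 p q hp hq (by omega) (by omega)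
      omega)) l'
    exact ⟨e, hu, by omega, by omega⟩
  · intro l
    obtain ⟨k1, k2⟩ := (hself.liesOn_iff R' hu).1 l
    by_contra hcon
    rw [hv.liesOn_iff R' hr] at hcon
    rcases he with rfl | rfl
    · have l' : U.LiesOn τ (d + 1) b v := ⟨r, hr, by omega, by omega⟩
      have := hmin _ _ (by omega) le_rfl (R.shrink (by omega) le_rfl hv l' (by
        intro z z1 p q hp hq p1 p2 q1 q2
        by_contra hq'
        have := R'.2.2 z z1 q p hq hp (by omega) (by omega)
        omega)) l'
      omega
    · have l' : U.LiesOn τ a (c - 1) v := ⟨r, hr, by omega, by omega⟩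
      have := hmin _ _ le_rfl (by omega) (R.shrink le_rfl (by omega) hv l' (by
        intro z z1 p q hp hq p1 p2 q1 q2
        by_contra hq'
        have := R'.2.2 z z1 q p hq hp (by omega) (by omega)
        omega)) l'
      omega

theorem IsInvolved.of_ridesOn (h : U.IsInvolved τ E A) (hAB : U.RidesOn τ A B) :
    U.IsInvolved τ E B := by
  obtain ⟨c, p, hc, hpc, hp, u, hu, v, hv, i, j, hi, hj, h1, h2⟩ := h
  obtain ⟨u', hu', -, -, i', -, hi', -, h3, -⟩ := hAB.2 u hu i hi
  obtain ⟨-, -, v', hv', -, j', -, hj', -, h4⟩ := hAB.2 v hv j hj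
  exact ⟨c, p, hc, hpc, hp, u', hu', v', hv', i', j', hi', hj', by omega, by omega⟩

/-- A rider without cusps is a local knot on the mid-line. -/
theorem IsRider.frozen (hm : ∀ p, U.OnMidline τ E p ↔ a < p ∧ p < b)
    (h2 : ∀ u, ∃ p q, p ≠ q ∧ ∀ k, U.PassesAt τ k u ↔ k = p ∨ k = q) (R : U.IsRider τ E c d)
    (hc : ∀ z, U.IsCusp τ E z → ¬ U.LiesOn τ c d z) (hv : U.LiesOn τ c d v) :
    Frozen (U.walk τ) a b v := by
  obtain ⟨p, hp, p1, p2⟩ := hv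
  have e1 := (hm c).1 (R.1 c le_rfl (by omega))
  have e2 := (hm d).1 (R.1 d (by omega) le_rfl)
  refine ⟨c, d, e1.1, e2.2, ⟨p, p1, p2, hp.2⟩, fun k k1 k2 z hz => ?_⟩
  have hk := R.1 k k1 k2
  obtain ⟨⟨y, -, hy⟩, -⟩ := id hk
  obtain rfl : z = y := IsAt.unique hz hy.2
  have hs := (hk.cusp_or_selfSite hy).resolve_left fun h => hc z h ⟨k, hy, k1, k2⟩
  obtain ⟨r, t, hrt, hrt'⟩ := h2 z
  obtain ⟨l, hl, hlk⟩ : ∃ l, U.PassesAt τ l z ∧ l ≠ k := by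
    rcases (hrt' k).1 hy with rfl | rfl
    · exact ⟨t, (hrt' t).2 (Or.inr rfl), hrt.symm⟩
    · exact ⟨r, (hrt' r).2 (Or.inl rfl), hrt⟩
  have := R.2.2 z hs k l hy hl k1 k2
  exact ⟨l, this.1, this.2, hlk, hl.2⟩

/-- A local knot on the mid-line contains both passages of each of its crossings. -/
theorem exists_of_frozen (hm : ∀ p, U.OnMidline τ E p ↔ a < p ∧ p < b)
    (h2 : ∀ u, ∃ p q, p ≠ q ∧ ∀ k, U.PassesAt τ k u ↔ k = p ∨ k = q)
    (hF : Frozen (U.walk τ) a b v) : ∃ c d, U.LiesOn τ c d v ∧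
      (∀ p, c ≤ p → p ≤ d → U.OnMidline τ E p) ∧
      ∀ z p q, U.PassesAt τ p z → U.PassesAt τ q z → c ≤ p → p ≤ d → c ≤ q ∧ q ≤ d := by
  obtain ⟨c, d, h3, h4, ⟨p, p1, p2, hp⟩, hcl⟩ := hF
  have hon : ∀ p, c ≤ p → p ≤ d → U.OnMidline τ E p := fun p h5 h6 =>
    (hm p).2 ⟨by omega, by omega⟩
  have hle : ∀ p, c ≤ p → p ≤ d → p ≤ 2 * Fintype.card V := fun p h5 h6 => by
    obtain ⟨⟨y, -, hy⟩, -⟩ := hon p h5 h6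
    exact hy.1
  refine ⟨c, d, ⟨p, ⟨hle p p1 p2, hp⟩, p1, p2⟩, hon, fun z k l hk hl k1 k2 => ?_⟩
  obtain ⟨m, m1, m2, m3, m4⟩ := hcl k k1 k2 z hk.2
  obtain ⟨r, t, hrt, hrt'⟩ := h2 z
  have i1 := (hrt' k).1 hk
  have i2 := (hrt' l).1 hl
  have i3 := (hrt' m).1 ⟨hle m m1 m2, m4⟩
  omega

theorem IsCusp.not_frozen (hm : ∀ p, U.OnMidline τ E p ↔ a < p ∧ p < b)
    (h2 : ∀ u, ∃ p q, p ≠ q ∧ ∀ k, U.PassesAt τ k u ↔ k = p ∨ k = q) (hv : U.IsCusp τ E v) :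
    ¬ Frozen (U.walk τ) a b v := by
  intro hF
  obtain ⟨c, d, ⟨p, hp, p1, p2⟩, hon, hcl⟩ := exists_of_frozen hm h2 hF
  obtain ⟨-, -, q, hq, hq'⟩ := hv
  have := hcl v p q hp hq p1 p2
  exact hq' (hon q this.1 this.2)

/-- A local knot that meets an atom contains its span, and hence no cusp on it. -/
theorem IsInvolved.not_frozen (hm : ∀ p, U.OnMidline τ E p ↔ a < p ∧ p < b)
    (h2 : ∀ u, ∃ p q, p ≠ q ∧ ∀ k, U.PassesAt τ k u ↔ k = p ∨ k = q) (hA : U.IsAtom τ E A)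
    (hI : U.IsInvolved τ E A) (hv : v ∈ A) : ¬ Frozen (U.walk τ) a b v := by
  intro hF
  obtain ⟨c, d, hl, hon, hcl⟩ := exists_of_frozen hm h2 hF
  obtain ⟨u₀, -, rfl⟩ := hA
  have R : U.IsRider τ E c d := by
    obtain ⟨p, hp, p1, p2⟩ := hl
    exact ⟨hon, ⟨v, p, hv.1, hp, p1, p2⟩, fun z _ => hcl z⟩
  have hl₀ := (hv.2 c d R).2 hl
  obtain ⟨z, p, hz, hpz, -, u, hu, w, hw, i, j, hi, hj, h3, h4⟩ := hI
  have e1 := (hu.1.liesOn_iff R hi).1 ((hu.2 c d R).1 hl₀)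
  have e2 := (hw.1.liesOn_iff R hj).1 ((hw.2 c d R).1 hl₀)
  obtain ⟨-, -, q, hq, hq'⟩ := hz
  have := hcl z p q hpz hq (by omega) (by omega)
  exact hq' (hon q this.1 this.2)

/-- The smallest rider around a site of an atom that is not involved is a local knot. -/
theorem IsAtom.frozen (hm : ∀ p, U.OnMidline τ E p ↔ a < p ∧ p < b)
    (h2 : ∀ u, ∃ p q, p ≠ q ∧ ∀ k, U.PassesAt τ k u ↔ k = p ∨ k = q) (hA : U.IsAtom τ E A)
    (hI : ¬ U.IsInvolved τ E A) (hv : v ∈ A) : Frozen (U.walk τ) a b v := by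
  obtain ⟨u₀, -, hA⟩ := hA
  have hv' := hA ▸ hv
  obtain ⟨hs, hatom⟩ := hv'
  have hex : ∃ n c d, U.IsRider τ E c d ∧ U.LiesOn τ c d v ∧ d - c = n := by
    obtain ⟨p, q, -, hpq⟩ := h2 v
    have hp := (hpq p).2 (Or.inl rfl)
    have hself : ∀ z, U.IsSelfSite τ E z → ∀ k, U.PassesAt τ k z → a + 1 ≤ k ∧ k ≤ b - 1 := by
      intro z hz k hk
      have := (hm k).1 (hz.2 k hk)
      omega
    refine ⟨_, a + 1, b - 1, ⟨fun k k1 k2 => (hm k).2 ⟨by omega, by omega⟩,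
      ⟨v, p, hs, hp, hself v hs p hp⟩, fun z hz k l _ hl _ _ => hself z hz l hl⟩,
      ⟨p, hp, hself v hs p hp⟩, rfl⟩
  classical
  obtain ⟨c, d, R, hl, hn⟩ := Nat.find_spec hex
  have hmin : ∀ c' d', c ≤ c' → d' ≤ d → U.IsRider τ E c' d' → U.LiesOn τ c' d' v →
      c' = c ∧ d' = d := by
    intro c' d' h3 h4 R' hl'
    have := Nat.find_min' hex ⟨c', d', R', hl', rfl⟩
    obtain ⟨p, -, p1, p2⟩ := hl
    obtain ⟨p', -, p1', p2'⟩ := hl'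
    omega
  have hends : ∀ e, e = c ∨ e = d → ∃ u ∈ A, U.PassesAt τ e u := by
    intro e he
    obtain ⟨u, hu, hsu, huv⟩ := R.atom_of_minimal hs hl hmin he
    refine ⟨u, ?_, hu⟩
    rw [hA]
    exact ⟨hsu, fun i j R' => (hatom i j R').trans (huv i j R')⟩
  refine R.frozen hm h2 (fun z hz hzl => hI ?_) hl
  obtain ⟨p, hp, p1, p2⟩ := hzl
  obtain ⟨u, hu, hcu⟩ := hends c (Or.inl rfl)
  obtain ⟨w, hw, hdw⟩ := hends d (Or.inr rfl)
  exact ⟨z, p, hz, hp, R.1 p p1 p2, u, hu, w, hw, c, d, hcu, hdw, p1, p2⟩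

end OneLinkoidUniverse

end Linkoid

/-! ### The mid-line of an indivisible exchange -/

namespace Linkoid

namespace OneLinkoidUniverse

variable {V : Type*} [Fintype V] {U : OneLinkoidUniverse V} {s : V → ZMod 4} {δ : Sense}
  {E : Finset V} {v w : V} {o : Option V}

/-- The trail reaches its first exchange site at the far passage of that site. -/
theorem IsMidline.exists_first (h : U.IsTour (smoothing s)) (M : U.IsMidline s δ v o) :
    ∃ z, (z = v ∨ some z = o) ∧ 0 < U.far s δ z ∧ U.far s δ z < 2 * Fintype.card V + 1 ∧
      ∀ u, (u = v ∨ some u = o) → ∀ q < U.far s δ z, ¬ IsAt (U.walk (smoothing s) q) u := by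
  have hn := near_lt h δ v
  have hf := far_pos h δ v
  rcases o with _ | w
  · obtain ⟨m1, m2⟩ := M
    refine ⟨v, Or.inl rfl, hf, by omega, ?_⟩
    rintro u (rfl | hu) q hq
    · rw [isAt_walk_iff h δ (by omega)]
      omega
    · cases hu
  · obtain ⟨hvw, m1, m2, m3, m4⟩ := M
    have hfw := far_pos h δ w
    rcases m4 with m4 | ⟨m4, m5⟩
    · refine ⟨v, Or.inl rfl, hf, by omega, ?_⟩
      rintro u (rfl | hu) q hq
      · rw [isAt_walk_iff h δ (by omega)]
        omega
      · cases hu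
        rw [isAt_walk_iff h δ (by omega)]
        omega
    · refine ⟨w, Or.inr rfl, hfw, by omega, ?_⟩
      rintro u (rfl | hu) q hq
      · rw [isAt_walk_iff h δ (by omega)]
        omega
      · cases hu
        rw [isAt_walk_iff h δ (by omega)]
        omega

/-- The half-edge opposite to the one along which the trail first arrives at an exchange site is the
half-edge across which the marker there turns first. -/
theorem IsMidline.startsMidline_iff (h : U.IsTour (smoothing s)) (M : U.IsMidline s δ v o)
    (hE : ∀ z, z ∈ E ↔ z = v ∨ some z = o) : ∃ z, (z = v ∨ some z = o) ∧
    ∀ m, U.StartsMidline (smoothing s) E m ↔ m ≤ 2 * Fintype.card V ∧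
      (U.walk (smoothing s) m = dart z (δ.lead (s z)) ∨
        U.opp (U.walk (smoothing s) m) = dart z (δ.lead (s z))) := by
  obtain ⟨z, hz, z0, z1, hfirst⟩ := M.exists_first h
  have e2 : ∀ a : ZMod 4, a + 2 + 2 = a := by decide
  -- the half-edge at which the trail arrives at its first exchange site
  have harr : U.opp (U.walk (smoothing s) (U.far s δ z - 1)) = dart z (δ.lead (s z) + 2) := by
    rw [h.opp_walk (by omega), ← walk_sub_far h]
    congr 1
    omega
  refine ⟨z, hz, fun m => and_congr_right fun hm => ⟨?_, fun hm' => ?_⟩⟩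
  · rintro ⟨p, i, y, hy, hp, hbefore, hm'⟩
    have hnext : IsAt (U.walk (smoothing s) (p + 1)) y := by
      rw [walk_succ, isAt_join, hp]
      exact ⟨i, rfl⟩
    have hp1 : U.far s δ z = p + 1 := by
      rcases lt_trichotomy (U.far s δ z) (p + 1) with hlt | heq | hgt
      · exact absurd ⟨by omega, _, walk_far h δ z⟩
          (hbefore (U.far s δ z) (by omega) z ((hE z).2 hz))
      · exact heq
      · exact absurd hnext (hfirst y ((hE y).1 hy) _ hgt)
    rw [hp1, Nat.add_sub_cancel, hp] at harr
    simp only [Sum.inl.injEq, Prod.mk.injEq] at harr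
    obtain ⟨rfl, rfl⟩ := harr
    rwa [e2] at hm'
  · refine ⟨U.far s δ z - 1, _, z, (hE z).2 hz, harr, fun q hq u hu hq' => ?_, ?_⟩
    · exact hfirst u ((hE u).1 hu) q (by omega) hq'.2
    · rwa [e2]

theorem IsMidline.onMidline_iff (h : U.IsTour (smoothing s)) (M : U.IsMidline s δ v o)
    (hE : ∀ z, z ∈ E ↔ z = v ∨ some z = o) (p : ℕ) :
    U.OnMidline (smoothing s) E p ↔
      4 * Fintype.card V + 2 - U.near s δ v < p ∧ p < U.arcStop s δ o := by
  obtain ⟨l1, l2⟩ := M.lt_arcStop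
  obtain ⟨z, hz, hstart⟩ := M.startsMidline_iff h hE
  have hn := near_lt h δ v
  have hin : ∀ q, 4 * Fintype.card V + 2 - U.near s δ v < q → q < U.arcStop s δ o →
      ∀ u ∈ E, ¬ U.PassesAt (smoothing s) q u := fun q h1 h2 u hu hq =>
    M.not_end h ((hE u).1 hu) h1 h2 hq.2
  have hbeg : ∃ u ∈ E, U.PassesAt (smoothing s) (4 * Fintype.card V + 2 - U.near s δ v) u :=
    ⟨v, (hE v).2 (Or.inl rfl), by omega, _, walk_sub_near h δ v⟩
  have hend : U.arcStop s δ o ≤ 2 * Fintype.card V →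
      ∃ u ∈ E, U.PassesAt (smoothing s) (U.arcStop s δ o) u := by
    intro hle
    rcases o with _ | w
    · simp only [arcStop] at hle
      omega
    · exact ⟨w, (hE w).2 (Or.inr rfl), hle, _, walk_near h δ w⟩
  -- the mid-line starts with its first or with its last edge
  have hm : ∃ m, U.StartsMidline (smoothing s) E m := by
    rcases hz with rfl | hz
    · exact ⟨_, (hstart _).2 ⟨by omega, Or.inl (walk_sub_near h δ z)⟩⟩
    · subst hz
      simp only [arcStop] at l1 l2
      refine ⟨U.near s δ z - 1, (hstart _).2 ⟨by omega, Or.inr ?_⟩⟩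
      rw [h.opp_walk (by omega), ← walk_sub_near h]
      congr 1
      omega
  have hm' : ∀ m, U.StartsMidline (smoothing s) E m →
      4 * Fintype.card V + 2 - U.near s δ v ≤ m ∧ m < U.arcStop s δ o := by
    intro m hsm
    obtain ⟨m1, m2⟩ := (hstart m).1 hsm
    rw [h.opp_walk (by omega), ← walk_sub_near h] at m2
    have hz1 := near_pos h δ z
    have hz2 := near_lt h δ z
    have m3 : m = 4 * Fintype.card V + 2 - U.near s δ z ∨
        4 * Fintype.card V + 1 - m = 4 * Fintype.card V + 2 - U.near s δ z := by
      rcases m2 with m2 | m2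
      · exact Or.inl (h.walk_inj (by omega) (by omega) m2)
      · exact Or.inr (h.walk_inj (by omega) (by omega) m2)
    rcases hz with rfl | hz
    · omega
    · subst hz
      simp only [arcStop] at l1 l2 ⊢
      omega
  constructor
  · rintro ⟨⟨y, hy, hpy⟩, m, hsm, hbetween⟩
    obtain ⟨m1, m2⟩ := hm' m hsm
    constructor
    · by_contra hcon
      obtain ⟨u, hu, hu'⟩ := hbeg
      by_cases hp : p = 4 * Fintype.card V + 2 - U.near s δ v
      · subst hp
        rw [hpy.unique hu'] at hy
        exact hy hu
      · exact hbetween _ (by omega) (by omega) u hu hu'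
    · by_contra hcon
      obtain ⟨u, hu, hu'⟩ := hend (by have := hpy.1; omega)
      exact hbetween _ (by omega) (by omega) u hu hu'
  · rintro ⟨p1, p2⟩
    obtain ⟨m, hsm⟩ := hm
    obtain ⟨m1, m2⟩ := hm' m hsm
    obtain ⟨y, hy⟩ := exists_isAt_walk h (k := p) (by omega) (by omega) (by omega)
    have hpy : U.PassesAt (smoothing s) p y := ⟨by omega, hy⟩
    exact ⟨⟨y, fun hyE => hin p p1 p2 y hyE hpy, hpy⟩, m, hsm, fun q q1 q2 =>
      hin q (by omega) (by omega)⟩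

/-- An indivisible exchange has a mid-line for one of the two senses. -/
theorem Indivisible.exists_isMidline [DecidableEq V] (hs : U.IsState s)
    (hX : U.IsExchange (smoothing s) (resmooth (smoothing s) E) E)
    (hI : U.Indivisible (smoothing s) E) :
    ∃ δ v o, (∀ z, z ∈ E ↔ z = v ∨ some z = o) ∧ U.IsMidline s δ v o := by
  obtain ⟨h, h', -, hcard⟩ := hX
  rw [isTrail_iff_isTour] at h h'
  have hre : ∀ (F : Finset V) z, z ∈ F ↔ resmooth (smoothing s) F z ≠ smoothing s z := by
    intro F z
    simp [resmooth]
  rcases hcard with hcard | hcard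
  · obtain ⟨v, rfl⟩ := Finset.card_eq_one.1 hcard
    have hE : ∀ z, z = v ↔ resmooth (smoothing s) {v} z ≠ smoothing s z := fun z => by
      rw [← hre, Finset.mem_singleton]
    obtain ⟨δ, M⟩ := exists_isMidline_none hs h v fun δ => not_near_lt_of_single hs h hE h' δ
    exact ⟨δ, v, none, fun z => by simp, M⟩
  · have hcard' := hcard
    obtain ⟨v, w, hvw, rfl⟩ := Finset.card_eq_two.1 hcard
    have hE : ∀ z, (z = v ∨ z = w) ↔ resmooth (smoothing s) {v, w} z ≠ smoothing s z := fun z => by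
      rw [← hre, Finset.mem_insert, Finset.mem_singleton]
    by_cases hside : ∃ x y, x ≠ y ∧ ({v, w} : Finset V) = {x, y} ∧
        ∃ δ, U.near s δ y < 2 * Fintype.card V + 1
    · obtain ⟨x, y, hxy, hxy', δ, hδ⟩ := hside
      rw [hxy'] at h' ⊢
      have hE : ∀ z, (z = x ∨ z = y) ↔ resmooth (smoothing s) {x, y} z ≠ smoothing s z :=
        fun z => by rw [← hre, Finset.mem_insert, Finset.mem_singleton]
      rcases exists_isMidline_some hs h hxy hE h' hδ with ⟨ε, M⟩ | ⟨ε, M⟩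
      · exact ⟨ε, x, some y, fun z => by simp, M⟩
      · exact ⟨ε, y, some x, fun z => by simp [or_comm], M⟩
    · exfalso
      refine hI ⟨hcard', fun y hy => isTrail_iff_isTour.2 ?_⟩
      obtain ⟨δ, M⟩ := exists_isMidline_none hs h y (fun δ hδ => hside (by
        rcases Finset.mem_insert.1 hy with rfl | hy
        · exact ⟨w, y, hvw.symm, Finset.pair_comm _ _, δ, hδ⟩
        · obtain rfl := Finset.mem_singleton.1 hy
          exact ⟨v, y, hvw, rfl, δ, hδ⟩))
      exact M.isTour_resmooth hs h fun z => by rw [← hre, Finset.mem_singleton]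

end OneLinkoidUniverse

end Linkoid

/-! ### The turns of the markers -/

namespace Linkoid

namespace OneLinkoidUniverse

variable {V : Type*} [Fintype V] {U : OneLinkoidUniverse V} {s s' : V → ZMod 4} {δ : Sense}
  {E : Finset V} {v w : V} {o : Option V}

/-- The turns of the markers across the mid-line of an indivisible exchange. -/
theorem turns_across_midline {a b : ℕ} (hE : ∀ z, z ∈ E ↔ z = v ∨ some z = o)
    (hm : ∀ p, U.OnMidline (smoothing s) E p ↔ a < p ∧ p < b)
    (h2 : ∀ u, ∃ p q, p ≠ q ∧ ∀ k, U.PassesAt (smoothing s) k u ↔ k = p ∨ k = q) :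
    (∀ u, U.OffMidline (smoothing s) E u → turns (U.walk (smoothing s)) v o a b u = 0) ∧
    (∀ u, U.IsCusp (smoothing s) E u → turns (U.walk (smoothing s)) v o a b u = 2) ∧
    (∀ c d, U.IsRider (smoothing s) E c d →
      (∀ z, U.IsCusp (smoothing s) E z → ¬ U.LiesOn (smoothing s) c d z) →
      ∀ u, U.LiesOn (smoothing s) c d u → turns (U.walk (smoothing s)) v o a b u = 0) ∧
    (∀ A, U.IsAtom (smoothing s) E A → U.IsInvolved (smoothing s) E A →
      ∀ u ∈ A, turns (U.walk (smoothing s)) v o a b u = 4) ∧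
    ∀ A, U.IsAtom (smoothing s) E A → ¬ U.IsInvolved (smoothing s) E A →
      ∀ u ∈ A, turns (U.walk (smoothing s)) v o a b u = 0 := by
  classical
  have hne : ∀ u, u ∉ E → u ≠ v ∧ some u ≠ o := fun u hu => by
    rw [hE] at hu
    push Not at hu
    exact hu
  have hon : ∀ u k, a < k → k < b → IsAt (U.walk (smoothing s) k) u →
      U.PassesAt (smoothing s) k u ∧ U.OnMidline (smoothing s) E k := fun u k k1 k2 hk => by
    have h := (hm k).2 ⟨k1, k2⟩
    obtain ⟨⟨y, -, hy⟩, -⟩ := id h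
    exact ⟨⟨hy.1, hk⟩, h⟩
  refine ⟨fun u hu => ?_, fun u hu => ?_, fun c d R hc u hu => ?_, fun A hA hI u hu => ?_,
    fun A hA hI u hu => ?_⟩
  · refine turns_of_not_isAt (hne u hu.1).1 (hne u hu.1).2 fun k k1 k2 hk => ?_
    have := hon u k k1 k2 hk
    exact hu.2 k this.1 this.2
  · rw [turns_of_not_frozen (hne u hu.1).1 (hne u hu.1).2 (hu.not_frozen hm h2)]
    obtain ⟨hu', ⟨p, hp, hpm⟩, q, hq, hqm⟩ := hu
    obtain ⟨x, y, hxy, hk⟩ := h2 u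
    have hcard : (Finset.Ioo a b).filter (fun k => IsAt (U.walk (smoothing s) k) u) = {p} := by
      ext k
      rw [Finset.mem_filter, Finset.mem_Ioo, Finset.mem_singleton]
      constructor
      · rintro ⟨⟨k1, k2⟩, k3⟩
        have k4 := hon u k k1 k2 k3
        have i1 := (hk k).1 k4.1
        have i2 := (hk p).1 hp
        have i3 := (hk q).1 hq
        have i4 : q ≠ p := by
          rintro rfl
          exact hqm hpm
        have i5 : q ≠ k := by
          rintro rfl
          exact hqm k4.2
        omega
      · rintro rfl
        exact ⟨(hm k).1 hpm, hp.2⟩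
    rw [hcard, Finset.card_singleton]
  · obtain ⟨p, hp, p1, p2⟩ := id hu
    obtain ⟨⟨y, hy, hpy⟩, -⟩ := R.1 p p1 p2
    obtain rfl := hp.unique hpy
    exact turns_of_frozen (hne u hy).1 (hne u hy).2 (R.frozen hm h2 hc hu)
  · have hself : U.IsSelfSite (smoothing s) E u := by
      obtain ⟨u₀, -, rfl⟩ := hA
      exact hu.1
    rw [turns_of_not_frozen (hne u hself.1).1 (hne u hself.1).2 (hI.not_frozen hm h2 hA hu)]
    obtain ⟨x, y, hxy, hk⟩ := h2 u
    have hcard : (Finset.Ioo a b).filter (fun k => IsAt (U.walk (smoothing s) k) u) = {x, y} := by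
      ext k
      rw [Finset.mem_filter, Finset.mem_Ioo, Finset.mem_insert, Finset.mem_singleton]
      constructor
      · rintro ⟨⟨k1, k2⟩, k3⟩
        exact (hk k).1 (hon u k k1 k2 k3).1
      · intro k1
        have k2 := (hk k).2 k1
        exact ⟨(hm k).1 (hself.2 k k2), k2.2⟩
    rw [hcard, Finset.card_pair hxy]
  · have hself : U.IsSelfSite (smoothing s) E u := by
      obtain ⟨u₀, -, rfl⟩ := hA
      exact hu.1
    exact turns_of_frozen (hne u hself.1).1 (hne u hself.1).2 (hA.frozen hm h2 hI hu)

theorem exists_passesAt (hs : U.IsState s) (h : U.IsTour (smoothing s)) (u : V) :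
    ∃ p q, p ≠ q ∧ ∀ k, U.PassesAt (smoothing s) k u ↔ k = p ∨ k = q := by
  obtain ⟨p, q, -, h1, h2, h3⟩ := exists_passages hs h u
  refine ⟨p, q, h1.ne, fun k => ⟨fun hk => (h3 k (by have := hk.1; omega)).1 hk.2, fun hk => ?_⟩⟩
  exact ⟨by omega, (h3 k (by omega)).2 hk⟩

/-- A divisible exchange that turns both markers in the same sense consists of two single exchanges,
each of which has its mid-line. -/
theorem exists_clockSequence_of_divisible [DecidableEq V] (hs : U.IsState s)
    (h : U.IsTour (smoothing s)) (hs' : U.IsState s') (h' : U.IsTour (smoothing s'))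
    (hE : ∀ z, z ∈ E ↔ smoothing s' z ≠ smoothing s z) (hδ : HasSense δ s s' E)
    (hcard : E.card = 2) (hsingle : ∀ v ∈ E, U.IsTour (resmooth (smoothing s) {v})) :
    ∃ t, U.ClockSequence δ s s' t := by
  obtain ⟨v, w, hvw, rfl⟩ := Finset.card_eq_two.1 hcard
  have hM : ∀ z ∈ ({v, w} : Finset V), ∃ ε, U.IsMidline s ε z none := fun z hz =>
    exists_isMidline_none hs h z fun ε =>
      not_near_lt_of_single hs h (fun y => by simp [resmooth]) (hsingle z hz) ε
  have hv : v ∈ ({v, w} : Finset V) := by simp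
  have hw : w ∈ ({v, w} : Finset V) := by simp
  have hE' : ∀ z, (z = v ∨ z = w) ↔ smoothing s' z ≠ smoothing s z := fun z => by
    rw [← hE, Finset.mem_insert, Finset.mem_singleton]
  obtain ⟨ε, M⟩ := hM v hv
  obtain ⟨ε', M'⟩ := hM w hw
  rcases lt_trichotomy (4 * Fintype.card V + 2 - U.near s ε v)
    (4 * Fintype.card V + 2 - U.near s ε' w) with hlt | heq | hgt
  · exact exists_clockSequence_of_separate hs h hs' h' hvw hE' (hδ v hv) (hδ w hw) M M' hlt
  · have h1 : IsAt (U.walk (smoothing s) (4 * Fintype.card V + 2 - U.near s ε v)) v :=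
      ⟨_, walk_sub_near h ε v⟩
    rw [heq] at h1
    exact absurd (h1.unique ⟨_, walk_sub_near h ε' w⟩) hvw
  · exact exists_clockSequence_of_separate hs h hs' h' hvw.symm (fun z => by rw [← hE', or_comm])
      (hδ w hw) (hδ v hv) M' M hgt

end OneLinkoidUniverse

end Linkoid

theorem mainTheorem3 {V : Type*} [Fintype V] [DecidableEq V] (U : Linkoid.OneLinkoidUniverse V)
    (s₁ s₂ : V → ZMod 4) (hs₁ : U.IsState s₁) (hs₂ : U.IsState s₂)
    (T₁ T₂ : Linkoid.Smoothing V)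
    (hT₁ : T₁ = Linkoid.smoothing s₁) (hT₂ : T₂ = Linkoid.smoothing s₂)
    (E : Finset V) (hE : U.IsExchange T₁ T₂ E) :
    (U.Indivisible T₁ E → ∃ δ, Linkoid.HasSense δ s₁ s₂ E) ∧
    ∀ δ, Linkoid.HasSense δ s₁ s₂ E →
      ∃ t : V → ℕ, U.ClockSequence δ s₁ s₂ t ∧
        (U.Indivisible T₁ E →
          (∀ v, U.OffMidline T₁ E v → t v = 0) ∧
          (∀ v ∈ E, t v = 1) ∧
          (∀ v, U.IsCusp T₁ E v → t v = 2) ∧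
          (∀ a b, U.IsRider T₁ E a b → (∀ c, U.IsCusp T₁ E c → ¬ U.LiesOn T₁ a b c) →
            ∀ v, U.LiesOn T₁ a b v → t v = 0) ∧
          (∀ A, U.IsAtom T₁ E A → U.IsInvolved T₁ E A → ∀ v ∈ A, t v = 4) ∧
          (∀ A, U.IsAtom T₁ E A → ¬ U.IsInvolved T₁ E A → ∀ v ∈ A, t v = 0) ∧
          (∀ A B, U.IsAtom T₁ E A → U.IsAtom T₁ E B → U.RidesOn T₁ A B →
            (∀ v ∈ A, 0 < t v) → ∀ v ∈ B, 0 < t v)) := by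
  subst hT₁ hT₂
  obtain ⟨h1, h2, hτ, hcard⟩ := id hE
  rw [Linkoid.OneLinkoidUniverse.isTrail_iff_isTour] at h1 h2
  have hEiff : ∀ z, z ∈ E ↔ Linkoid.smoothing s₂ z ≠ Linkoid.smoothing s₁ z := by
    intro z
    rw [hτ]
    simp [Linkoid.resmooth]
  have hpass := Linkoid.OneLinkoidUniverse.exists_passesAt hs₁ h1
  have key : U.Indivisible (Linkoid.smoothing s₁) E → ∃ δ v o,
      (∀ z, z ∈ E ↔ z = v ∨ some z = o) ∧ U.IsMidline s₁ δ v o ∧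
      U.ClockSequence δ s₁ s₂ (Linkoid.OneLinkoidUniverse.turns (U.walk (Linkoid.smoothing s₁)) v o
        (4 * Fintype.card V + 2 - U.near s₁ δ v) (U.arcStop s₁ δ o)) ∧
      Linkoid.HasSense δ s₁ s₂ E := by
    intro hI
    rw [hτ] at hE
    obtain ⟨δ, v, o, hvo, M⟩ := hI.exists_isMidline hs₁ hE
    have seq := M.clockSequence hs₁ h1 hs₂ fun z => by rw [← hvo, hEiff]
    refine ⟨δ, v, o, hvo, M, seq, fun z hz => ?_⟩
    rw [seq.apply_eq, Linkoid.OneLinkoidUniverse.turns_of_end ((hvo z).1 hz), one_nsmul]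
  refine ⟨fun hI => ?_, fun δ hδ => ?_⟩
  · obtain ⟨δ, -, -, -, -, -, hδ⟩ := key hI
    exact ⟨δ, hδ⟩
  · by_cases hI : U.Indivisible (Linkoid.smoothing s₁) E
    · obtain ⟨ε, v, o, hvo, M, seq, hε⟩ := key hI
      have hv : v ∈ E := (hvo v).2 (Or.inl rfl)
      obtain rfl : ε = δ := Linkoid.Sense.step_injective
        (add_left_cancel ((hε v hv).symm.trans (hδ v hv)))
      obtain ⟨c1, c2, c3, c4, c5⟩ := Linkoid.OneLinkoidUniverse.turns_across_midline hvo
        (M.onMidline_iff h1 hvo) hpass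
      refine ⟨_, seq, fun _ => ⟨c1, fun z hz => ?_, c2, c3, c4, c5, fun A B hA hB hAB hpos => ?_⟩⟩
      · exact Linkoid.OneLinkoidUniverse.turns_of_end ((hvo z).1 hz)
      · intro z hz
        have hAI : U.IsInvolved (Linkoid.smoothing s₁) E A := by
          by_contra hcon
          obtain ⟨u, hu, rfl⟩ := id hA
          exact (hpos u ⟨hu, fun _ _ _ => Iff.rfl⟩).ne' (c5 _ hA hcon u ⟨hu, fun _ _ _ => Iff.rfl⟩)
        rw [c4 B hB (hAI.of_ridesOn hAB) z hz]
        decide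
    · rw [Linkoid.OneLinkoidUniverse.Indivisible, not_not] at hI
      obtain ⟨t, ht⟩ := Linkoid.OneLinkoidUniverse.exists_clockSequence_of_divisible hs₁ h1 hs₂ h2
        hEiff hδ hI.1 fun z hz => Linkoid.OneLinkoidUniverse.isTrail_iff_isTour.1 (hI.2 z hz)
      exact ⟨t, ht, fun hI' => absurd hI hI'⟩
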